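/- Let $SL_3(\mathbb R)$ carry its usual topology, and let $\mathcal Q=\{C,F,N_1,N_2,N_3\}$, where $C,F,N_1,N_2,N_3\le SL_3(\mathbb R)$ are the subgroups of all matrices of the form $$ \begin{pmatrix} a&0&0\\0&b&0\\0&0&\frac1{ab}\end{pmatrix},\quad \begin{pmatrix} a&t&0\\0&a&0\\0&0&\frac1{a^2}\end{pmatrix},\quad \begin{pmatrix} 1&s&t\\0&1&s\\0&0&1\end{pmatrix},\quad \begin{pmatrix} 1&s&t\\0&1&0\\0&0&1\end{pmatrix},\quad \begin{pmatrix} 1&0&t\\0&1&s\\0&0&1\end{pmatrix} $$ respectively, with $a,b>0$ and $s,t\in\mathbb R$. Let $\Gamma$ be the directed graph with vertex set $\mathcal Q$ and arrows $C\to F$, $F\to N_1$, $N_1\to N_2$, $N_1\to N_3$. A sequence of subgroups $H_n\le SL_3(\mathbb R)$ converges to a subgroup $L$ if (a) every $h\in L$ is the limit of a sequence $h_n\in H_n$, and (b) whenever $h_n\in H_n$ for all $n$ and a subsequence of $(h_n)$ converges to $h$, then $h\in L$. A subgroup $L$ is a conjugacy limit of a subgroup $H$ if there are $P_n\in SL_3(\mathbb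 R)$ such that $P_nHP_n^{-1}$ converges to $L$; it is a 1-parameter limit of $H$ (a limit under a 1-parameter path of conjugacies) if the $P_n$ can moreover be chosen all in the image of one continuous homomorphism $\mathbb R\to SL_3(\mathbb R)$. A subgroup is called isomorphic to $\mathbb R^2$ if it is the image of an injective continuous homomorphism $\mathbb R^2\to SL_3(\mathbb R)$ (an isomorphism of Lie groups, not merely of abstract groups). Theorem. 1. Every subgroup of $SL_3(\mathbb R)$ isomorphic to $\mathbb R^2$ is conjugate in $SL_3(\mathbb R)$ to exactly one element of $\mathcal Q$. 2. If $G_1\neq G_2$ are elements of $\mathcal Q$, then $G_2$ is a conjugacy limit of $G_1$ if and only if there is a directed path in $\Gamma$ from $G_1$ to $G_2$. 3. If a subgroup $G\le SL_3(\mathbb R)$ is a conjugacy limit of $C$, then $G$ is a 1-parameter limit of $C$. Moreover, whenever there is a directed path in $\Gamma$ from $G_1$ to $G_2$, the group $G_2$ is a 1-parameter limit of $G_1$. -/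

import Mathlib

open Filter Topology

/-- The group `SL₃(ℝ)`, with the topology of entrywise convergence. -/
abbrev SL3 : Type := Matrix.SpecialLinearGroup (Fin 3) ℝ

section General

variable {G : Type*} [Group G]

/-- The conjugate `P H P⁻¹` of a subgroup `H`. -/
def conjSubgroup (P : G) (H : Subgroup G) : Subgroup G :=
  H.map (MulAut.conj P).toMonoidHom

/-- `L` is conjugate to `H`: `L = P H P⁻¹` for some `P` in the ambient group. -/
def IsConjugateTo (L H : Subgroup G) : Prop :=
  ∃ P : G, L = conjSubgroup P H

variable [TopologicalSpace G]

/-- A sequence of subgroups `H n` converges to the subgroup `L`: every element of `L` is the limit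
of a sequence of elements of the `H n`, and every subsequential limit of a sequence of elements
of the `H n` lies in `L`. -/
def SubgroupsConvergeTo (H : ℕ → Subgroup G) (L : Subgroup G) : Prop :=
  (∀ h ∈ L, ∃ u : ℕ → G, (∀ n, u n ∈ H n) ∧ Tendsto u atTop (𝓝 h)) ∧
  (∀ u : ℕ → G, (∀ n, u n ∈ H n) → ∀ h : G,
    (∃ k : ℕ → ℕ, StrictMono k ∧ Tendsto (fun n => u (k n)) atTop (𝓝 h)) → h ∈ L)

/-- `L` is a conjugacy limit of `H`. -/
def IsConjugacyLimit (L H : Subgroup G) : Prop :=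
  ∃ P : ℕ → G, SubgroupsConvergeTo (fun n => conjSubgroup (P n) H) L

/-- `L` is a 1-parameter limit of `H` (a limit under a 1-parameter path of conjugacies): all the
conjugating elements can be taken in the image of a single one-parameter subgroup, that is, of
a continuous homomorphism `φ` from the additive group `ℝ`. -/
def IsOneParameterLimit (L H : Subgroup G) : Prop :=
  ∃ φ : Multiplicative ℝ →* G, Continuous φ ∧ ∃ P : ℕ → G,
    (∀ n, P n ∈ φ.range) ∧ SubgroupsConvergeTo (fun n => conjSubgroup (P n) H) L

/-- `H` is a Lie subgroup isomorphic to the Lie group `ℝ²`: it is the image of an injective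
continuous homomorphism from `ℝ²`. No topological embedding is required, so that this covers all
subgroups that are isomorphic to `ℝ²` in the subspace topology and all immersed ones. -/
def IsIsomorphicToPlane (H : Subgroup G) : Prop :=
  ∃ φ : Multiplicative (ℝ × ℝ) →* G, Continuous φ ∧ Function.Injective φ ∧ φ.range = H

end General

/-- The positive diagonal Cartan subgroup. -/
def groupC : Subgroup SL3 where
  carrier := {g | ∃ a b : ℝ, 0 < a ∧ 0 < b ∧
    (g : Matrix (Fin 3) (Fin 3) ℝ) = !![a, 0, 0; 0, b, 0; 0, 0, 1 / (a * b)]}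
  mul_mem' := by
    rintro g h ⟨a, b, ha, hb, hg⟩ ⟨c, d, hc, hd, hh⟩
    refine ⟨a * c, b * d, by positivity, by positivity, ?_⟩
    rw [Matrix.SpecialLinearGroup.coe_mul, hg, hh]
    ext i j
    fin_cases i <;> fin_cases j <;> simp [Matrix.mul_apply, Fin.sum_univ_three]
    ring
  one_mem' := by
    refine ⟨1, 1, one_pos, one_pos, ?_⟩
    ext i j
    fin_cases i <;> fin_cases j <;> simp
  inv_mem' := by
    rintro g ⟨a, b, ha, hb, hg⟩
    refine ⟨a⁻¹, b⁻¹, by positivity, by positivity, ?_⟩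
    rw [Matrix.SpecialLinearGroup.coe_inv, hg, Matrix.adjugate_fin_three]
    ext i j
    fin_cases i <;> fin_cases j <;> simp <;> field_simp

/-- The group `F`. -/
def groupF : Subgroup SL3 where
  carrier := {g | ∃ a t : ℝ, 0 < a ∧
    (g : Matrix (Fin 3) (Fin 3) ℝ) = !![a, t, 0; 0, a, 0; 0, 0, 1 / a ^ 2]}
  mul_mem' := by
    rintro g h ⟨a, t, ha, hg⟩ ⟨c, u, hc, hh⟩
    refine ⟨a * c, a * u + t * c, by positivity, ?_⟩
    rw [Matrix.SpecialLinearGroup.coe_mul, hg, hh]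
    ext i j
    fin_cases i <;> fin_cases j <;> simp [Matrix.mul_apply, Fin.sum_univ_three]
    ring
  one_mem' := by
    refine ⟨1, 0, one_pos, ?_⟩
    ext i j
    fin_cases i <;> fin_cases j <;> simp
  inv_mem' := by
    rintro g ⟨a, t, ha, hg⟩
    refine ⟨a⁻¹, -t / a ^ 2, by positivity, ?_⟩
    rw [Matrix.SpecialLinearGroup.coe_inv, hg, Matrix.adjugate_fin_three]
    ext i j
    fin_cases i <;> fin_cases j <;> simp <;> field_simp

/-- The group `N₁`. -/
def groupN1 : Subgroup SL3 where
  carrier := {g | ∃ s t : ℝ,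
    (g : Matrix (Fin 3) (Fin 3) ℝ) = !![1, s, t; 0, 1, s; 0, 0, 1]}
  mul_mem' := by
    rintro g h ⟨s, t, hg⟩ ⟨u, v, hh⟩
    refine ⟨u + s, v + s * u + t, ?_⟩
    rw [Matrix.SpecialLinearGroup.coe_mul, hg, hh]
    ext i j
    fin_cases i <;> fin_cases j <;> simp [Matrix.mul_apply, Fin.sum_univ_three]
  one_mem' := by
    refine ⟨0, 0, ?_⟩
    ext i j
    fin_cases i <;> fin_cases j <;> simp
  inv_mem' := by
    rintro g ⟨s, t, hg⟩
    refine ⟨-s, s * s - t, ?_⟩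
    rw [Matrix.SpecialLinearGroup.coe_inv, hg, Matrix.adjugate_fin_three]
    ext i j
    fin_cases i <;> fin_cases j <;> simp

/-- The group `N₂`. -/
def groupN2 : Subgroup SL3 where
  carrier := {g | ∃ s t : ℝ,
    (g : Matrix (Fin 3) (Fin 3) ℝ) = !![1, s, t; 0, 1, 0; 0, 0, 1]}
  mul_mem' := by
    rintro g h ⟨s, t, hg⟩ ⟨u, v, hh⟩
    refine ⟨u + s, v + t, ?_⟩
    rw [Matrix.SpecialLinearGroup.coe_mul, hg, hh]
    ext i j
    fin_cases i <;> fin_cases j <;> simp [Matrix.mul_apply, Fin.sum_univ_three]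
  one_mem' := by
    refine ⟨0, 0, ?_⟩
    ext i j
    fin_cases i <;> fin_cases j <;> simp
  inv_mem' := by
    rintro g ⟨s, t, hg⟩
    refine ⟨-s, -t, ?_⟩
    rw [Matrix.SpecialLinearGroup.coe_inv, hg, Matrix.adjugate_fin_three]
    ext i j
    fin_cases i <;> fin_cases j <;> simp

/-- The group `N₃`. -/
def groupN3 : Subgroup SL3 where
  carrier := {g | ∃ s t : ℝ,
    (g : Matrix (Fin 3) (Fin 3) ℝ) = !![1, 0, t; 0, 1, s; 0, 0, 1]}
  mul_mem' := by
    rintro g h ⟨s, t, hg⟩ ⟨u, v, hh⟩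
    refine ⟨u + s, v + t, ?_⟩
    rw [Matrix.SpecialLinearGroup.coe_mul, hg, hh]
    ext i j
    fin_cases i <;> fin_cases j <;> simp [Matrix.mul_apply, Fin.sum_univ_three]
  one_mem' := by
    refine ⟨0, 0, ?_⟩
    ext i j
    fin_cases i <;> fin_cases j <;> simp
  inv_mem' := by
    rintro g ⟨s, t, hg⟩
    refine ⟨-s, -t, ?_⟩
    rw [Matrix.SpecialLinearGroup.coe_inv, hg, Matrix.adjugate_fin_three]
    ext i j
    fin_cases i <;> fin_cases j <;> simp

/-- The set `𝒬 = {C, F, N₁, N₂, N₃}` of subgroups of `SL₃(ℝ)`. -/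
def groupsQ : Set (Subgroup SL3) := {groupC, groupF, groupN1, groupN2, groupN3}

/-- The directed graph `Γ` on `𝒬`, with the arrows `C → F`, `F → N₁`, `N₁ → N₂`, `N₁ → N₃`. -/
def digraphGamma : Digraph groupsQ where
  Adj G₁ G₂ :=
    (G₁.1 = groupC ∧ G₂.1 = groupF) ∨ (G₁.1 = groupF ∧ G₂.1 = groupN1) ∨
    (G₁.1 = groupN1 ∧ G₂.1 = groupN2) ∨ (G₁.1 = groupN1 ∧ G₂.1 = groupN3)

/-- There is a directed path (with at least one arrow) in `Γ` from `G₁` to `G₂`. -/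
def HasDirectedPath (G₁ G₂ : groupsQ) : Prop :=
  Relation.TransGen digraphGamma.Adj G₁ G₂

/-! Each group in `𝒬` consists of the determinant-one matrices with positive eigenvalues in a
three-dimensional commutative algebra A of matrices with real spectrum (`IsSplitPair`). This makes
convergence a linear problem: if the three-dimensional space B of another such group consists of
limits of elements of P_n A P_n⁻¹, the groups converge (`IsSplitPair.convergeTo`). Elements of the
limit group are approximated by rescaling determinants. Conversely no limit can leave B, by counting
dimensions, and positivity survives because positive eigenvalues with product one have trace at
least 3.

Classification: a commuting family with real spectra can be conjugated into one of the five
algebras, by a Jordan form argument (`CommSplit.fitsModel`). An element of a plane has real spectrum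
(`realSplit_of_plane`): a non-real eigenvalue would yield a continuous complex character of ℝ² whose
kernel is trivial, and there is none. The eigenvalues are positive because every element is a
square, and a plane inside a model group fills it because an injective continuous additive map ℝ² →
ℝ² is linear, hence onto. For limits of `C`, compactness of the Grassmannian supplies a
subsequential limit space. It is commutative, and its spectra are real because the discriminant
stays nonnegative. So limits of `C` are conjugates of members of `𝒬`
(`IsConjugacyLimit.exists_conj`).

One-parameter limits: reaching R L R⁻¹ from `C` is the same, after conjugating the whole path, as
reaching L from R⁻¹ C R. Hence a flow is needed from every conjugate of `C` to every L in `𝒬`. For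
`N₂` and `N₃` a cyclic vector suffices; for `N₁` a suitable flag is found by the intermediate value
theorem (`limit_conj_C_N1`). A conjugate of `C` is reached from `C` because the conjugator, times a
monomial matrix normalizing `C`, can be given distinct positive eigenvalues and so lies on a
one-parameter group (`limit_conj_C_C`). For `F` a diagonal flow handles degenerate positions;
otherwise the flow contracts a plane while rotating it and is observed once per turn
(`limit_conj_C_F`).

Non-limits come from closed conditions preserved by conjugation: unipotence, vanishing discriminant,
vanishing products of nilpotent parts, and a common image or kernel of these parts. They also give
uniqueness in the classification. -/

/-- Real `3 × 3` matrices. -/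
abbrev M3 : Type := Matrix (Fin 3) (Fin 3) ℝ

/-! ### Conjugation and invariants of the characteristic polynomial -/

/-- The characteristic polynomial of `X` splits over `ℝ`. -/
def RealSplit (X : M3) : Prop :=
  ∃ a b c : ℝ, X.trace = a + b + c ∧ X.adjugate.trace = a * b + b * c + c * a ∧
    X.det = a * b * c

/-- Conjugation by an element of `SL₃(ℝ)`, on matrices. -/
def conjMat (P : SL3) : M3 ≃ₐ[ℝ] M3 where
  toFun X := (P : M3) * X * ((P⁻¹ : SL3) : M3)
  invFun X := ((P⁻¹ : SL3) : M3) * X * (P : M3)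
  left_inv X := by
    have h : ((P⁻¹ : SL3) : M3) * (P : M3) = 1 := by
      rw [← Matrix.SpecialLinearGroup.coe_mul]; simp
    calc _ = (((P⁻¹ : SL3) : M3) * (P : M3)) * X * (((P⁻¹ : SL3) : M3) * (P : M3)) := by
          simp only [mul_assoc]
      _ = X := by rw [h]; simp
  right_inv X := by
    have h : (P : M3) * ((P⁻¹ : SL3) : M3) = 1 := by
      rw [← Matrix.SpecialLinearGroup.coe_mul]; simp
    calc _ = ((P : M3) * ((P⁻¹ : SL3) : M3)) * X * ((P : M3) * ((P⁻¹ : SL3) : M3)) := by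
          simp only [mul_assoc]
      _ = X := by rw [h]; simp
  map_mul' X Y := by
    have h : ((P⁻¹ : SL3) : M3) * (P : M3) = 1 := by
      rw [← Matrix.SpecialLinearGroup.coe_mul]; simp
    calc _ = (P : M3) * X * 1 * Y * ((P⁻¹ : SL3) : M3) := by simp only [mul_assoc, one_mul]
      _ = _ := by rw [← h]; simp only [mul_assoc]
  map_add' X Y := by simp [mul_add, add_mul]
  commutes' r := by
    have h : (P : M3) * ((P⁻¹ : SL3) : M3) = 1 := by
      rw [← Matrix.SpecialLinearGroup.coe_mul]; simp
    rw [Algebra.algebraMap_eq_smul_one]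
    simp only [mul_smul_comm, smul_mul_assoc, mul_one, h]

theorem conjMat_apply (P : SL3) (X : M3) : conjMat P X = (P : M3) * X * ((P⁻¹ : SL3) : M3) := rfl

theorem conjMat_mul (P Q : SL3) (X : M3) : conjMat (P * Q) X = conjMat P (conjMat Q X) := by
  simp only [conjMat_apply, mul_inv_rev, Matrix.SpecialLinearGroup.coe_mul, mul_assoc]

theorem conjMat_one (X : M3) : conjMat 1 X = X := by
  simp [conjMat_apply]

theorem conjMat_inv_conjMat (P : SL3) (X : M3) : conjMat P⁻¹ (conjMat P X) = X := by
  rw [← conjMat_mul, inv_mul_cancel, conjMat_one]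

theorem conjMat_conjMat_inv (P : SL3) (X : M3) : conjMat P (conjMat P⁻¹ X) = X := by
  rw [← conjMat_mul, mul_inv_cancel, conjMat_one]

theorem coe_conj (P g : SL3) : ((P * g * P⁻¹ : SL3) : M3) = conjMat P g := by
  simp [conjMat_apply]

theorem trace_conjMat (P : SL3) (X : M3) : (conjMat P X).trace = X.trace := by
  rw [conjMat_apply, Matrix.trace_mul_comm, ← mul_assoc, ← Matrix.SpecialLinearGroup.coe_mul]
  simp

theorem det_conjMat (P : SL3) (X : M3) : (conjMat P X).det = X.det := by
  rw [conjMat_apply, Matrix.det_mul, Matrix.det_mul, Matrix.SpecialLinearGroup.det_coe,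
    Matrix.SpecialLinearGroup.det_coe, one_mul, mul_one]

/-- Newton's identity; it reduces conjugation invariance of the second coefficient to that of the
trace. -/
theorem trace_adjugate_eq (X : M3) :
    X.adjugate.trace = (X.trace ^ 2 - (X * X).trace) / 2 := by
  rw [Matrix.adjugate_fin_three]
  simp [Matrix.trace, Fin.sum_univ_three, Matrix.mul_apply]
  ring

theorem trace_adjugate_conjMat (P : SL3) (X : M3) :
    (conjMat P X).adjugate.trace = X.adjugate.trace := by
  rw [trace_adjugate_eq, trace_adjugate_eq, ← map_mul, trace_conjMat, trace_conjMat]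

theorem RealSplit.conjMat {X : M3} (h : RealSplit X) (P : SL3) : RealSplit (conjMat P X) := by
  rwa [RealSplit, trace_conjMat, trace_adjugate_conjMat, det_conjMat]

/-- If the elementary symmetric functions of three reals are positive then so are the reals. -/
theorem pos_of_symmetric_pos {a b c : ℝ} (h1 : 0 < a + b + c) (h2 : 0 < a * b + b * c + c * a)
    (h3 : 0 < a * b * c) : 0 < a ∧ 0 < b ∧ 0 < c := by
  have key : ∀ x y z : ℝ, 0 < x + y + z → 0 < x * y + y * z + z * x → 0 < x * y * z → 0 < x := by
    intro x y z k1 k2 k3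
    by_contra hx
    have hx : 0 ≤ -x := by linarith
    -- The polynomial (T + x)(T + y)(T + z) has positive coefficients, so it cannot vanish at the
    -- nonnegative number T = -x.
    have : (-x - -x) * (-x + y) * (-x + z) = 0 := by ring
    nlinarith [pow_nonneg hx 3, mul_nonneg (pow_nonneg hx 2) k1.le, mul_nonneg hx k2.le]
  refine ⟨key a b c h1 h2 h3, key b c a ?_ ?_ ?_, key c a b ?_ ?_ ?_⟩ <;> linarith

theorem three_le_add_of_mul_eq_one {a b c : ℝ} (ha : 0 < a) (hb : 0 < b) (hc : 0 < c)
    (h : a * b * c = 1) : 3 ≤ a + b + c := by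
  by_contra hlt
  push Not at hlt
  have hs : 0 < a + b + c := by positivity
  have amgm : 27 * (a * b * c) ≤ (a + b + c) ^ 3 := by
    nlinarith [mul_nonneg ha.le (sq_nonneg (b - c)), mul_nonneg hb.le (sq_nonneg (a - c)),
      mul_nonneg hc.le (sq_nonneg (a - b)), mul_nonneg hs.le (sq_nonneg (a - b)),
      mul_nonneg hs.le (sq_nonneg (b - c)), mul_nonneg hs.le (sq_nonneg (a - c))]
  have : (a + b + c) ^ 3 < 3 ^ 3 := pow_lt_pow_left₀ hlt hs.le (by norm_num)
  linarith

/-- AM-GM for the eigenvalues and for their pairwise products. The gap between 0 and 3 makes the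
open positivity condition stable under limits. -/
theorem RealSplit.three_le {X : M3} (h : RealSplit X) (hd : X.det = 1) (h1 : 0 < X.trace)
    (h2 : 0 < X.adjugate.trace) : 3 ≤ X.trace ∧ 3 ≤ X.adjugate.trace := by
  obtain ⟨a, b, c, e1, e2, e3⟩ := h
  rw [e1] at h1 ⊢
  rw [e2] at h2 ⊢
  rw [e3] at hd
  obtain ⟨ha, hb, hc⟩ := pos_of_symmetric_pos h1 h2 (by rw [hd]; exact one_pos)
  refine ⟨three_le_add_of_mul_eq_one ha hb hc hd, three_le_add_of_mul_eq_one
    (by positivity) (by positivity) (by positivity) ?_⟩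
  calc a * b * (b * c) * (c * a) = (a * b * c) ^ 2 := by ring
    _ = 1 := by rw [hd, one_pow]

/-! ### Linearization: limits of groups from limits of linear spaces -/

/-- `H` consists of the elements with positive eigenvalues and determinant one of the
three-dimensional space `A` of matrices with real eigenvalues. -/
structure IsSplitPair (H : Subgroup SL3) (A : Submodule ℝ M3) : Prop where
  mem_iff : ∀ g : SL3, g ∈ H ↔
    (g : M3) ∈ A ∧ 0 < (g : M3).trace ∧ 0 < (g : M3).adjugate.trace
  realSplit : ∀ X ∈ A, RealSplit X
  finrank_eq : Module.finrank ℝ A = 3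

/-- The conjugate of a space of matrices. -/
def conjSpace (P : SL3) (A : Submodule ℝ M3) : Submodule ℝ M3 := A.map (conjMat P).toLinearMap

theorem mem_conjSpace {P : SL3} {A : Submodule ℝ M3} {X : M3} :
    X ∈ conjSpace P A ↔ conjMat P⁻¹ X ∈ A := by
  constructor
  · rintro ⟨Y, hY, rfl⟩
    simpa [conjMat_inv_conjMat] using hY
  · intro h
    exact ⟨_, h, by simp [conjMat_conjMat_inv]⟩

theorem finrank_conjSpace (P : SL3) (A : Submodule ℝ M3) :
    Module.finrank ℝ (conjSpace P A) = Module.finrank ℝ A :=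
  LinearEquiv.finrank_map_eq (conjMat P).toLinearEquiv A

theorem conjMat_mem_conjSpace {P : SL3} {A : Submodule ℝ M3} {X : M3} (h : X ∈ A) :
    conjMat P X ∈ conjSpace P A :=
  ⟨X, h, rfl⟩

theorem mem_conjSubgroup {P g : SL3} {H : Subgroup SL3} :
    g ∈ conjSubgroup P H ↔ P⁻¹ * g * P ∈ H := by
  constructor
  · rintro ⟨y, hy, rfl⟩
    simpa [mul_assoc] using hy
  · intro h
    exact ⟨_, h, by simp [mul_assoc]⟩

theorem coe_inv_conj (P g : SL3) : ((P⁻¹ * g * P : SL3) : M3) = conjMat P⁻¹ g := by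
  rw [← coe_conj, inv_inv]

theorem IsSplitPair.conj {H : Subgroup SL3} {A : Submodule ℝ M3} (h : IsSplitPair H A) (P : SL3) :
    IsSplitPair (conjSubgroup P H) (conjSpace P A) where
  mem_iff g := by
    rw [mem_conjSubgroup, h.mem_iff, mem_conjSpace, coe_inv_conj, trace_conjMat,
      trace_adjugate_conjMat]
  realSplit X hX := by
    have := (h.realSplit _ (mem_conjSpace.1 hX)).conjMat P
    rwa [conjMat_conjMat_inv] at this
  finrank_eq := by
    exact (finrank_conjSpace P A).trans h.finrank_eq

/-- The space of limits of sequences in the conjugates `P n A (P n)⁻¹`. -/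
def limitSpace (P : ℕ → SL3) (A : Submodule ℝ M3) : Submodule ℝ M3 where
  carrier := {Y | ∃ X : ℕ → M3, (∀ n, X n ∈ A) ∧
    Tendsto (fun n => conjMat (P n) (X n)) atTop (𝓝 Y)}
  add_mem' := by
    rintro Y Z ⟨X, hX, hX'⟩ ⟨W, hW, hW'⟩
    exact ⟨fun n => X n + W n, fun n => A.add_mem (hX n) (hW n), by
      simpa only [map_add] using hX'.add hW'⟩
  zero_mem' := ⟨fun _ => 0, fun _ => A.zero_mem, by simp⟩
  smul_mem' := by
    rintro c Y ⟨X, hX, hX'⟩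
    exact ⟨fun n => c • X n, fun n => A.smul_mem c (hX n), by
      simpa only [map_smul] using hX'.const_smul c⟩

theorem one_mem_limitSpace {P : ℕ → SL3} {A : Submodule ℝ M3} (h : (1 : M3) ∈ A) :
    (1 : M3) ∈ limitSpace P A :=
  ⟨fun _ => 1, fun _ => h, by simp⟩

theorem mul_mem_limitSpace {P : ℕ → SL3} {A : Submodule ℝ M3}
    (h : ∀ X ∈ A, ∀ Y ∈ A, X * Y ∈ A) {Y Z : M3} (hY : Y ∈ limitSpace P A)
    (hZ : Z ∈ limitSpace P A) : Y * Z ∈ limitSpace P A := by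
  obtain ⟨X, hX, hX'⟩ := hY
  obtain ⟨W, hW, hW'⟩ := hZ
  exact ⟨fun n => X n * W n, fun n => h _ (hX n) _ (hW n), by
    simpa only [map_mul] using hX'.mul hW'⟩

theorem continuous_coe_SL3 : Continuous (fun g : SL3 => (g : M3)) := continuous_subtype_val

theorem tendsto_SL3_iff {α : Type*} {l : Filter α} {u : α → SL3} {g : SL3} :
    Tendsto u l (𝓝 g) ↔ Tendsto (fun n => (u n : M3)) l (𝓝 (g : M3)) :=
  tendsto_subtype_rng

theorem continuous_trace_adjugate : Continuous fun X : M3 => X.adjugate.trace := by fun_prop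

/-- Elements of the limit space with determinant one and positive eigenvalues are limits of
elements of the conjugate subgroups. -/
theorem IsSplitPair.exists_tendsto {H : Subgroup SL3} {A : Submodule ℝ M3} (h : IsSplitPair H A)
    {P : ℕ → SL3} {g : SL3} (hg : (g : M3) ∈ limitSpace P A) (h1 : 0 < (g : M3).trace)
    (h2 : 0 < (g : M3).adjugate.trace) :
    ∃ u : ℕ → SL3, (∀ n, u n ∈ conjSubgroup (P n) H) ∧ Tendsto u atTop (𝓝 g) := by
  classical
  obtain ⟨X, hX, hlim⟩ := hg
  set Z : ℕ → M3 := fun n => conjMat (P n) (X n) with hZ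
  have ld : Tendsto (fun n => (Z n).det) atTop (𝓝 1) := by
    have := ((continuous_id.matrix_det (n := Fin 3) (R := ℝ)).tendsto (g : M3)).comp hlim
    rw [show (1 : ℝ) = (g : M3).det from g.2.symm]
    exact this
  have lt : Tendsto (fun n => (Z n).trace) atTop (𝓝 (g : M3).trace) :=
    ((continuous_id.matrix_trace (n := Fin 3) (R := ℝ)).tendsto (g : M3)).comp hlim
  have la : Tendsto (fun n => (Z n).adjugate.trace) atTop (𝓝 (g : M3).adjugate.trace) :=
    (continuous_trace_adjugate.tendsto (g : M3)).comp hlim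
  -- Determinants are cubic in the scale, so this factor brings them back to one; it tends to one
  -- since the limit has determinant one.
  set s : ℕ → ℝ := fun n => (Z n).det ^ (-(1 / 3) : ℝ) with hs
  have ls : Tendsto s atTop (𝓝 1) := by
    have := ld.rpow_const (p := (-(1 / 3) : ℝ)) (Or.inl one_ne_zero)
    rwa [Real.one_rpow] at this
  have hdet : ∀ n, 0 < (Z n).det → (s n • Z n).det = 1 := by
    intro n hn
    rw [Matrix.det_smul, Fintype.card_fin]
    have : s n ^ 3 = (Z n).det⁻¹ := by
      rw [hs, ← Real.rpow_natCast, ← Real.rpow_mul hn.le]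
      norm_num
      rw [Real.rpow_neg_one]
    rw [this, inv_mul_cancel₀ hn.ne']
  -- The three inequalities hold for large n only; the identity is a harmless value elsewhere.
  let u : ℕ → SL3 := fun n =>
    if hn : 0 < (Z n).det ∧ 0 < (Z n).trace ∧ 0 < (Z n).adjugate.trace then
      ⟨s n • Z n, hdet n hn.1⟩ else 1
  refine ⟨u, fun n => ?_, ?_⟩
  · by_cases hn : 0 < (Z n).det ∧ 0 < (Z n).trace ∧ 0 < (Z n).adjugate.trace
    · have hu : u n = ⟨s n • Z n, hdet n hn.1⟩ := dif_pos hn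
      have hsp : 0 < s n := Real.rpow_pos_of_pos hn.1 _
      rw [(h.conj (P n)).mem_iff, hu]
      refine ⟨?_, ?_, ?_⟩
      · refine Submodule.smul_mem _ _ ⟨X n, hX n, rfl⟩
      · simpa using mul_pos hsp hn.2.1
      · simp only [Matrix.adjugate_smul, Matrix.trace_smul, smul_eq_mul]
        exact mul_pos (by positivity) hn.2.2
    · have hu : u n = 1 := dif_neg hn
      rw [hu]
      exact one_mem _
  · rw [tendsto_SL3_iff]
    have : Tendsto (fun n => s n • Z n) atTop (𝓝 (g : M3)) := by simpa using ls.smul hlim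
    refine this.congr' ?_
    filter_upwards [ld.eventually_const_lt one_pos, lt.eventually_const_lt h1,
      la.eventually_const_lt h2] with n k1 k2 k3
    have hu : u n = ⟨s n • Z n, hdet n k1⟩ := dif_pos ⟨k1, k2, k3⟩
    rw [hu]

/-- A three-dimensional space of limits contains all subsequential limits. -/
theorem mem_of_tendsto_subseq {A B : Submodule ℝ M3} {P : ℕ → SL3}
    (hA : Module.finrank ℝ A = 3) (hB : Module.finrank ℝ B = 3) (hBA : B ≤ limitSpace P A)
    {Z : ℕ → M3} (hZ : ∀ n, Z n ∈ conjSpace (P n) A) {k : ℕ → ℕ} (hk : StrictMono k) {Y : M3}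
    (hY : Tendsto (fun n => Z (k n)) atTop (𝓝 Y)) : Y ∈ B := by
  let _ : NormedAddCommGroup M3 := Matrix.normedAddCommGroup
  let _ : NormedSpace ℝ M3 := Matrix.normedSpace
  by_contra hYB
  let b := Module.finBasisOfFinrankEq ℝ B hB
  have hb : LinearIndependent ℝ (fun i => (b i : M3)) :=
    b.linearIndependent.map' B.subtype B.ker_subtype
  have hspan : Submodule.span ℝ (Set.range fun i => (b i : M3)) ≤ B :=
    Submodule.span_le.2 (by rintro _ ⟨i, rfl⟩; exact (b i).2)
  -- Linear independence is an open condition: four independent limits would force four independent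
  -- vectors in a three-dimensional conjugate of A.
  have hind : LinearIndependent ℝ (Fin.cons Y (fun i => (b i : M3)) : Fin 4 → M3) :=
    linearIndependent_finCons.2 ⟨hb, fun h => hYB (hspan h)⟩
  choose X hX hlim using fun i => hBA (b i).2
  have ht : Tendsto (fun n => (Fin.cons (Z (k n)) fun i => conjMat (P (k n)) (X i (k n)) :
      Fin 4 → M3)) atTop (𝓝 (Fin.cons Y (fun i => (b i : M3)))) := by
    rw [tendsto_pi_nhds]
    intro i
    refine Fin.cases ?_ (fun j => ?_) i
    · simpa using hY
    · exact (hlim j).comp hk.tendsto_atTop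
  obtain ⟨n, hn⟩ := (ht.eventually hind.eventually).exists
  have hin : ∀ i, (Fin.cons (Z (k n)) fun i => conjMat (P (k n)) (X i (k n)) : Fin 4 → M3) i ∈
      conjSpace (P (k n)) A := by
    intro i
    refine Fin.cases ?_ (fun j => ?_) i
    · simpa using hZ (k n)
    · exact conjMat_mem_conjSpace (hX j (k n))
  have h4 : LinearIndependent ℝ (fun i => (⟨_, hin i⟩ : conjSpace (P (k n)) A)) :=
    LinearIndependent.of_comp (conjSpace (P (k n)) A).subtype hn
  have hc := h4.fintype_card_le_finrank
  have hf : Module.finrank ℝ (conjSpace (P (k n)) A) = 3 := by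
    exact (finrank_conjSpace _ A).trans hA
  rw [hf, Fintype.card_fin] at hc
  omega

/-- Subsequential limits of elements of the conjugate subgroups. -/
theorem IsSplitPair.mem_of_tendsto {H : Subgroup SL3} {A B : Submodule ℝ M3}
    (h : IsSplitPair H A) {P : ℕ → SL3} (hB : Module.finrank ℝ B = 3)
    (hBA : B ≤ limitSpace P A) {u : ℕ → SL3} (hu : ∀ n, u n ∈ conjSubgroup (P n) H)
    {k : ℕ → ℕ} (hk : StrictMono k) {g : SL3} (hg : Tendsto (fun n => u (k n)) atTop (𝓝 g)) :
    (g : M3) ∈ B ∧ 0 < (g : M3).trace ∧ 0 < (g : M3).adjugate.trace := by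
  rw [tendsto_SL3_iff] at hg
  have key : ∀ n, 3 ≤ (u n : M3).trace ∧ 3 ≤ (u n : M3).adjugate.trace := by
    intro n
    have := ((h.conj (P n)).mem_iff (u n)).1 (hu n)
    exact ((h.conj (P n)).realSplit _ this.1).three_le (by simp) this.2.1 this.2.2
  refine ⟨mem_of_tendsto_subseq h.finrank_eq hB hBA (Z := fun n => (u n : M3))
    (fun n => (((h.conj (P n)).mem_iff (u n)).1 (hu n)).1) hk hg, ?_, ?_⟩
  · have lt : Tendsto (fun n => (u (k n) : M3).trace) atTop (𝓝 (g : M3).trace) :=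
      ((continuous_id.matrix_trace (n := Fin 3) (R := ℝ)).tendsto (g : M3)).comp hg
    linarith [ge_of_tendsto' lt fun n => (key (k n)).1]
  · have la : Tendsto (fun n => (u (k n) : M3).adjugate.trace) atTop
        (𝓝 (g : M3).adjugate.trace) :=
      (continuous_trace_adjugate.tendsto (g : M3)).comp hg
    linarith [ge_of_tendsto' la fun n => (key (k n)).2]

/-- One linear inclusion gives both halves of convergence, because A and B have the same dimension.
-/
theorem IsSplitPair.convergeTo {H L : Subgroup SL3} {A B : Submodule ℝ M3}
    (h : IsSplitPair H A) (hL : IsSplitPair L B) {P : ℕ → SL3} (hBA : B ≤ limitSpace P A) :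
    SubgroupsConvergeTo (fun n => conjSubgroup (P n) H) L := by
  refine ⟨fun g hg => ?_, fun u hu g ⟨k, hk, hlim⟩ => ?_⟩
  · obtain ⟨h0, h1, h2⟩ := (hL.mem_iff g).1 hg
    exact h.exists_tendsto (hBA h0) h1 h2
  · exact (hL.mem_iff g).2 (h.mem_of_tendsto hL.finrank_eq hBA hu hk hlim)

/-! ### The five model algebras -/

/-- Diagonal matrices. -/
def paramC : (Fin 3 → ℝ) →ₗ[ℝ] M3 where
  toFun v := !![v 0, 0, 0; 0, v 1, 0; 0, 0, v 2]
  map_add' v w := by ext i j; fin_cases i <;> fin_cases j <;> simp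
  map_smul' c v := by ext i j; fin_cases i <;> fin_cases j <;> simp

/-- The commutative algebra spanned by `F`. -/
def paramF : (Fin 3 → ℝ) →ₗ[ℝ] M3 where
  toFun v := !![v 0, v 1, 0; 0, v 0, 0; 0, 0, v 2]
  map_add' v w := by ext i j; fin_cases i <;> fin_cases j <;> simp
  map_smul' c v := by ext i j; fin_cases i <;> fin_cases j <;> simp

/-- The commutative algebra spanned by `N₁`. -/
def paramN1 : (Fin 3 → ℝ) →ₗ[ℝ] M3 where
  toFun v := !![v 0, v 1, v 2; 0, v 0, v 1; 0, 0, v 0]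
  map_add' v w := by ext i j; fin_cases i <;> fin_cases j <;> simp
  map_smul' c v := by ext i j; fin_cases i <;> fin_cases j <;> simp

/-- The commutative algebra spanned by `N₂`. -/
def paramN2 : (Fin 3 → ℝ) →ₗ[ℝ] M3 where
  toFun v := !![v 0, v 1, v 2; 0, v 0, 0; 0, 0, v 0]
  map_add' v w := by ext i j; fin_cases i <;> fin_cases j <;> simp
  map_smul' c v := by ext i j; fin_cases i <;> fin_cases j <;> simp

/-- The commutative algebra spanned by `N₃`. -/
def paramN3 : (Fin 3 → ℝ) →ₗ[ℝ] M3 where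
  toFun v := !![v 0, 0, v 2; 0, v 0, v 1; 0, 0, v 0]
  map_add' v w := by ext i j; fin_cases i <;> fin_cases j <;> simp
  map_smul' c v := by ext i j; fin_cases i <;> fin_cases j <;> simp

theorem paramC_apply (v : Fin 3 → ℝ) : paramC v = !![v 0, 0, 0; 0, v 1, 0; 0, 0, v 2] := rfl
theorem paramF_apply (v : Fin 3 → ℝ) : paramF v = !![v 0, v 1, 0; 0, v 0, 0; 0, 0, v 2] := rfl
theorem paramN1_apply (v : Fin 3 → ℝ) :
    paramN1 v = !![v 0, v 1, v 2; 0, v 0, v 1; 0, 0, v 0] := rfl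
theorem paramN2_apply (v : Fin 3 → ℝ) :
    paramN2 v = !![v 0, v 1, v 2; 0, v 0, 0; 0, 0, v 0] := rfl
theorem paramN3_apply (v : Fin 3 → ℝ) :
    paramN3 v = !![v 0, 0, v 2; 0, v 0, v 1; 0, 0, v 0] := rfl

theorem trace_upper (a b c x y z : ℝ) : (!![a, x, y; 0, b, z; 0, 0, c] : M3).trace = a + b + c := by
  simp [Matrix.trace, Fin.sum_univ_three]

theorem trace_adjugate_upper (a b c x y z : ℝ) :
    (!![a, x, y; 0, b, z; 0, 0, c] : M3).adjugate.trace = a * b + b * c + c * a := by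
  rw [Matrix.adjugate_fin_three]
  simp [Matrix.trace, Fin.sum_univ_three]
  ring

theorem det_upper (a b c x y z : ℝ) : (!![a, x, y; 0, b, z; 0, 0, c] : M3).det = a * b * c := by
  simp [Matrix.det_fin_three]

theorem realSplit_upper (a b c x y z : ℝ) : RealSplit !![a, x, y; 0, b, z; 0, 0, c] :=
  ⟨a, b, c, trace_upper .., trace_adjugate_upper .., det_upper ..⟩

theorem finrank_range_three {f : (Fin 3 → ℝ) →ₗ[ℝ] M3} (hf : ∀ v, f v = 0 → v = 0) :
    Module.finrank ℝ (LinearMap.range f) = 3 := by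
  rw [LinearMap.finrank_range_of_inj ((injective_iff_map_eq_zero f).2 hf)]
  simp

theorem vec3_eq_zero {v : Fin 3 → ℝ} (h0 : v 0 = 0) (h1 : v 1 = 0) (h2 : v 2 = 0) : v = 0 := by
  ext i; fin_cases i <;> simpa

theorem isSplitPair_C : IsSplitPair groupC (LinearMap.range paramC) where
  mem_iff g := by
    constructor
    · rintro ⟨a, b, ha, hb, hg⟩
      have hc : 0 < 1 / (a * b) := by positivity
      refine ⟨⟨![a, b, 1 / (a * b)], by rw [hg]; rfl⟩, ?_, ?_⟩
      · rw [hg, trace_upper]; positivity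
      · rw [hg, trace_adjugate_upper]; positivity
    · rintro ⟨⟨v, hv⟩, h1, h2⟩
      have hd := g.2
      change (g : M3).det = 1 at hd
      rw [paramC_apply] at hv
      rw [← hv, trace_upper] at h1
      rw [← hv, trace_adjugate_upper] at h2
      rw [← hv, det_upper] at hd
      obtain ⟨h0, h1, h2⟩ := pos_of_symmetric_pos h1 h2 (by rw [hd]; exact one_pos)
      refine ⟨v 0, v 1, h0, h1, ?_⟩
      rw [← hv, eq_one_div_of_mul_eq_one_right hd]
  realSplit := by
    rintro _ ⟨v, rfl⟩
    exact realSplit_upper ..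
  finrank_eq := finrank_range_three fun v hv => by
    rw [paramC_apply, ← Matrix.ext_iff] at hv
    exact vec3_eq_zero (by simpa using hv 0 0) (by simpa using hv 1 1) (by simpa using hv 2 2)

theorem isSplitPair_F : IsSplitPair groupF (LinearMap.range paramF) where
  mem_iff g := by
    constructor
    · rintro ⟨a, t, ha, hg⟩
      have hc : 0 < 1 / a ^ 2 := by positivity
      refine ⟨⟨![a, t, 1 / a ^ 2], by rw [hg]; rfl⟩, ?_, ?_⟩
      · rw [hg, trace_upper]; positivity
      · rw [hg, trace_adjugate_upper]; positivity
    · rintro ⟨⟨v, hv⟩, h1, h2⟩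
      have hd := g.2
      change (g : M3).det = 1 at hd
      rw [paramF_apply] at hv
      rw [← hv, trace_upper] at h1
      rw [← hv, trace_adjugate_upper] at h2
      rw [← hv, det_upper] at hd
      obtain ⟨h0, h1, h2⟩ := pos_of_symmetric_pos h1 h2 (by rw [hd]; exact one_pos)
      refine ⟨v 0, v 1, h0, ?_⟩
      rw [← hv, eq_one_div_of_mul_eq_one_right hd, sq]
  realSplit := by
    rintro _ ⟨v, rfl⟩
    exact realSplit_upper ..
  finrank_eq := finrank_range_three fun v hv => by
    rw [paramF_apply, ← Matrix.ext_iff] at hv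
    exact vec3_eq_zero (by simpa using hv 0 0) (by simpa using hv 0 1) (by simpa using hv 2 2)

theorem eq_one_of_mul_self_mul_self {a : ℝ} (h : a * a * a = 1) : a = 1 := by
  have : (a - 1) * ((a + 1 / 2) ^ 2 + 3 / 4) = 0 := by linarith
  rcases mul_eq_zero.1 this with h | h
  · linarith
  · nlinarith [sq_nonneg (a + 1 / 2)]

/-- The only real cube root of one is one, so here the determinant alone fixes the diagonal and
positivity is automatic. The same happens for `N₂` and `N₃`. -/
theorem isSplitPair_N1 : IsSplitPair groupN1 (LinearMap.range paramN1) where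
  mem_iff g := by
    constructor
    · rintro ⟨s, t, hg⟩
      refine ⟨⟨![1, s, t], by rw [hg]; rfl⟩, ?_, ?_⟩
      · rw [hg, trace_upper]; norm_num
      · rw [hg, trace_adjugate_upper]; norm_num
    · rintro ⟨⟨v, hv⟩, -, -⟩
      have hd := g.2
      change (g : M3).det = 1 at hd
      rw [paramN1_apply] at hv
      rw [← hv, det_upper] at hd
      exact ⟨v 1, v 2, by rw [← hv, eq_one_of_mul_self_mul_self hd]⟩
  realSplit := by
    rintro _ ⟨v, rfl⟩
    exact realSplit_upper ..
  finrank_eq := finrank_range_three fun v hv => by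
    rw [paramN1_apply, ← Matrix.ext_iff] at hv
    exact vec3_eq_zero (by simpa using hv 0 0) (by simpa using hv 0 1) (by simpa using hv 0 2)

theorem isSplitPair_N2 : IsSplitPair groupN2 (LinearMap.range paramN2) where
  mem_iff g := by
    constructor
    · rintro ⟨s, t, hg⟩
      refine ⟨⟨![1, s, t], by rw [hg]; rfl⟩, ?_, ?_⟩
      · rw [hg, trace_upper]; norm_num
      · rw [hg, trace_adjugate_upper]; norm_num
    · rintro ⟨⟨v, hv⟩, -, -⟩
      have hd := g.2
      change (g : M3).det = 1 at hd
      rw [paramN2_apply] at hv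
      rw [← hv, det_upper] at hd
      exact ⟨v 1, v 2, by rw [← hv, eq_one_of_mul_self_mul_self hd]⟩
  realSplit := by
    rintro _ ⟨v, rfl⟩
    exact realSplit_upper ..
  finrank_eq := finrank_range_three fun v hv => by
    rw [paramN2_apply, ← Matrix.ext_iff] at hv
    exact vec3_eq_zero (by simpa using hv 0 0) (by simpa using hv 0 1) (by simpa using hv 0 2)

theorem isSplitPair_N3 : IsSplitPair groupN3 (LinearMap.range paramN3) where
  mem_iff g := by
    constructor
    · rintro ⟨s, t, hg⟩
      refine ⟨⟨![1, s, t], by rw [hg]; rfl⟩, ?_, ?_⟩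
      · rw [hg, trace_upper]; norm_num
      · rw [hg, trace_adjugate_upper]; norm_num
    · rintro ⟨⟨v, hv⟩, -, -⟩
      have hd := g.2
      change (g : M3).det = 1 at hd
      rw [paramN3_apply] at hv
      rw [← hv, det_upper] at hd
      exact ⟨v 1, v 2, by rw [← hv, eq_one_of_mul_self_mul_self hd]⟩
  realSplit := by
    rintro _ ⟨v, rfl⟩
    exact realSplit_upper ..
  finrank_eq := finrank_range_three fun v hv => by
    rw [paramN3_apply, ← Matrix.ext_iff] at hv
    exact vec3_eq_zero (by simpa using hv 0 0) (by simpa using hv 1 2) (by simpa using hv 0 2)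

/-! ### Transport of limits under automorphisms -/

theorem map_conjSubgroup {G : Type*} [Group G] (e : G ≃* G) (P : G) (H : Subgroup G) :
    (conjSubgroup P H).map e.toMonoidHom = conjSubgroup (e P) (H.map e.toMonoidHom) := by
  ext g
  simp [conjSubgroup, Subgroup.mem_map]

theorem SubgroupsConvergeTo.map {G : Type*} [Group G] [TopologicalSpace G] (e : G ≃* G)
    (he : Continuous e) (he' : Continuous e.symm) {H : ℕ → Subgroup G} {L : Subgroup G}
    (h : SubgroupsConvergeTo H L) :
    SubgroupsConvergeTo (fun n => (H n).map e.toMonoidHom) (L.map e.toMonoidHom) := by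
  refine ⟨?_, ?_⟩
  · rintro _ ⟨g, hg, rfl⟩
    obtain ⟨u, hu, hlim⟩ := h.1 g hg
    exact ⟨fun n => e (u n), fun n => ⟨u n, hu n, rfl⟩, (he.tendsto g).comp hlim⟩
  · rintro u hu g ⟨k, hk, hlim⟩
    refine ⟨e.symm g, h.2 (fun n => e.symm (u n)) (fun n => ?_) _
      ⟨k, hk, (he'.tendsto g).comp hlim⟩, e.apply_symm_apply g⟩
    obtain ⟨y, hy, hyu⟩ := hu n
    have hyu : e y = u n := hyu
    change e.symm (u n) ∈ H n
    rwa [← hyu, e.symm_apply_apply]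

theorem IsOneParameterLimit.map {G : Type*} [Group G] [TopologicalSpace G] (e : G ≃* G)
    (he : Continuous e) (he' : Continuous e.symm) {H L : Subgroup G}
    (h : IsOneParameterLimit L H) :
    IsOneParameterLimit (L.map e.toMonoidHom) (H.map e.toMonoidHom) := by
  obtain ⟨φ, hφ, P, hP, hlim⟩ := h
  refine ⟨e.toMonoidHom.comp φ, he.comp hφ, fun n => e (P n), fun n => ?_, ?_⟩
  · obtain ⟨t, ht⟩ := hP n
    exact ⟨t, congrArg e ht⟩
  · simpa only [map_conjSubgroup] using hlim.map e he he'

theorem IsOneParameterLimit.conj {L H : Subgroup SL3} (h : IsOneParameterLimit L H) (Q : SL3) :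
    IsOneParameterLimit (conjSubgroup Q L) (conjSubgroup Q H) := by
  refine h.map (MulAut.conj Q) ?_ ?_
  · change Continuous fun g => Q * g * Q⁻¹
    fun_prop
  · change Continuous fun g => Q⁻¹ * g * Q
    fun_prop

theorem conjSubgroup_mul {G : Type*} [Group G] (P Q : G) (H : Subgroup G) :
    conjSubgroup (P * Q) H = conjSubgroup P (conjSubgroup Q H) := by
  rw [conjSubgroup, conjSubgroup, conjSubgroup, Subgroup.map_map, map_mul]
  rfl

theorem conjSubgroup_one {G : Type*} [Group G] (H : Subgroup G) : conjSubgroup 1 H = H := by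
  ext g
  simp [conjSubgroup]

/-- Multiplying the P_n by a fixed matrix would leave the one-parameter group, whereas conjugating
the whole path does not. The price is a conjugated starting group, so flows must be built from all
conjugates. -/
theorem IsOneParameterLimit.of_conj {L H : Subgroup SL3} {Q : SL3}
    (h : IsOneParameterLimit L (conjSubgroup Q⁻¹ H)) :
    IsOneParameterLimit (conjSubgroup Q L) H := by
  have := h.conj Q
  rwa [← conjSubgroup_mul, mul_inv_cancel, conjSubgroup_one] at this

theorem IsOneParameterLimit.isConjugacyLimit {L H : Subgroup SL3} (h : IsOneParameterLimit L H) :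
    IsConjugacyLimit L H := by
  obtain ⟨φ, -, P, -, hP⟩ := h
  exact ⟨P, hP⟩

/-! ### Flows -/

/-- A one-parameter group of matrices of determinant one. -/
def flowHom (φ : ℝ → M3) (h0 : φ 0 = 1) (hadd : ∀ s t, φ (s + t) = φ s * φ t)
    (hdet : ∀ t, (φ t).det = 1) : Multiplicative ℝ →* SL3 where
  toFun t := ⟨φ t.toAdd, hdet _⟩
  map_one' := Subtype.ext h0
  map_mul' s t := Subtype.ext (hadd s.toAdd t.toAdd)

theorem IsSplitPair.isOneParameterLimit {H L : Subgroup SL3} {A B : Submodule ℝ M3}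
    (h : IsSplitPair H A) (hL : IsSplitPair L B) {φ : Multiplicative ℝ →* SL3}
    (hφ : Continuous φ) {P : ℕ → SL3} (hP : ∀ n, P n ∈ φ.range) (hBA : B ≤ limitSpace P A) :
    IsOneParameterLimit L H :=
  ⟨φ, hφ, P, hP, h.convergeTo hL hBA⟩

/-- The one-parameter group `diag(exp(w i * t))` in `SL₃(ℝ)`. -/
noncomputable def diagHom (w : Fin 3 → ℝ) (hw : w 0 + w 1 + w 2 = 0) : Multiplicative ℝ →* SL3 :=
  flowHom (fun t => Matrix.diagonal fun i => Real.exp (w i * t)) (by simp)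
    (fun s t => by simp [mul_add, Real.exp_add])
    (fun t => by
      rw [Matrix.det_diagonal, Fin.prod_univ_three, ← Real.exp_add, ← Real.exp_add, ← add_mul,
        ← add_mul, hw, zero_mul, Real.exp_zero])

theorem continuous_diagHom (w : Fin 3 → ℝ) (hw : w 0 + w 1 + w 2 = 0) :
    Continuous (diagHom w hw) := by
  refine Continuous.subtype_mk (f := fun t : Multiplicative ℝ =>
    (Matrix.diagonal fun i => Real.exp (w i * t.toAdd) : M3)) ?_ _
  refine Continuous.matrix_diagonal (continuous_pi fun i => ?_)
  exact Real.continuous_exp.comp (continuous_const.mul continuous_toAdd)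

theorem coe_diagHom (w : Fin 3 → ℝ) (hw : w 0 + w 1 + w 2 = 0) (t : ℝ) :
    (diagHom w hw (Multiplicative.ofAdd t) : M3) =
      Matrix.diagonal fun i => Real.exp (w i * t) := rfl

theorem conjMat_diagHom (w : Fin 3 → ℝ) (hw : w 0 + w 1 + w 2 = 0) (t : ℝ) (X : M3) (i j : Fin 3) :
    conjMat (diagHom w hw (Multiplicative.ofAdd t)) X i j =
      Real.exp ((w i - w j) * t) * X i j := by
  rw [conjMat_apply, ← map_inv, ← ofAdd_neg, coe_diagHom, coe_diagHom, Matrix.mul_diagonal,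
    Matrix.diagonal_mul, mul_right_comm, ← Real.exp_add]
  congr 2
  ring

/-- The limits under a conjugated diagonal flow: the entries of the highest weight `κ` survive. -/
theorem mem_limitSpace_diagHom {w : Fin 3 → ℝ} {hw : w 0 + w 1 + w 2 = 0} {S : SL3}
    {A : Submodule ℝ M3} {D E : M3} (κ : ℝ) (hD : conjMat S D ∈ A)
    (hE : ∀ i j, (κ < w i - w j ∧ D i j = 0 ∧ E i j = 0) ∨ (w i - w j = κ ∧ E i j = D i j) ∨
      (w i - w j < κ ∧ E i j = 0)) :
    conjMat S E ∈ limitSpace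
      (fun n : ℕ => S * diagHom w hw (Multiplicative.ofAdd (n : ℝ)) * S⁻¹) A := by
  -- A is linear, so the flow may be renormalized by its growth rate: weight κ becomes constant,
  -- lower weights decay, and higher weights are absent by hypothesis.
  refine ⟨fun n => Real.exp (-κ * n) • conjMat S D, fun n => A.smul_mem _ hD, ?_⟩
  have hs : ∀ n : ℕ, conjMat (S * diagHom w hw (Multiplicative.ofAdd (n : ℝ)) * S⁻¹)
      (Real.exp (-κ * n) • conjMat S D) = conjMat S (Real.exp (-κ * n) •
        conjMat (diagHom w hw (Multiplicative.ofAdd (n : ℝ))) D) := by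
    intro n
    simp only [conjMat_mul, map_smul, conjMat_inv_conjMat]
  simp only [hs]
  have hc : Continuous (conjMat S) := by
    change Continuous fun X : M3 => (S : M3) * X * ((S⁻¹ : SL3) : M3)
    fun_prop
  refine (hc.tendsto E).comp ?_
  refine tendsto_pi_nhds.2 fun i => tendsto_pi_nhds.2 fun j => ?_
  have heq : ∀ n : ℕ, (Real.exp (-κ * n) •
      conjMat (diagHom w hw (Multiplicative.ofAdd (n : ℝ))) D) i j =
      Real.exp ((w i - w j - κ) * n) * D i j := by
    intro n
    rw [Matrix.smul_apply, conjMat_diagHom, smul_eq_mul, ← mul_assoc, ← Real.exp_add]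
    congr 2
    ring
  simp only [heq]
  rcases hE i j with ⟨-, h1, h2⟩ | ⟨h1, h2⟩ | ⟨h1, h2⟩
  · simp [h1, h2]
  · simp [h1, h2]
  · rw [h2]
    have : Tendsto (fun n : ℕ => Real.exp ((w i - w j - κ) * n)) atTop (𝓝 0) := by
      refine Real.tendsto_exp_atBot.comp ?_
      exact tendsto_natCast_atTop_atTop.const_mul_atTop_of_neg (by linarith)
    simpa using this.mul_const (D i j)

/-- Upper unipotent matrices. -/
def unip (a b c : ℝ) : SL3 := ⟨!![1, a, b; 0, 1, c; 0, 0, 1], by rw [det_upper]; norm_num⟩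

theorem coe_unip (a b c : ℝ) : (unip a b c : M3) = !![1, a, b; 0, 1, c; 0, 0, 1] := rfl

theorem coe_unip_inv (a b c : ℝ) :
    (((unip a b c)⁻¹ : SL3) : M3) = !![1, -a, a * c - b; 0, 1, -c; 0, 0, 1] := by
  rw [Matrix.SpecialLinearGroup.coe_inv, coe_unip, Matrix.adjugate_fin_three]
  ext i j
  fin_cases i <;> fin_cases j <;> simp

theorem conj_diagHom_mem_range (S : SL3) (w : Fin 3 → ℝ) (hw : w 0 + w 1 + w 2 = 0) (t : ℝ) :
    S * diagHom w hw (Multiplicative.ofAdd t) * S⁻¹ ∈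
      ((MulAut.conj S).toMonoidHom.comp (diagHom w hw)).range :=
  ⟨Multiplicative.ofAdd t, rfl⟩

theorem continuous_conj_diagHom (S : SL3) (w : Fin 3 → ℝ) (hw : w 0 + w 1 + w 2 = 0) :
    Continuous ((MulAut.conj S).toMonoidHom.comp (diagHom w hw)) := by
  change Continuous fun t => S * diagHom w hw t * S⁻¹
  have := continuous_diagHom w hw
  fun_prop

open scoped Matrix in
/-- If a row vector with first entry one is cyclic for `A`, then `N₂` is a limit. -/
theorem IsSplitPair.limit_N2 {H : Subgroup SL3} {A : Submodule ℝ M3} (h : IsSplitPair H A)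
    (h1 : (1 : M3) ∈ A) (a b : ℝ)
    (hs : ∀ y z : ℝ, ∃ X ∈ A, ![1, a, b] ᵥ* X = ![0, y, z]) : IsOneParameterLimit groupN2 H := by
  -- The entries (1,2) and (1,3) have the top weight 3. `S` is chosen so that the row vector (1, a,
  -- b) becomes the first row of S⁻¹; cyclicity then prescribes these two entries freely, with zero
  -- in the corner (1,1).
  set w : Fin 3 → ℝ := ![2, -1, -1] with hw'
  have hw : w 0 + w 1 + w 2 = 0 := by simp [w]; norm_num
  set S : SL3 := (unip a b 0)⁻¹ with hS
  have hS1 : (S : M3) = !![1, -a, -b; 0, 1, 0; 0, 0, 1] := by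
    rw [hS, coe_unip_inv]; simp
  have hS2 : ((S⁻¹ : SL3) : M3) = !![1, a, b; 0, 1, 0; 0, 0, 1] := by
    rw [hS, inv_inv, coe_unip]
  refine h.isOneParameterLimit isSplitPair_N2 (continuous_conj_diagHom S w hw)
    (P := fun n : ℕ => S * diagHom w hw (Multiplicative.ofAdd (n : ℝ)) * S⁻¹)
    (fun n => conj_diagHom_mem_range S w hw n) ?_
  rintro _ ⟨v, rfl⟩
  have key : ∀ y z : ℝ, (!![0, y, z; 0, 0, 0; 0, 0, 0] : M3) ∈ limitSpace
      (fun n : ℕ => S * diagHom w hw (Multiplicative.ofAdd (n : ℝ)) * S⁻¹) A := by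
    intro y z
    obtain ⟨X, hX, hX'⟩ := hs y z
    have e0 := congrFun hX' 0
    have e1 := congrFun hX' 1
    have e2 := congrFun hX' 2
    simp [Matrix.vecMul, dotProduct, Fin.sum_univ_three] at e0 e1 e2
    have hE : conjMat S !![0, y, z; 0, 0, 0; 0, 0, 0] = !![0, y, z; 0, 0, 0; 0, 0, 0] := by
      rw [conjMat_apply, hS1, hS2]
      ext i j
      fin_cases i <;> fin_cases j <;> simp [Matrix.mul_apply, Fin.sum_univ_three]
    rw [← hE]
    refine mem_limitSpace_diagHom (D := conjMat S⁻¹ X) 3 (by rwa [conjMat_conjMat_inv]) ?_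
    have d1 : conjMat S⁻¹ X 0 1 = y := by
      rw [conjMat_apply, hS2, inv_inv, hS1]
      simp [Matrix.mul_apply, Matrix.vecMul, dotProduct, Fin.sum_univ_three]
      linear_combination e1 - a * e0
    have d2 : conjMat S⁻¹ X 0 2 = z := by
      rw [conjMat_apply, hS2, inv_inv, hS1]
      simp [Matrix.mul_apply, Matrix.vecMul, dotProduct, Fin.sum_univ_three]
      linear_combination e2 - b * e0
    intro i j
    fin_cases i <;> fin_cases j <;> simp [w, d1, d2] <;> norm_num
  have := (limitSpace (fun n : ℕ => S * diagHom w hw (Multiplicative.ofAdd (n : ℝ)) * S⁻¹)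
    A).add_mem (key (v 1) (v 2)) (Submodule.smul_mem _ (v 0) (one_mem_limitSpace h1))
  convert this using 1
  rw [paramN2_apply]
  ext i j
  fin_cases i <;> fin_cases j <;> simp

open scoped Matrix in
/-- If a column vector with last entry one is cyclic for `A`, then `N₃` is a limit. -/
theorem IsSplitPair.limit_N3 {H : Subgroup SL3} {A : Submodule ℝ M3} (h : IsSplitPair H A)
    (h1 : (1 : M3) ∈ A) (a b : ℝ)
    (hs : ∀ y z : ℝ, ∃ X ∈ A, X *ᵥ ![a, b, 1] = ![y, z, 0]) : IsOneParameterLimit groupN3 H := by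
  set w : Fin 3 → ℝ := ![1, 1, -2] with hw'
  have hw : w 0 + w 1 + w 2 = 0 := by simp [w]; norm_num
  set S : SL3 := unip 0 a b with hS
  have hS1 : (S : M3) = !![1, 0, a; 0, 1, b; 0, 0, 1] := rfl
  have hS2 : ((S⁻¹ : SL3) : M3) = !![1, 0, -a; 0, 1, -b; 0, 0, 1] := by
    rw [hS, coe_unip_inv]; simp
  refine h.isOneParameterLimit isSplitPair_N3 (continuous_conj_diagHom S w hw)
    (P := fun n : ℕ => S * diagHom w hw (Multiplicative.ofAdd (n : ℝ)) * S⁻¹)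
    (fun n => conj_diagHom_mem_range S w hw n) ?_
  rintro _ ⟨v, rfl⟩
  have key : ∀ y z : ℝ, (!![0, 0, y; 0, 0, z; 0, 0, 0] : M3) ∈ limitSpace
      (fun n : ℕ => S * diagHom w hw (Multiplicative.ofAdd (n : ℝ)) * S⁻¹) A := by
    intro y z
    obtain ⟨X, hX, hX'⟩ := hs y z
    have e0 := congrFun hX' 0
    have e1 := congrFun hX' 1
    have e2 := congrFun hX' 2
    simp [Matrix.mulVec, dotProduct, Fin.sum_univ_three] at e0 e1 e2
    have hE : conjMat S !![0, 0, y; 0, 0, z; 0, 0, 0] = !![0, 0, y; 0, 0, z; 0, 0, 0] := by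
      rw [conjMat_apply, hS1, hS2]
      ext i j
      fin_cases i <;> fin_cases j <;> simp [Matrix.mul_apply, Fin.sum_univ_three]
    rw [← hE]
    refine mem_limitSpace_diagHom (D := conjMat S⁻¹ X) 3 (by rwa [conjMat_conjMat_inv]) ?_
    have d1 : conjMat S⁻¹ X 0 2 = y := by
      rw [conjMat_apply, hS2, inv_inv, hS1]
      simp [Matrix.mul_apply, Matrix.vecMul, dotProduct, Fin.sum_univ_three]
      linear_combination e0 - a * e2
    have d2 : conjMat S⁻¹ X 1 2 = z := by
      rw [conjMat_apply, hS2, inv_inv, hS1]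
      simp [Matrix.mul_apply, Matrix.vecMul, dotProduct, Fin.sum_univ_three]
      linear_combination e1 - b * e2
    intro i j
    fin_cases i <;> fin_cases j <;> simp [w, d1, d2] <;> norm_num
  have := (limitSpace (fun n : ℕ => S * diagHom w hw (Multiplicative.ofAdd (n : ℝ)) * S⁻¹)
    A).add_mem (key (v 2) (v 1)) (Submodule.smul_mem _ (v 0) (one_mem_limitSpace h1))
  convert this using 1
  rw [paramN3_apply]
  ext i j
  fin_cases i <;> fin_cases j <;> simp

open scoped Matrix in
/-- A criterion for `N₁` to be a limit. -/
theorem IsSplitPair.limit_N1 {H : Subgroup SL3} {A : Submodule ℝ M3} (h : IsSplitPair H A)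
    (h1 : (1 : M3) ∈ A) (hmul : ∀ X ∈ A, ∀ Y ∈ A, X * Y ∈ A) {D : M3} (hD : D ∈ A)
    {a x y κ α β γ : ℝ} (hκ : κ ≠ 0)
    (hf3 : D *ᵥ ![x, y, 1] = κ • ![a, 1, 0] + α • ![x, y, 1])
    (hf2 : D *ᵥ ![a, 1, 0] = κ • ![1, 0, 0] + β • ![a, 1, 0] + γ • ![x, y, 1]) :
    IsOneParameterLimit groupN1 H := by
  -- The columns of `S` are e₁, (a, 1, 0) and (x, y, 1). In this basis `D` has zero in the only
  -- entry of weight 2 and κ in both entries of weight 1, so a multiple of the regular nilpotent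
  -- survives. Equality of the two entries puts the limit in the algebra of `N₁` itself and not
  -- merely in a conjugate.
  set w : Fin 3 → ℝ := ![1, 0, -1] with hw'
  have hw : w 0 + w 1 + w 2 = 0 := by simp [w]
  set S : SL3 := unip a x y with hS
  have hS1 : (S : M3) = !![1, a, x; 0, 1, y; 0, 0, 1] := rfl
  have hS2 : ((S⁻¹ : SL3) : M3) = !![1, -a, a * y - x; 0, 1, -y; 0, 0, 1] := by
    rw [hS, coe_unip_inv]
  refine h.isOneParameterLimit isSplitPair_N1 (continuous_conj_diagHom S w hw)
    (P := fun n : ℕ => S * diagHom w hw (Multiplicative.ofAdd (n : ℝ)) * S⁻¹)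
    (fun n => conj_diagHom_mem_range S w hw n) ?_
  rintro _ ⟨v, rfl⟩
  set P : ℕ → SL3 := fun n : ℕ => S * diagHom w hw (Multiplicative.ofAdd (n : ℝ)) * S⁻¹ with hP
  have key : (!![0, κ, κ * (a - y); 0, 0, κ; 0, 0, 0] : M3) ∈ limitSpace P A := by
    have e0 := congrFun hf3 0
    have e1 := congrFun hf3 1
    have e2 := congrFun hf3 2
    have k0 := congrFun hf2 0
    have k1 := congrFun hf2 1
    have k2 := congrFun hf2 2
    simp [Matrix.mulVec, dotProduct, Fin.sum_univ_three] at e0 e1 e2 k0 k1 k2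
    have hE : conjMat S !![0, κ, 0; 0, 0, κ; 0, 0, 0] =
        !![0, κ, κ * (a - y); 0, 0, κ; 0, 0, 0] := by
      rw [conjMat_apply, hS1, hS2]
      ext i j
      fin_cases i <;> fin_cases j <;> simp [Matrix.mul_apply, Fin.sum_univ_three] <;> ring
    rw [← hE]
    refine mem_limitSpace_diagHom (D := conjMat S⁻¹ D) 1 (by rwa [conjMat_conjMat_inv]) ?_
    have d1 : conjMat S⁻¹ D 0 1 = κ := by
      rw [conjMat_apply, hS2, inv_inv, hS1]
      simp [Matrix.mul_apply, Matrix.vecMul, dotProduct, Fin.sum_univ_three]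
      linear_combination k0 - a * k1 + (a * y - x) * k2
    have d2 : conjMat S⁻¹ D 1 2 = κ := by
      rw [conjMat_apply, hS2, inv_inv, hS1]
      simp [Matrix.mul_apply, Matrix.vecMul, dotProduct, Fin.sum_univ_three]
      linear_combination e1 - y * e2
    have d3 : conjMat S⁻¹ D 0 2 = 0 := by
      rw [conjMat_apply, hS2, inv_inv, hS1]
      simp [Matrix.mul_apply, Matrix.vecMul, dotProduct, Fin.sum_univ_three]
      linear_combination e0 - a * e1 + (a * y - x) * e2
    intro i j
    fin_cases i <;> fin_cases j <;> simp [w, d1, d2, d3] <;> norm_num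
  -- The limit space inherits closure under products, so 1, the surviving nilpotent and its square
  -- span everything required.
  have k2 := mul_mem_limitSpace hmul key key
  have k0 := one_mem_limitSpace (P := P) h1
  have := (limitSpace P A).add_mem ((limitSpace P A).add_mem
    (Submodule.smul_mem _ (v 0) k0) (Submodule.smul_mem _ (v 1 / κ) key))
    (Submodule.smul_mem _ ((v 2 - v 1 * (a - y)) / κ ^ 2) k2)
  convert this using 1
  rw [paramN1_apply]
  ext i j
  fin_cases i <;> fin_cases j <;> simp <;> field_simp
  ring

/-! ### Limits of `F` and `N₁` -/

theorem one_mem_range_paramF : (1 : M3) ∈ LinearMap.range paramF :=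
  ⟨![1, 0, 1], by rw [paramF_apply]; ext i j; fin_cases i <;> fin_cases j <;> simp⟩

theorem one_mem_range_paramN1 : (1 : M3) ∈ LinearMap.range paramN1 :=
  ⟨![1, 0, 0], by rw [paramN1_apply]; ext i j; fin_cases i <;> fin_cases j <;> simp⟩

theorem mul_mem_range_paramF : ∀ X ∈ LinearMap.range paramF, ∀ Y ∈ LinearMap.range paramF,
    X * Y ∈ LinearMap.range paramF := by
  rintro _ ⟨v, rfl⟩ _ ⟨w, rfl⟩
  refine ⟨![v 0 * w 0, v 0 * w 1 + v 1 * w 0, v 2 * w 2], ?_⟩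
  simp only [paramF_apply]
  ext i j
  fin_cases i <;> fin_cases j <;> simp [Matrix.mul_apply, Fin.sum_univ_three]

theorem limit_F_N1 : IsOneParameterLimit groupN1 groupF := by
  -- The basis of the flag is e₁, e₁ + e₂, e₂ + e₃.
  refine isSplitPair_F.limit_N1 one_mem_range_paramF mul_mem_range_paramF
    (D := paramF ![0, -1, 1]) ⟨_, rfl⟩ (a := 1) (x := 0) (y := 1) (κ := -1) (α := 1) (β := 0)
    (γ := 0) (by norm_num) ?_ ?_ <;>
  · rw [paramF_apply]
    ext i
    fin_cases i <;> simp [Matrix.mulVec, dotProduct, Fin.sum_univ_three]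

theorem limit_F_N2 : IsOneParameterLimit groupN2 groupF := by
  refine isSplitPair_F.limit_N2 one_mem_range_paramF 0 1 fun y z =>
    ⟨paramF ![0, y, z], ⟨_, rfl⟩, ?_⟩
  rw [paramF_apply]
  ext i
  fin_cases i <;> simp [Matrix.vecMul, dotProduct, Fin.sum_univ_three]

theorem limit_N1_N2 : IsOneParameterLimit groupN2 groupN1 := by
  refine isSplitPair_N1.limit_N2 one_mem_range_paramN1 0 0 fun y z =>
    ⟨paramN1 ![0, y, z], ⟨_, rfl⟩, ?_⟩
  rw [paramN1_apply]
  ext i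
  fin_cases i <;> simp [Matrix.vecMul, dotProduct, Fin.sum_univ_three]

theorem limit_N1_N3 : IsOneParameterLimit groupN3 groupN1 := by
  refine isSplitPair_N1.limit_N3 one_mem_range_paramN1 0 0 fun y z =>
    ⟨paramN1 ![0, z, y], ⟨_, rfl⟩, ?_⟩
  rw [paramN1_apply]
  ext i
  fin_cases i <;> simp [Matrix.mulVec, dotProduct, Fin.sum_univ_three]

theorem limit_F_N3 : IsOneParameterLimit groupN3 groupF := by
  refine isSplitPair_F.limit_N3 one_mem_range_paramF 0 1 fun y z =>
    ⟨paramF ![z, y, 0], ⟨_, rfl⟩, ?_⟩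
  rw [paramF_apply]
  ext i
  fin_cases i <;> simp [Matrix.mulVec, dotProduct, Fin.sum_univ_three]

/-! ### From conjugates of `C` to `N₂` and `N₃` -/

theorem one_mem_conjSpace {A : Submodule ℝ M3} (h : (1 : M3) ∈ A) (P : SL3) :
    (1 : M3) ∈ conjSpace P A :=
  mem_conjSpace.2 (by rwa [map_one])

theorem mul_mem_conjSpace {A : Submodule ℝ M3} (h : ∀ X ∈ A, ∀ Y ∈ A, X * Y ∈ A) (P : SL3) :
    ∀ X ∈ conjSpace P A, ∀ Y ∈ conjSpace P A, X * Y ∈ conjSpace P A := by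
  intro X hX Y hY
  rw [mem_conjSpace] at *
  rw [map_mul]
  exact h _ hX _ hY

theorem diagonal_mem_range_paramC (d : Fin 3 → ℝ) :
    Matrix.diagonal d ∈ LinearMap.range paramC :=
  ⟨d, by rw [paramC_apply]; ext i j; fin_cases i <;> fin_cases j <;> simp⟩

theorem paramC_eq_diagonal (d : Fin 3 → ℝ) : paramC d = Matrix.diagonal d := by
  rw [paramC_apply]; ext i j; fin_cases i <;> fin_cases j <;> simp

theorem one_mem_range_paramC : (1 : M3) ∈ LinearMap.range paramC := by
  rw [← Matrix.diagonal_one]; exact diagonal_mem_range_paramC _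

theorem mul_mem_range_paramC : ∀ X ∈ LinearMap.range paramC, ∀ Y ∈ LinearMap.range paramC,
    X * Y ∈ LinearMap.range paramC := by
  rintro _ ⟨v, rfl⟩ _ ⟨w, rfl⟩
  rw [paramC_eq_diagonal, paramC_eq_diagonal, Matrix.diagonal_mul_diagonal]
  exact diagonal_mem_range_paramC _

theorem coe_mul_coe_inv (R : SL3) : (R : M3) * ((R⁻¹ : SL3) : M3) = 1 := by
  rw [← Matrix.SpecialLinearGroup.coe_mul, mul_inv_cancel, Matrix.SpecialLinearGroup.coe_one]

theorem coe_inv_mul_coe (R : SL3) : ((R⁻¹ : SL3) : M3) * (R : M3) = 1 := by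
  rw [← Matrix.SpecialLinearGroup.coe_mul, inv_mul_cancel, Matrix.SpecialLinearGroup.coe_one]

/-- A quadratic curve avoids three given planes. -/
theorem exists_quadratic_ne_zero (v : Fin 3 → Fin 3 → ℝ) (hv : ∀ i, v i ≠ 0) :
    ∃ t : ℝ, ∀ i, v i 0 + t * v i 1 + t ^ 2 * v i 2 ≠ 0 := by
  let p : Fin 3 → Polynomial ℝ := fun i =>
    Polynomial.C (v i 0) + Polynomial.X * Polynomial.C (v i 1) +
      Polynomial.X ^ 2 * Polynomial.C (v i 2)
  have hp : ∀ i, p i ≠ 0 := by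
    intro i hi
    refine hv i (vec3_eq_zero ?_ ?_ ?_)
    · simpa [p, Polynomial.coeff_X, Polynomial.coeff_C, Polynomial.coeff_X_pow]
        using congrArg (fun q => q.coeff 0) hi
    · simpa [p, Polynomial.coeff_X, Polynomial.coeff_C, Polynomial.coeff_X_pow]
        using congrArg (fun q => q.coeff 1) hi
    · simpa [p, Polynomial.coeff_X, Polynomial.coeff_C, Polynomial.coeff_X_pow]
        using congrArg (fun q => q.coeff 2) hi
  have hprod : ∏ i, p i ≠ 0 := Finset.prod_ne_zero_iff.2 fun i _ => hp i
  by_contra hcon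
  push Not at hcon
  refine hprod (Polynomial.funext fun t => ?_)
  obtain ⟨i, hi⟩ := hcon t
  rw [Polynomial.eval_prod, Polynomial.eval_zero]
  exact Finset.prod_eq_zero (Finset.mem_univ i) (by
    simp only [p, Polynomial.eval_add, Polynomial.eval_mul, Polynomial.eval_pow,
      Polynomial.eval_C, Polynomial.eval_X]
    exact hi)

-- A row vector w is cyclic for R C R⁻¹ exactly when no entry of wR vanishes. The curve (1, t, t²)
-- leaves the three forbidden planes at some t, and dividing entry by entry by wR then solves for
-- the diagonal matrix.
open scoped Matrix in
theorem limit_conj_C_N2 (R : SL3) : IsOneParameterLimit groupN2 (conjSubgroup R groupC) := by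
  obtain ⟨t, ht⟩ := exists_quadratic_ne_zero (fun i j => (R : M3) j i) (fun i hi => by
    have := congrFun (congrFun (coe_inv_mul_coe R) i) i
    rw [Matrix.mul_apply] at this
    have h0 : ∀ j, (R : M3) j i = 0 := fun j => congrFun hi j
    simp [h0] at this)
  refine (isSplitPair_C.conj R).limit_N2 (one_mem_conjSpace one_mem_range_paramC R) t (t ^ 2)
    fun y z => ?_
  set w : Fin 3 → ℝ := ![1, t, t ^ 2] with hw
  have hne : ∀ i, (w ᵥ* (R : M3)) i ≠ 0 := by
    intro i
    have := ht i
    simpa [w, Matrix.vecMul, dotProduct, Fin.sum_univ_three] using this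
  refine ⟨conjMat R (Matrix.diagonal fun i => (![0, y, z] ᵥ* (R : M3)) i / (w ᵥ* (R : M3)) i),
    conjMat_mem_conjSpace (diagonal_mem_range_paramC _), ?_⟩
  have e1 : w ᵥ* ((R : M3) * (Matrix.diagonal fun i => (![0, y, z] ᵥ* (R : M3)) i /
      (w ᵥ* (R : M3)) i)) = ![0, y, z] ᵥ* (R : M3) := by
    rw [← Matrix.vecMul_vecMul]
    ext i
    rw [Matrix.vecMul_diagonal, mul_div_cancel₀ _ (hne i)]
  rw [conjMat_apply, ← Matrix.vecMul_vecMul, e1, Matrix.vecMul_vecMul, coe_mul_coe_inv,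
    Matrix.vecMul_one]

-- The same argument for column vectors and R⁻¹; the curve is reversed so that the last entry is
-- one.
open scoped Matrix in
theorem limit_conj_C_N3 (R : SL3) : IsOneParameterLimit groupN3 (conjSubgroup R groupC) := by
  obtain ⟨t, ht⟩ := exists_quadratic_ne_zero
    (fun i j => ((R⁻¹ : SL3) : M3) i (Fin.rev j)) (fun i hi => by
    have := congrFun (congrFun (coe_inv_mul_coe R) i) i
    rw [Matrix.mul_apply] at this
    have h0 : ∀ j, ((R⁻¹ : SL3) : M3) i j = 0 := fun j => by
      simpa using congrFun hi (Fin.rev j)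
    simp only [h0] at this
    simp at this)
  refine (isSplitPair_C.conj R).limit_N3 (one_mem_conjSpace one_mem_range_paramC R) (t ^ 2) t
    fun y z => ?_
  set w : Fin 3 → ℝ := ![t ^ 2, t, 1] with hw
  set W : M3 := ((R⁻¹ : SL3) : M3) with hW
  have hne : ∀ i, (W *ᵥ w) i ≠ 0 := by
    intro i
    have := ht i
    have e : (W *ᵥ w) i = W i (Fin.rev 0) + t * W i (Fin.rev 1) + t ^ 2 * W i (Fin.rev 2) := by
      simp only [w, Matrix.mulVec, dotProduct, Fin.sum_univ_three]
      change W i 0 * t ^ 2 + W i 1 * t + W i 2 * 1 = W i 2 + t * W i 1 + t ^ 2 * W i 0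
      ring
    rwa [e]
  refine ⟨conjMat R (Matrix.diagonal fun i => (W *ᵥ ![y, z, 0]) i / (W *ᵥ w) i),
    conjMat_mem_conjSpace (diagonal_mem_range_paramC _), ?_⟩
  have e1 : (Matrix.diagonal fun i => (W *ᵥ ![y, z, 0]) i / (W *ᵥ w) i) *ᵥ (W *ᵥ w) =
      W *ᵥ ![y, z, 0] := by
    ext i
    rw [Matrix.mulVec_diagonal, div_mul_cancel₀ _ (hne i)]
  rw [conjMat_apply, ← Matrix.mulVec_mulVec, ← Matrix.mulVec_mulVec, e1, Matrix.mulVec_mulVec,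
    coe_mul_coe_inv, Matrix.one_mulVec]

/-! ### From conjugates of `C` to `N₁` -/

/-- The equation behind the degeneration of `C` to `N₁`, solved by continuity. -/
theorem exists_regular_flag (p q r : ℝ) : ∃ ε ξ k u : ℝ, ε ≠ 0 ∧ k ≠ 0 ∧
    k = p * ε * ξ + 1 - r * ε ^ 2 * ξ - q * ε ∧ u * k = (2 - r * ε ^ 2 * ξ - q * ε) * ξ ∧
    u - (r * ε * u + q) * ε * ξ - (p * ε * u - (r * ε * u + q) * ε) * u = k := by
  let K : ℝ → ℝ → ℝ := fun ε ξ => p * ε * ξ + 1 - r * ε ^ 2 * ξ - q * ε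
  let U : ℝ → ℝ → ℝ := fun ε ξ => (2 - r * ε ^ 2 * ξ - q * ε) * ξ / K ε ξ
  let g : ℝ → ℝ → ℝ := fun ε ξ => U ε ξ - (r * ε * U ε ξ + q) * ε * ξ -
    (p * ε * U ε ξ - (r * ε * U ε ξ + q) * ε) * U ε ξ - K ε ξ
  have hK : ∀ ξ, ContinuousAt (fun ε => K ε ξ) 0 := fun ξ => by fun_prop
  have hK0 : ∀ ξ, K 0 ξ = 1 := fun ξ => by simp [K]
  have hU : ContinuousAt (fun ε => U ε 1) 0 := by
    refine ContinuousAt.div (by fun_prop) (hK 1) ?_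
    rw [hK0]; exact one_ne_zero
  have hU0 : U 0 1 = 2 := by simp [U, hK0]
  have hg : ContinuousAt (fun ε => g ε 1) 0 := by
    have := hK 1
    fun_prop
  have hg0 : g 0 1 = 1 := by simp [g, hU0, hK0]; norm_num
  -- At ε = 0 one has K = 1 and g = 2ξ - 1, which changes sign on [0, 1]. The sign change persists
  -- for small ε ≠ 0.
  have ev : ∀ᶠ ε in 𝓝 (0 : ℝ), 0 < K ε 0 ∧ 0 < K ε 1 ∧ 0 < g ε 1 := by
    refine ((hK 0).eventually_const_lt (by simp only [hK0]; exact one_pos)).and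
      (((hK 1).eventually_const_lt (by simp only [hK0]; exact one_pos)).and
      (hg.eventually_const_lt (by simp only [hg0]; exact one_pos)))
  obtain ⟨ε, ⟨h0, h1, h2⟩, hε⟩ :=
    ((ev.filter_mono nhdsWithin_le_nhds).and (self_mem_nhdsWithin (a := (0 : ℝ))
      (s := {(0 : ℝ)}ᶜ))).exists
  have hpos : ∀ ξ ∈ Set.Icc (0 : ℝ) 1, 0 < K ε ξ := by
    intro ξ hξ
    -- K is affine in ξ, so positivity at the endpoints is enough.
    have : K ε ξ = (1 - ξ) * K ε 0 + ξ * K ε 1 := by simp only [K]; ring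
    rw [this]
    rcases eq_or_lt_of_le hξ.1 with h | h
    · rw [← h]; simpa using h0
    · have : 0 ≤ (1 - ξ) * K ε 0 := mul_nonneg (by linarith [hξ.2]) h0.le
      nlinarith
  have hcK : ContinuousOn (fun ξ => K ε ξ) (Set.Icc 0 1) := by fun_prop
  have hcU : ContinuousOn (fun ξ => U ε ξ) (Set.Icc 0 1) :=
    ContinuousOn.div (by fun_prop) hcK fun ξ hξ => (hpos ξ hξ).ne'
  have hcg : ContinuousOn (fun ξ => g ε ξ) (Set.Icc 0 1) := by fun_prop
  have hgz : g ε 0 ≤ 0 := by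
    have : U ε 0 = 0 := by simp [U]
    simp only [g, this]
    linarith
  obtain ⟨ξ, hξ, hgξ⟩ := intermediate_value_Icc zero_le_one hcg ⟨hgz, h2.le⟩
  refine ⟨ε, ξ, K ε ξ, U ε ξ, hε, (hpos ξ hξ).ne', rfl, div_mul_cancel₀ _ (hpos ξ hξ).ne', ?_⟩
  have hgξ : g ε ξ = 0 := hgξ
  linear_combination hgξ

/-- The last row is nonzero at some c. If all 2 × 2 minors of the last two rows through column c
vanished, these rows would be proportional. After a suitable ordering of the columns of R the
trailing minors are thus nonzero. -/
theorem exists_trailing_minors_ne_zero (R : SL3) : ∃ b c : Fin 3, b ≠ c ∧ (R : M3) 2 c ≠ 0 ∧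
    (R : M3) 1 b * (R : M3) 2 c - (R : M3) 1 c * (R : M3) 2 b ≠ 0 := by
  have hd : (R : M3).det = 1 := R.2
  have h1 : ∃ c, (R : M3) 2 c ≠ 0 := by
    by_contra h
    push Not at h
    rw [Matrix.det_fin_three] at hd
    simp [h] at hd
  obtain ⟨c, hc⟩ := h1
  by_contra h
  push Not at h
  have key : ∀ b, (R : M3) 1 b * (R : M3) 2 c = (R : M3) 1 c * (R : M3) 2 b := by
    intro b
    by_cases hb : b = c
    · rw [hb]
    · linarith [h b c hb hc]
  have : (R : M3) 2 c * (R : M3).det = 0 := by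
    rw [Matrix.det_fin_three]
    linear_combination ((R : M3) 0 0 * (R : M3) 2 2 - (R : M3) 0 2 * (R : M3) 2 0) * key 1 +
      ((R : M3) 0 1 * (R : M3) 2 0 - (R : M3) 0 0 * (R : M3) 2 1) * key 2 +
      ((R : M3) 0 2 * (R : M3) 2 1 - (R : M3) 0 1 * (R : M3) 2 2) * key 0
  rw [hd, mul_one] at this
  exact hc this

open scoped Matrix in
theorem conjMat_diagonal_mulVec (R : SL3) (d : Fin 3 → ℝ) (i : Fin 3) :
    conjMat R (Matrix.diagonal d) *ᵥ (fun k => (R : M3) k i) = d i • fun k => (R : M3) k i := by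
  have e : (fun k => (R : M3) k i) = (R : M3) *ᵥ Pi.single i 1 := by
    rw [Matrix.mulVec_single_one]; rfl
  rw [e, conjMat_apply, Matrix.mulVec_mulVec, mul_assoc, coe_inv_mul_coe, mul_one,
    ← Matrix.mulVec_mulVec, ← Matrix.mulVec_smul]
  congr 1
  ext k
  rw [Matrix.mulVec_diagonal]
  by_cases hk : k = i
  · subst hk; simp
  · simp [hk]

-- A traceless element D of the algebra with eigenvalues 1, 0, -1 is written in a basis e₁, g₂, g₃
-- which is upper unitriangular in the standard basis. The flag required by the criterion for `N₁`
-- is a small perturbation of this one.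
open scoped Matrix in
theorem limit_conj_C_N1 (R : SL3) : IsOneParameterLimit groupN1 (conjSubgroup R groupC) := by
  obtain ⟨b, c, hbc, hc, hm⟩ := exists_trailing_minors_ne_zero R
  set d : Fin 3 → ℝ := fun k => if k = c then -1 else if k = b then 0 else 1 with hd
  set D : M3 := conjMat R (Matrix.diagonal d) with hD
  have hdc : d c = -1 := by simp [d]
  have hdb : d b = 0 := by simp [d, hbc]
  have htr : D.trace = 0 := by
    rw [hD, trace_conjMat, Matrix.trace_diagonal, Fin.sum_univ_three]
    clear_value D
    clear hD hdc hdb hm hc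
    fin_cases b <;> fin_cases c <;> simp [d] at hbc ⊢
  have hDc := conjMat_diagonal_mulVec R d c
  have hDb := conjMat_diagonal_mulVec R d b
  rw [← hD, hdc] at hDc
  rw [← hD, hdb, zero_smul] at hDb
  -- g₃ = (x₃, y₃, 1) is the normalized eigenvector of column c. g₂ = (s, 1, 0) is the combination
  -- of columns b and c with last entry zero, so D g₃ = -g₃ and D g₂ = q g₃.
  set ρ : ℝ := (R : M3) 2 b / (R : M3) 2 c with hρ
  set η : ℝ := (R : M3) 1 b - ρ * (R : M3) 1 c with hη
  have hη0 : η ≠ 0 := by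
    intro h
    apply hm
    have : η * (R : M3) 2 c = 0 := by rw [h, zero_mul]
    rw [hη, hρ, sub_mul] at this
    field_simp at this
    linarith
  set x₃ : ℝ := (R : M3) 0 c / (R : M3) 2 c with hx₃
  set y₃ : ℝ := (R : M3) 1 c / (R : M3) 2 c with hy₃
  set s : ℝ := ((R : M3) 0 b - ρ * (R : M3) 0 c) / η with hs
  set q : ℝ := ρ * (R : M3) 2 c / η with hq
  have ec : ![x₃, y₃, 1] = ((R : M3) 2 c)⁻¹ • fun k => (R : M3) k c := by
    ext i
    fin_cases i <;> simp [x₃, y₃, div_eq_inv_mul, hc]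
  have eb : ![s, 1, 0] = η⁻¹ • ((fun k => (R : M3) k b) - ρ • fun k => (R : M3) k c) := by
    ext i
    fin_cases i
    · simp [s, div_eq_inv_mul]
    · simp [← hη, hη0]
    · simp [hρ, hc]
  have hg3 : D *ᵥ ![x₃, y₃, 1] = -![x₃, y₃, 1] := by
    rw [ec, Matrix.mulVec_smul, hDc]; simp
  have hg2 : D *ᵥ ![s, 1, 0] = q • ![x₃, y₃, 1] := by
    rw [eb, Matrix.mulVec_smul, Matrix.mulVec_sub, Matrix.mulVec_smul, hDb, hDc, ec, smul_smul,
      hq]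
    ext i
    simp
    field_simp
  have a0 := congrFun hg3 0
  have a1 := congrFun hg3 1
  have a2 := congrFun hg3 2
  have b0 := congrFun hg2 0
  have b1 := congrFun hg2 1
  have b2 := congrFun hg2 2
  simp [Matrix.mulVec, dotProduct, Fin.sum_univ_three] at a0 a1 a2 b0 b1 b2
  rw [Matrix.trace, Fin.sum_univ_three] at htr
  simp only [Matrix.diag_apply] at htr
  clear_value D s q x₃ y₃
  set r : ℝ := D 2 0 with hr
  set p : ℝ := D 1 0 - r * y₃ with hp
  -- Vanishing trace forces D e₁ = e₁ + p g₂ + r g₃.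
  have c0 : D 0 0 = 1 + p * s + r * x₃ := by
    rw [hp]; linear_combination htr - b1 - a2 + y₃ * b2
  have c1 : D 1 0 = p + r * y₃ := by rw [hp]; ring
  -- The new basis is e₁, g₂ + εu e₁, g₃ + ε g₂ + ε²ξ e₁. The three equations equate the two
  -- superdiagonal entries of D with εk and make the corner zero.
  obtain ⟨ε, ξ, k, u, hε, hk, ek, eu, eg⟩ := exists_regular_flag p q r
  refine (isSplitPair_C.conj R).limit_N1 (one_mem_conjSpace one_mem_range_paramC R)
    (mul_mem_conjSpace mul_mem_range_paramC R) (D := D)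
    (by rw [hD]; exact conjMat_mem_conjSpace (diagonal_mem_range_paramC d))
    (a := ε * u + s) (x := ε ^ 2 * ξ + ε * s + x₃) (y := ε + y₃) (κ := ε * k)
    (α := -1 + r * ε ^ 2 * ξ + q * ε) (β := p * ε * u - (r * ε * u + q) * ε)
    (γ := r * ε * u + q) (mul_ne_zero hε hk) ?_ ?_
  · ext i
    fin_cases i <;> simp [Matrix.mulVec, dotProduct, Fin.sum_univ_three]
    · linear_combination (ε ^ 2 * ξ) * c0 + ε * b0 + a0 - ε ^ 2 * eu - ε * s * ek
    · linear_combination (ε ^ 2 * ξ) * c1 + ε * b1 + a1 - ε * ek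
    · linear_combination ε * b2 + a2
  · ext i
    fin_cases i <;> simp [Matrix.mulVec, dotProduct, Fin.sum_univ_three]
    · linear_combination (ε * u) * c0 + b0 + ε * eg
    · linear_combination (ε * u) * c1 + b1
    · linear_combination b2

/-! ### Diagonalization, and from `C` to its conjugates -/

open scoped Matrix in
/-- Eigenvectors for distinct eigenvalues are the columns of an invertible matrix. -/
theorem isUnit_of_eigenvectors {K : Type*} [Field K] {M : Matrix (Fin 3) (Fin 3) K}
    {l : Fin 3 → K} (hl : Function.Injective l) {v : Fin 3 → Fin 3 → K} (hv : ∀ i, v i ≠ 0)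
    (hv' : ∀ i, M *ᵥ v i = l i • v i) : IsUnit (Matrix.of fun i j => v j i) := by
  have hlin : LinearIndependent K v :=
    Module.End.eigenvectors_linearIndependent' (Matrix.toLin' M) l hl v fun i =>
      Module.End.hasEigenvector_iff.2 ⟨Module.End.mem_eigenspace_iff.2 (by simpa using hv' i), hv i⟩
  rw [← Matrix.linearIndependent_cols_iff_isUnit]
  exact hlin

open scoped Matrix in
theorem mul_of_eigenvectors {K : Type*} [Field K] {M : Matrix (Fin 3) (Fin 3) K}
    {l : Fin 3 → K} {v : Fin 3 → Fin 3 → K} (hv' : ∀ i, M *ᵥ v i = l i • v i) :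
    M * (Matrix.of fun i j => v j i) = (Matrix.of fun i j => v j i) * Matrix.diagonal l := by
  ext i j
  rw [Matrix.mul_diagonal]
  have := congrFun (hv' j) i
  simp only [Matrix.mulVec, dotProduct, Pi.smul_apply, smul_eq_mul] at this
  simp only [Matrix.mul_apply, Matrix.of_apply]
  rw [this, mul_comm]

open scoped Matrix in
theorem exists_eigenvector {K : Type*} [Field K] {M : Matrix (Fin 3) (Fin 3) K} {a : K}
    (h : (M - a • 1).det = 0) : ∃ v : Fin 3 → K, v ≠ 0 ∧ M *ᵥ v = a • v := by
  obtain ⟨v, hv, hv'⟩ := Matrix.exists_mulVec_eq_zero_iff.2 h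
  refine ⟨v, hv, ?_⟩
  rwa [Matrix.sub_mulVec, Matrix.smul_mulVec, Matrix.one_mulVec, sub_eq_zero] at hv'

/-- A matrix with distinct eigenvalues is diagonalizable. -/
theorem exists_diagonalization {K : Type*} [Field K] (M : Matrix (Fin 3) (Fin 3) K)
    (l : Fin 3 → K) (hl : Function.Injective l) (h : ∀ i, (M - l i • 1).det = 0) :
    ∃ S : Matrix (Fin 3) (Fin 3) K, S.det ≠ 0 ∧ M * S = S * Matrix.diagonal l := by
  choose v hv hv' using fun i => exists_eigenvector (h i)
  exact ⟨_, ((Matrix.isUnit_iff_isUnit_det _).1 (isUnit_of_eigenvectors hl hv hv')).ne_zero,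
    mul_of_eigenvectors hv'⟩

theorem exists_cube_eq (x : ℝ) : ∃ y : ℝ, y ^ 3 = x := by
  have h : ∀ x : ℝ, 0 ≤ x → ∃ y : ℝ, y ^ 3 = x := fun x hx =>
    ⟨x ^ ((1 : ℝ) / 3), by
      rw [← Real.rpow_natCast, ← Real.rpow_mul hx]; norm_num⟩
  rcases le_total 0 x with hx | hx
  · exact h x hx
  · obtain ⟨y, hy⟩ := h (-x) (by linarith)
    exact ⟨-y, by rw [Odd.neg_pow (by decide), hy, neg_neg]⟩

/-- Every invertible matrix is a multiple of one of determinant one. -/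
theorem exists_SL3_eq_smul {S : M3} (hS : S.det ≠ 0) :
    ∃ (T : SL3) (c : ℝ), c ≠ 0 ∧ (T : M3) = c • S := by
  obtain ⟨c, hc⟩ := exists_cube_eq (S.det)⁻¹
  have hc0 : c ≠ 0 := by
    rintro rfl
    exact inv_ne_zero hS (by rw [← hc]; norm_num)
  refine ⟨⟨c • S, ?_⟩, c, hc0, rfl⟩
  rw [Matrix.det_smul, Fintype.card_fin, hc, inv_mul_cancel₀ hS]

/-- The split pair determines the subgroup. -/
theorem IsSplitPair.unique {H L : Subgroup SL3} {A : Submodule ℝ M3} (h : IsSplitPair H A)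
    (h' : IsSplitPair L A) : H = L := by
  ext g
  rw [h.mem_iff, h'.mem_iff]

/-- Monomial matrices normalize `C`. -/
theorem conjSubgroup_monomial {Q : SL3} {σ : Equiv.Perm (Fin 3)} {t : Fin 3 → ℝ}
    (hQ : ∀ i j, (Q : M3) i j = if i = σ j then t j else 0) :
    conjSubgroup Q groupC = groupC := by
  have hle : LinearMap.range paramC ≤ conjSpace Q (LinearMap.range paramC) := by
    rintro _ ⟨d, rfl⟩
    refine ⟨Matrix.diagonal (d ∘ σ), diagonal_mem_range_paramC _, ?_⟩
    have e : (Q : M3) * Matrix.diagonal (d ∘ σ) = Matrix.diagonal d * (Q : M3) := by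
      ext i j
      rw [Matrix.mul_diagonal, Matrix.diagonal_mul, hQ]
      by_cases h : i = σ j
      · rw [if_pos h, h, mul_comm]; rfl
      · rw [if_neg h, zero_mul, mul_zero]
    change conjMat Q _ = _
    rw [conjMat_apply, e, mul_assoc, coe_mul_coe_inv, mul_one, paramC_eq_diagonal]
  have heq : LinearMap.range paramC = conjSpace Q (LinearMap.range paramC) :=
    Submodule.eq_of_le_of_finrank_eq hle (finrank_conjSpace _ _).symm
  refine IsSplitPair.unique (A := LinearMap.range paramC) ?_ isSplitPair_C
  rw [heq]
  exact isSplitPair_C.conj Q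

/-- Columns of a matrix with non-zero trailing minors can be rescaled so that the characteristic
polynomial has three distinct positive roots. -/
theorem exists_scaling_positive_roots (a0 a1 a2 m01 m02 m12 δ : ℝ) (h2 : a2 ≠ 0) (hm : m12 ≠ 0)
    (hδ : δ ≠ 0) : ∃ x y z l1 l2 l3 : ℝ, 0 < l1 ∧ l1 < l2 ∧ l2 < l3 ∧ ∀ l, l = l1 ∨ l = l2 ∨ l = l3 →
      l ^ 3 - (x * a0 + y * a1 + z * a2) * l ^ 2 + (y * z * m12 + x * z * m02 + x * y * m01) * l -
        x * y * z * δ = 0 := by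
  -- With x = y = 0 the polynomial is l²(l - 1), negative at 1/2 and positive at 2. The double root
  -- at zero is then split by a small y and a much smaller x, with signs making the lower
  -- coefficients positive.
  set z : ℝ := a2⁻¹ with hz
  have hz0 : z ≠ 0 := inv_ne_zero h2
  have hza : z * a2 = 1 := inv_mul_cancel₀ h2
  let p : ℝ → ℝ → ℝ → ℝ := fun x y l =>
    l ^ 3 - (x * a0 + y * a1 + z * a2) * l ^ 2 + (y * z * m12 + x * z * m02 + x * y * m01) * l -
        x * y * z * δ
  have hy : ∃ y, 0 < y * z * m12 ∧ p 0 y (1 / 2) < 0 ∧ 0 < p 0 y 2 := by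
    have c1 : ContinuousAt (fun τ => p 0 (τ * (z * m12)) (1 / 2)) 0 := by fun_prop
    have c2 : ContinuousAt (fun τ => p 0 (τ * (z * m12)) 2) 0 := by fun_prop
    have ev := (c1.eventually_lt_const (u := 0) (by simp [p, hza]; norm_num)).and
      (c2.eventually_const_lt (u := 0) (by simp [p, hza]; norm_num))
    obtain ⟨τ, ⟨e1, e2⟩, hτ⟩ := ((ev.filter_mono nhdsWithin_le_nhds).and
      (self_mem_nhdsWithin (a := (0 : ℝ)) (s := Set.Ioi 0))).exists
    refine ⟨τ * (z * m12), ?_, e1, e2⟩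
    have : 0 < (z * m12) ^ 2 := by positivity
    have hτ : 0 < τ := hτ
    calc 0 < τ * (z * m12) ^ 2 := by positivity
      _ = _ := by ring
  obtain ⟨y, hy0, hy1, hy2⟩ := hy
  have hyz : y ≠ 0 := by rintro rfl; simp at hy0
  -- For x = 0 the polynomial is l times a quadratic with positive constant term, hence positive
  -- just to the right of zero.
  have hr : ∃ r, 0 < r ∧ r < 1 / 2 ∧ 0 < p 0 y r := by
    have c1 : ContinuousAt (fun r : ℝ => r ^ 2 - (y * a1 + z * a2) * r + y * z * m12) 0 := by
      fun_prop
    have ev := (c1.eventually_const_lt (u := 0) (by simpa using hy0)).and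
      (eventually_lt_nhds (show (0 : ℝ) < 1 / 2 by norm_num))
    obtain ⟨r, ⟨e1, e2⟩, hr⟩ := ((ev.filter_mono nhdsWithin_le_nhds).and
      (self_mem_nhdsWithin (a := (0 : ℝ)) (s := Set.Ioi 0))).exists
    have hr : 0 < r := hr
    refine ⟨r, hr, e2, ?_⟩
    have : p 0 y r = r * (r ^ 2 - (y * a1 + z * a2) * r + y * z * m12) := by simp only [p]; ring
    rw [this]
    exact mul_pos hr e1
  obtain ⟨r, hr0, hr1, hr2⟩ := hr
  have hx : ∃ x, 0 < x * y * z * δ ∧ p x y (1 / 2) < 0 ∧ 0 < p x y 2 ∧ 0 < p x y r := by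
    have c1 : ContinuousAt (fun τ => p (τ * (y * z * δ)) y (1 / 2)) 0 := by fun_prop
    have c2 : ContinuousAt (fun τ => p (τ * (y * z * δ)) y 2) 0 := by fun_prop
    have c3 : ContinuousAt (fun τ => p (τ * (y * z * δ)) y r) 0 := by fun_prop
    have ev := (c1.eventually_lt_const (u := 0) (by simpa using hy1)).and
      ((c2.eventually_const_lt (u := 0) (by simpa using hy2)).and
      (c3.eventually_const_lt (u := 0) (by simpa using hr2)))
    obtain ⟨τ, ⟨e1, e2, e3⟩, hτ⟩ := ((ev.filter_mono nhdsWithin_le_nhds).and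
      (self_mem_nhdsWithin (a := (0 : ℝ)) (s := Set.Ioi 0))).exists
    refine ⟨τ * (y * z * δ), ?_, e1, e2, e3⟩
    have : 0 < (y * z * δ) ^ 2 := by positivity
    have hτ : 0 < τ := hτ
    calc 0 < τ * (y * z * δ) ^ 2 := by positivity
      _ = _ := by ring
  obtain ⟨x, hx0, hx1, hx2, hx3⟩ := hx
  -- The signs at 0 < r < 1/2 < 2 are now -, +, -, +, which isolates three roots.
  have hc : Continuous (p x y) := by fun_prop
  have hp0 : p x y 0 < 0 := by simp [p]; linarith
  obtain ⟨l1, ⟨b1, b1'⟩, e1⟩ := intermediate_value_Ioo hr0.le hc.continuousOn ⟨hp0, hx3⟩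
  obtain ⟨l2, ⟨b2, b2'⟩, e2⟩ := intermediate_value_Ioo' hr1.le hc.continuousOn ⟨hx1, hx3⟩
  obtain ⟨l3, ⟨b3, b3'⟩, e3⟩ := intermediate_value_Ioo (by norm_num : (1 / 2 : ℝ) ≤ 2)
    hc.continuousOn ⟨hx1, hx2⟩
  refine ⟨x, y, z, l1, l2, l3, b1, b1'.trans b2, b2'.trans b3, ?_⟩
  rintro l (rfl | rfl | rfl)
  exacts [e1, e2, e3]

theorem exists_perm_two_one {b c : Fin 3} (h : b ≠ c) :
    ∃ σ : Equiv.Perm (Fin 3), σ 1 = b ∧ σ 2 = c := by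
  revert b c
  decide

/-- Permuting and scaling the columns of R does not change R C R⁻¹. It can be arranged that the
resulting matrix g has distinct positive eigenvalues; then g has a real diagonalizable logarithm,
and the constant sequence g lies in one one-parameter group. -/
theorem limit_conj_C_C (R : SL3) : IsOneParameterLimit (conjSubgroup R groupC) groupC := by
  obtain ⟨b, c, hbc, hc, hm⟩ := exists_trailing_minors_ne_zero R
  obtain ⟨σ, rfl, rfl⟩ := exists_perm_two_one hbc
  set K : M3 := (R : M3).submatrix id σ with hK
  have hKd : K.det ≠ 0 := by
    rw [hK, Matrix.det_permute', Matrix.SpecialLinearGroup.det_coe, mul_one]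
    rcases Int.units_eq_one_or (Equiv.Perm.sign σ) with h | h <;> rw [h] <;> norm_num
  obtain ⟨x, y, z, l1, l2, l3, p1, p2, p3, hroot⟩ := exists_scaling_positive_roots (K 0 0) (K 1 1)
    (K 2 2) (K 0 0 * K 1 1 - K 0 1 * K 1 0) (K 0 0 * K 2 2 - K 0 2 * K 2 0)
    (K 1 1 * K 2 2 - K 1 2 * K 2 1) K.det hc hm hKd
  set t : Fin 3 → ℝ := ![x, y, z] with ht
  set l : Fin 3 → ℝ := ![l1, l2, l3] with hl
  have hpos : ∀ i, 0 < l i := by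
    intro i; fin_cases i <;> simp [l] <;> linarith
  have hinj : Function.Injective l := by
    intro i j hij
    fin_cases i <;> fin_cases j <;> simp [l] at hij ⊢ <;> linarith
  obtain ⟨S, hS, hMS⟩ := exists_diagonalization (K * Matrix.diagonal t) l hinj (fun i => by
    have := hroot (l i) (by fin_cases i <;> simp [l])
    rw [Matrix.det_fin_three] at this ⊢
    simp [Matrix.mul_diagonal, t]
    linear_combination -this)
  obtain ⟨T, k, hk, hT⟩ := exists_SL3_eq_smul hS
  -- Subtracting the mean logarithm normalizes the determinant to one.
  set m : ℝ := (Real.log l1 + Real.log l2 + Real.log l3) / 3 with hm'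
  set w : Fin 3 → ℝ := fun i => Real.log (l i) - m with hw'
  have hw : w 0 + w 1 + w 2 = 0 := by simp [w, l, m]; ring
  have hexp : ∀ i, Real.exp (w i * 1) = Real.exp (-m) * l i := by
    intro i
    rw [mul_one, hw']
    simp only
    rw [sub_eq_add_neg, Real.exp_add, Real.exp_log (hpos i), mul_comm]
  set g : SL3 := T * diagHom w hw (Multiplicative.ofAdd 1) * T⁻¹ with hg
  have hgm : (g : M3) = Real.exp (-m) • (K * Matrix.diagonal t) := by
    have e1 : (g : M3) * (T : M3) = (T : M3) * Matrix.diagonal fun i => Real.exp (-m) * l i := by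
      rw [hg, ← Matrix.SpecialLinearGroup.coe_mul, inv_mul_cancel_right,
        Matrix.SpecialLinearGroup.coe_mul, coe_diagHom]
      simp only [hexp]
    have e2 : (Real.exp (-m) • (K * Matrix.diagonal t)) * (T : M3) =
        (T : M3) * Matrix.diagonal fun i => Real.exp (-m) * l i := by
      rw [hT, smul_mul_assoc, mul_smul_comm, hMS, smul_mul_assoc, smul_comm]
      congr 1
      ext i j
      simp [Matrix.mul_diagonal]
      ring
    calc (g : M3) = (g : M3) * (T : M3) * ((T⁻¹ : SL3) : M3) := by
          rw [mul_assoc, coe_mul_coe_inv, mul_one]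
      _ = _ := by rw [e1, ← e2, mul_assoc, coe_mul_coe_inv, mul_one]
  have hQ : conjSubgroup (R⁻¹ * g) groupC = groupC := by
    refine conjSubgroup_monomial (σ := σ) (t := fun j => Real.exp (-m) * t j) fun i j => ?_
    have e : ((R⁻¹ * g : SL3) : M3) = Real.exp (-m) •
        ((1 : M3).submatrix id σ * Matrix.diagonal t) := by
      rw [Matrix.SpecialLinearGroup.coe_mul, hgm, mul_smul_comm, ← mul_assoc]
      congr 2
      rw [hK, ← coe_inv_mul_coe R]
      ext i j
      simp [Matrix.mul_apply]
    rw [e, Matrix.smul_apply, Matrix.mul_diagonal, Matrix.submatrix_apply, Matrix.one_apply]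
    by_cases h : i = σ j <;> simp [h]
  have hgR : conjSubgroup R groupC = conjSubgroup g groupC := by
    conv_lhs => rw [← hQ]
    rw [← conjSubgroup_mul, mul_inv_cancel_left]
  rw [hgR]
  refine isSplitPair_C.isOneParameterLimit (isSplitPair_C.conj g) (continuous_conj_diagHom T w hw)
    (P := fun _ => g) (fun _ => conj_diagHom_mem_range T w hw 1) ?_
  rintro _ ⟨X, hX, rfl⟩
  exact ⟨fun _ => X, fun _ => hX, tendsto_const_nhds⟩

theorem conjMat_eq_of_mul_eq {P : SL3} {X Y : M3} (h : Y * (P : M3) = (P : M3) * X) :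
    conjMat P X = Y := by
  rw [conjMat_apply, ← h, mul_assoc, coe_mul_coe_inv, mul_one]

/-! ### From conjugates of `C` to `F`: elliptic and hyperbolic flows -/

theorem IsSplitPair.limit_F {H : Subgroup SL3} {A : Submodule ℝ M3} (h : IsSplitPair H A)
    (h1 : (1 : M3) ∈ A) {φ : Multiplicative ℝ →* SL3} (hφ : Continuous φ) {P : ℕ → SL3}
    (hP : ∀ n, P n ∈ φ.range)
    (h33 : (!![0, 0, 0; 0, 0, 0; 0, 0, 1] : M3) ∈ limitSpace P A)
    (h12 : (!![0, 1, 0; 0, 0, 0; 0, 0, 0] : M3) ∈ limitSpace P A) :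
    IsOneParameterLimit groupF H := by
  refine h.isOneParameterLimit isSplitPair_F hφ hP ?_
  rintro _ ⟨v, rfl⟩
  have := (limitSpace P A).add_mem ((limitSpace P A).add_mem
    (Submodule.smul_mem _ (v 0) (one_mem_limitSpace h1)) (Submodule.smul_mem _ (v 1) h12))
    (Submodule.smul_mem _ (v 2 - v 0) h33)
  convert this using 1
  rw [paramF_apply]
  ext i j
  fin_cases i <;> fin_cases j <;> simp

/-- A one-parameter group scaling the first axis against a rotation of the complementary plane,
where `J = !![a, b; c, -a]` is a complex structure on that plane. -/
noncomputable def rotHom (a b c : ℝ) (h : a ^ 2 + b * c = -1) : Multiplicative ℝ →* SL3 :=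
  flowHom (fun t => !![Real.exp (2 * t), 0, 0;
      0, Real.exp (-t) * (Real.cos t + a * Real.sin t), Real.exp (-t) * (b * Real.sin t);
      0, Real.exp (-t) * (c * Real.sin t), Real.exp (-t) * (Real.cos t - a * Real.sin t)])
    (by ext i j; fin_cases i <;> fin_cases j <;> simp)
    (fun s t => by
      have e1 : Real.exp (2 * (s + t)) = Real.exp (2 * s) * Real.exp (2 * t) := by
        rw [← Real.exp_add]; ring_nf
      have e2 : Real.exp (-(s + t)) = Real.exp (-s) * Real.exp (-t) := by
        rw [← Real.exp_add]; ring_nf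
      rw [e1, e2, Real.cos_add, Real.sin_add]
      ext i j
      fin_cases i <;> fin_cases j <;> simp
      · linear_combination (-Real.exp (-s) * Real.exp (-t) * Real.sin s * Real.sin t) * h
      · ring
      · ring
      · linear_combination (-Real.exp (-s) * Real.exp (-t) * Real.sin s * Real.sin t) * h)
    (fun t => by
      have e : Real.exp (2 * t) * Real.exp (-t) ^ 2 = 1 := by
        rw [← Real.exp_nat_mul, ← Real.exp_add]; norm_num
      rw [Matrix.det_fin_three]
      simp
      linear_combination (Real.cos t ^ 2 - (a ^ 2 + b * c) * Real.sin t ^ 2) * e -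
        Real.sin t ^ 2 * h + Real.sin_sq_add_cos_sq t)

theorem coe_rotHom (a b c : ℝ) (h : a ^ 2 + b * c = -1) (t : ℝ) :
    (rotHom a b c h (Multiplicative.ofAdd t) : M3) = !![Real.exp (2 * t), 0, 0;
      0, Real.exp (-t) * (Real.cos t + a * Real.sin t), Real.exp (-t) * (b * Real.sin t);
      0, Real.exp (-t) * (c * Real.sin t), Real.exp (-t) * (Real.cos t - a * Real.sin t)] := rfl

theorem continuous_rotHom (a b c : ℝ) (h : a ^ 2 + b * c = -1) : Continuous (rotHom a b c h) := by
  refine Continuous.subtype_mk (f := fun t : Multiplicative ℝ =>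
    (!![Real.exp (2 * t.toAdd), 0, 0;
      0, Real.exp (-t.toAdd) * (Real.cos t.toAdd + a * Real.sin t.toAdd),
        Real.exp (-t.toAdd) * (b * Real.sin t.toAdd);
      0, Real.exp (-t.toAdd) * (c * Real.sin t.toAdd),
        Real.exp (-t.toAdd) * (Real.cos t.toAdd - a * Real.sin t.toAdd)] : M3)) ?_ _
  have : Continuous fun t : Multiplicative ℝ => t.toAdd := continuous_toAdd
  refine continuous_matrix fun i j => ?_
  fin_cases i <;> fin_cases j <;> simp <;> fun_prop

/-- The infimum of the square over r is 4zb if zb > 0 and 0 otherwise, hence below 4. The quantity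
is the trace of a 2 × 2 matrix of determinant one, so the bound says that this matrix is elliptic.
-/
theorem exists_elliptic_scale {z b : ℝ} (h : z * b < 1) :
    ∃ r : ℝ, r ≠ 0 ∧ (z / r + r * b) ^ 2 < 4 := by
  by_cases hz : z = 0
  · have hp : 0 < |b| + 1 := by positivity
    refine ⟨(|b| + 1)⁻¹, inv_ne_zero hp.ne', ?_⟩
    have : |(|b| + 1)⁻¹ * b| < 2 := by
      rw [abs_mul, abs_inv, abs_of_pos hp, inv_mul_lt_iff₀ hp]
      linarith [abs_nonneg b]
    rw [hz, zero_div, zero_add, ← sq_abs]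
    nlinarith [abs_nonneg ((|b| + 1)⁻¹ * b)]
  by_cases hb : b = 0
  · have hp : 0 < |z| + 1 := by positivity
    refine ⟨|z| + 1, hp.ne', ?_⟩
    have : |z / (|z| + 1)| < 2 := by
      rw [abs_div, abs_of_pos hp, div_lt_iff₀ hp]
      linarith [abs_nonneg z]
    rw [hb, mul_zero, add_zero, ← sq_abs]
    nlinarith [abs_nonneg (z / (|z| + 1))]
  have hq : 0 < |z / b| := abs_pos.2 (div_ne_zero hz hb)
  have hr : Real.sqrt |z / b| ≠ 0 := (Real.sqrt_pos.2 hq).ne'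
  refine ⟨Real.sqrt |z / b|, hr, ?_⟩
  have hs : Real.sqrt |z / b| ^ 2 = |z / b| := Real.sq_sqrt hq.le
  set r := Real.sqrt |z / b|
  have e : (z / r + r * b) ^ 2 = (z + r ^ 2 * b) ^ 2 / r ^ 2 := by field_simp
  rw [e, hs]
  rcases lt_or_gt_of_ne (div_ne_zero hz hb) with hlt | hgt
  · rw [abs_of_neg hlt]
    have : z + -(z / b) * b = 0 := by field_simp; ring
    rw [this]; norm_num
  · rw [abs_of_pos hgt]
    have : (z + z / b * b) ^ 2 / (z / b) = 4 * (z * b) := by field_simp; ring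
    rw [this]; linarith

theorem tendsto_exp_neg_rotation (θ : ℝ) :
    Tendsto (fun n : ℕ => Real.exp (-(θ + n * (2 * Real.pi)))) atTop (𝓝 0) := by
  refine Real.tendsto_exp_neg_atTop_nhds_zero.comp ?_
  exact tendsto_atTop_add_const_left _ _
    (tendsto_natCast_atTop_atTop.atTop_mul_const (by positivity))

/-- Degeneration to `F` by an elliptic flow, in normalized coordinates. -/
theorem IsSplitPair.limit_F_of_elliptic {H : Subgroup SL3} {A : Submodule ℝ M3}
    (h : IsSplitPair H A) (h1 : (1 : M3) ∈ A) (S : ℝ) {z b l q0 q1 q2 m0 m2 : ℝ}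
    (hzb : z * b < 1) (hq : q0 ≠ 0) (hm : m2 ≠ 0)
    (hD1 : conjMat (unip S 0 0) (Matrix.vecMulVec ![0, 1, z] ![l, 1 - z * b, b]) ∈ A)
    (hD2 : conjMat (unip S 0 0) (Matrix.vecMulVec ![q0, q1, q2] ![m0, -z * m2, m2]) ∈ A) :
    IsOneParameterLimit groupF H := by
  obtain ⟨r, hr, hr4⟩ := exists_elliptic_scale hzb
  -- The block G = (z/r, -1/r; r(1 - zb), rb) has determinant one and trace 2C with |C| < 1. So G =
  -- cos θ + sin θ · J with J² = -1, and G is a rotation in the flow generated by J.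
  set C : ℝ := (z / r + r * b) / 2 with hC
  have hC1 : 0 < 1 - C ^ 2 := by rw [hC]; nlinarith
  set s : ℝ := Real.sqrt (1 - C ^ 2) with hs
  have hs0 : s ≠ 0 := (Real.sqrt_pos.2 hC1).ne'
  have hs2 : s ^ 2 = 1 - C ^ 2 := Real.sq_sqrt hC1.le
  set θ : ℝ := Real.arccos C with hθ
  have hsin : Real.sin θ = s := Real.sin_arccos C
  have hcos : Real.cos θ = C := Real.cos_arccos (by nlinarith) (by nlinarith)
  have hJ : ((z / r - C) / s) ^ 2 + -1 / (r * s) * (r * (1 - z * b) / s) = -1 := by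
    have e : z / r - C = (z / r - r * b) / 2 := by rw [hC]; ring
    have e2 : (z / r - C) ^ 2 = C ^ 2 - z * b := by
      rw [e, hC]; field_simp; ring
    have e3 : ((z / r - C) / s) ^ 2 + -1 / (r * s) * (r * (1 - z * b) / s) =
        ((z / r - C) ^ 2 - (1 - z * b)) / s ^ 2 := by field_simp; ring
    rw [e3, e2, hs2]
    field_simp
    ring
  set Φ := rotHom ((z / r - C) / s) (-1 / (r * s)) (r * (1 - z * b) / s) hJ with hΦ
  -- At the times θ + 2πn the rotational part is always G, while d contracts the plane and d⁻²
  -- expands the first axis.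
  set d : ℕ → ℝ := fun n => Real.exp (-(θ + n * (2 * Real.pi))) with hd
  have hd0 : ∀ n, d n ≠ 0 := fun n => (Real.exp_pos _).ne'
  have hdlim : Tendsto d atTop (𝓝 0) := tendsto_exp_neg_rotation θ
  set T : SL3 := unip S 0 0 with hT
  set g : ℕ → SL3 := fun n => Φ (Multiplicative.ofAdd (θ + n * (2 * Real.pi))) with hg
  have hgm : ∀ n, (g n : M3) = !![(d n ^ 2)⁻¹, 0, 0; 0, d n * (z / r), d n * (-1 / r);
      0, d n * (r * (1 - z * b)), d n * (r * b)] := by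
    intro n
    have e : Real.exp (2 * (θ + n * (2 * Real.pi))) = (d n ^ 2)⁻¹ := by
      rw [hd, ← Real.exp_nat_mul, ← Real.exp_neg]; congr 1; push_cast; ring
    have f1 : C + (z / r - C) / s * s = z / r := by field_simp; ring
    have f2 : -1 / (r * s) * s = -1 / r := by field_simp
    have f3 : r * (1 - z * b) / s * s = r * (1 - z * b) := by field_simp
    have f4 : C - (z / r - C) / s * s = r * b := by
      rw [div_mul_cancel₀ _ hs0, hC]; ring
    rw [hg, hΦ]
    simp only
    rw [coe_rotHom, Real.cos_add_nat_mul_two_pi, Real.sin_add_nat_mul_two_pi, hsin, hcos, e, f1,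
      f2, f3, f4]
  have hφc : Continuous ((MulAut.conj T).toMonoidHom.comp Φ) := by
    change Continuous fun t => T * Φ t * T⁻¹
    have := continuous_rotHom _ _ _ hJ
    fun_prop
  have hTc : Continuous (conjMat T) := by
    change Continuous fun X : M3 => (T : M3) * X * ((T⁻¹ : SL3) : M3)
    fun_prop
  have hlim : ∀ (X : ℕ → M3) (D : M3) (Y : M3) (c : ℕ → ℝ), conjMat T D ∈ A → conjMat T Y = Y →
      (∀ n, X n * (g n : M3) = (g n : M3) * (c n • D)) → Tendsto X atTop (𝓝 Y) →
      Y ∈ limitSpace (fun n => T * g n * T⁻¹) A := by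
    intro X D Y c hD hY hX hXY
    refine ⟨fun n => c n • conjMat T D, fun n => A.smul_mem _ hD, ?_⟩
    have e : ∀ n, conjMat (T * g n * T⁻¹) (c n • conjMat T D) = conjMat T (X n) := by
      intro n
      rw [conjMat_mul, conjMat_mul, ← map_smul, conjMat_inv_conjMat, conjMat_eq_of_mul_eq (hX n)]
    simp only [e]
    rw [← hY]
    exact (hTc.tendsto Y).comp hXY
  refine h.limit_F h1 hφc (P := fun n => T * g n * T⁻¹)
    (fun n => ⟨Multiplicative.ofAdd (θ + n * (2 * Real.pi)), rfl⟩) ?_ ?_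
  -- G carries the column (1, z) and the row (1 - zb, b) to multiples of the last basis column and
  -- row. The first projection becomes E₃₃ up to one entry of order d³.
  · refine hlim (fun n => !![0, 0, 0; 0, 0, 0; l * r * d n ^ 3, 0, 1]) _ _ (fun _ => 1) hD1 ?_ ?_ ?_
    · refine conjMat_eq_of_mul_eq ?_
      rw [hT, coe_unip]
      ext i j
      fin_cases i <;> fin_cases j <;> simp
    · intro n
      have := hd0 n
      rw [hgm, one_smul]
      ext i j
      fin_cases i <;> fin_cases j <;>
        simp [Matrix.mul_apply, Fin.sum_univ_three] <;> field_simp <;> ring_nf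
    · have : Tendsto (fun n => l * r * d n ^ 3) atTop (𝓝 0) := by
        simpa using (hdlim.pow 3).const_mul (l * r)
      refine tendsto_pi_nhds.2 fun i => tendsto_pi_nhds.2 fun j => ?_
      fin_cases i <;> fin_cases j <;> simp [this]
  -- G carries the row (-z m₂, m₂) to a multiple of the middle basis row. Thus the (1,2) entry
  -- dominates, growing like d⁻³, and rescaling leaves E₁₂.
  · set k1 : ℝ := (z * q1 - q2) / r
    set k2 : ℝ := r * (1 - z * b) * q1 + r * b * q2
    refine hlim (fun n => !![-m0 / (r * m2) * d n ^ 3, 1, 0;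
      -k1 * m0 / (r * m2 * q0) * (d n ^ 3 * d n ^ 3), k1 / q0 * d n ^ 3, 0;
      -k2 * m0 / (r * m2 * q0) * (d n ^ 3 * d n ^ 3), k2 / q0 * d n ^ 3, 0]) _ _
      (fun n => d n ^ 3 / (-r * m2 * q0)) hD2 ?_ ?_ ?_
    · refine conjMat_eq_of_mul_eq ?_
      rw [hT, coe_unip]
      ext i j
      fin_cases i <;> fin_cases j <;> simp
    · intro n
      have := hd0 n
      rw [hgm]
      ext i j
      fin_cases i <;> fin_cases j <;>
        simp [Matrix.mul_apply, Fin.sum_univ_three, k1, k2] <;>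
        field_simp <;> ring_nf
    · have l3 : Tendsto (fun n => d n ^ 3) atTop (𝓝 0) := by simpa using hdlim.pow 3
      have l6 : Tendsto (fun n => d n ^ 3 * d n ^ 3) atTop (𝓝 0) := by simpa using l3.mul l3
      have lc : ∀ c : ℝ, Tendsto (fun n => c * d n ^ 3) atTop (𝓝 0) := fun c => by
        simpa using l3.const_mul c
      have lc6 : ∀ c : ℝ, Tendsto (fun n => c * (d n ^ 3 * d n ^ 3)) atTop (𝓝 0) := fun c => by
        simpa using l6.const_mul c
      refine tendsto_pi_nhds.2 fun i => tendsto_pi_nhds.2 fun j => ?_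
      fin_cases i <;> fin_cases j <;> simp <;> first | exact lc _ | exact lc6 _

/-- The `i`-th column of `R`. -/
def colOf (R : SL3) (i : Fin 3) : Fin 3 → ℝ := fun k => (R : M3) k i

/-- The `i`-th row of `R⁻¹`. -/
def dualRowOf (R : SL3) (i : Fin 3) : Fin 3 → ℝ := fun k => ((R⁻¹ : SL3) : M3) i k

theorem dualRowOf_colOf (R : SL3) (i j : Fin 3) :
    dualRowOf R i 0 * colOf R j 0 + dualRowOf R i 1 * colOf R j 1 +
      dualRowOf R i 2 * colOf R j 2 = if i = j then 1 else 0 := by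
  have := congrFun (congrFun (coe_inv_mul_coe R) i) j
  rw [Matrix.mul_apply, Fin.sum_univ_three, Matrix.one_apply] at this
  exact this

theorem colOf_dualRowOf (R : SL3) (a b : Fin 3) :
    colOf R 0 a * dualRowOf R 0 b + colOf R 1 a * dualRowOf R 1 b +
      colOf R 2 a * dualRowOf R 2 b = if a = b then 1 else 0 := by
  have := congrFun (congrFun (coe_mul_coe_inv R) a) b
  rw [Matrix.mul_apply, Fin.sum_univ_three, Matrix.one_apply] at this
  exact this

theorem projection_mem (R : SL3) (i : Fin 3) :
    Matrix.vecMulVec (colOf R i) (dualRowOf R i) ∈ conjSpace R (LinearMap.range paramC) := by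
  refine ⟨Matrix.diagonal (Pi.single i 1), diagonal_mem_range_paramC _, ?_⟩
  change conjMat R _ = _
  rw [conjMat_apply]
  ext a b
  rw [Matrix.mul_apply, Matrix.vecMulVec_apply]
  simp only [Matrix.mul_diagonal]
  rw [Finset.sum_eq_single i]
  · simp [colOf, dualRowOf]
  · intro k _ hk
    simp [hk]
  · simp

/-- A shear along e₁ kills the first entry of column i, and rescaling turns it into (0, 1, z). The
product zb is then the (3,3) entry of the i-th projection, whence the bound by one. The row of index
j annihilates column i, which gives it the form (m₀, -z m₂, m₂). -/
theorem limit_conj_C_F_of_elliptic (R : SL3) {i j k : Fin 3} (hij : i ≠ j) (hik : i ≠ k)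
    (hjk : j ≠ k) (hu : colOf R i 1 ≠ 0) (hh : colOf R i 2 * dualRowOf R i 2 < 1)
    (hj : dualRowOf R j 2 ≠ 0) (hk : dualRowOf R k 2 ≠ 0) :
    IsOneParameterLimit groupF (conjSubgroup R groupC) := by
  have eii := dualRowOf_colOf R i i
  have ejj := dualRowOf_colOf R j j
  have eij := dualRowOf_colOf R i j
  have eji := dualRowOf_colOf R j i
  have eki := dualRowOf_colOf R k i
  have ekj := dualRowOf_colOf R k j
  rw [if_pos rfl] at eii ejj
  rw [if_neg hij] at eij
  rw [if_neg hij.symm] at eji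
  rw [if_neg hik.symm] at eki
  rw [if_neg hjk.symm] at ekj
  have hpi := projection_mem R i
  have hpj := projection_mem R j
  set p := colOf R i
  set lam := dualRowOf R i
  set q := colOf R j
  set μ := dualRowOf R j
  set ν := dualRowOf R k
  -- Row k of R⁻¹ is proportional to the cross product of the other two columns, and this is its
  -- third coordinate.
  have hq : p 0 * q 1 - p 1 * q 0 ≠ 0 := by
    intro h0
    have h2 : q 1 * p 2 - p 1 * q 2 = 0 := by
      have : ν 2 * (q 1 * p 2 - p 1 * q 2) = 0 := by
        linear_combination q 1 * eki - p 1 * ekj - ν 0 * h0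
      exact (mul_eq_zero.1 this).resolve_left hk
    have : p 1 = 0 := by linear_combination -p 1 * ejj + q 1 * eji - μ 0 * h0 - μ 2 * h2
    exact hu this
  refine (isSplitPair_C.conj R).limit_F_of_elliptic (one_mem_conjSpace one_mem_range_paramC R)
    (p 0 / p 1) (z := p 2 / p 1) (b := p 1 * lam 2) (l := p 1 * lam 0)
    (q0 := q 0 - p 0 / p 1 * q 1) (q1 := q 1) (q2 := q 2) (m0 := μ 0) (m2 := μ 2)
    ?_ ?_ hj ?_ ?_
  · calc p 2 / p 1 * (p 1 * lam 2) = p 2 * lam 2 := by field_simp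
      _ < 1 := hh
  · intro h
    apply hq
    field_simp at h
    linarith
  · convert hpi using 1
    refine conjMat_eq_of_mul_eq ?_
    rw [coe_unip]
    have l1 : 1 - p 2 / p 1 * (p 1 * lam 2) = lam 0 * p 0 + lam 1 * p 1 := by
      field_simp; linarith
    rw [l1]
    ext a b
    fin_cases a <;> fin_cases b <;>
      simp [Matrix.mul_apply, Fin.sum_univ_three, Matrix.vecMulVec_apply] <;> field_simp
  · convert hpj using 1
    refine conjMat_eq_of_mul_eq ?_
    rw [coe_unip]
    have l1 : -(p 2 / p 1) * μ 2 = μ 0 * (p 0 / p 1) + μ 1 := by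
      field_simp; linarith
    rw [l1]
    ext a b
    fin_cases a <;> fin_cases b <;>
      simp [Matrix.mul_apply, Fin.sum_univ_three, Matrix.vecMulVec_apply] <;> ring

/-- Columns j and k span the plane of e₁ and e₂, so row i of R⁻¹ is a multiple of the last basis
row. The i-th projection has only a third column and flows to E₃₃; the j-th has no third row, and
its leading entry is (1,2). -/
theorem limit_conj_C_F_of_hyperbolic (R : SL3) {i j k : Fin 3} (hij : i ≠ j) (hik : i ≠ k)
    (hjk : j ≠ k) (hj : colOf R j 2 = 0) (hk : colOf R k 2 = 0) :
    IsOneParameterLimit groupF (conjSubgroup R groupC) := by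
  have eii := dualRowOf_colOf R i i
  have ejj := dualRowOf_colOf R j j
  rw [if_pos rfl] at eii ejj
  have hsum : ∀ b, colOf R i 2 * dualRowOf R i b = if 2 = b then 1 else 0 := by
    intro b
    rw [← colOf_dualRowOf R 2 b]
    revert hij hik hjk hj hk
    clear eii ejj
    fin_cases i <;> fin_cases j <;> fin_cases k <;> simp <;> intro h1 h2 <;> simp [h1, h2]
  have hpi := projection_mem R i
  have hpj := projection_mem R j
  have s0 := hsum 0
  have s1 := hsum 1
  have s2 := hsum 2
  simp at s0 s1 s2
  set p := colOf R i
  set lam := dualRowOf R i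
  set q := colOf R j
  set μ := dualRowOf R j
  have hp2 : p 2 ≠ 0 := by rintro h; rw [h, zero_mul] at s2; exact zero_ne_one s2
  have l0 : lam 0 = 0 := s0.resolve_left hp2
  have l1 : lam 1 = 0 := s1.resolve_left hp2
  rw [hj, mul_zero, add_zero] at ejj
  -- The shear s is generic so that the (1,2) entry of the sheared j-th projection does not vanish.
  -- The third vector is only padding.
  obtain ⟨s, hs⟩ := exists_quadratic_ne_zero
    ![![q 0, -q 1, 0], ![μ 1, μ 0, 0], ![1, 0, 0]] (by
      intro a ha
      fin_cases a
      · have h0 := congrFun ha 0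
        have h1 := congrFun ha 1
        simp at h0 h1
        simp [h0, h1] at ejj
      · have h0 := congrFun ha 0
        have h1 := congrFun ha 1
        simp at h0 h1
        simp [h0, h1] at ejj
      · simpa using congrFun ha 0)
  have hs0 := hs 0
  have hs1 := hs 1
  simp at hs0 hs1
  set w : Fin 3 → ℝ := ![0, -1, 1] with hw'
  have hw : w 0 + w 1 + w 2 = 0 := by simp [w]
  refine (isSplitPair_C.conj R).limit_F (one_mem_conjSpace one_mem_range_paramC R)
    (continuous_conj_diagHom (unip s 0 0) w hw)
    (P := fun n : ℕ => unip s 0 0 * diagHom w hw (Multiplicative.ofAdd (n : ℝ)) * (unip s 0 0)⁻¹)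
    (fun n => conj_diagHom_mem_range (unip s 0 0) w hw n) ?_ ?_
  · have e : conjMat (unip s 0 0) !![0, 0, 0; 0, 0, 0; 0, 0, 1] =
        !![0, 0, 0; 0, 0, 0; 0, 0, 1] := by
      refine conjMat_eq_of_mul_eq ?_
      rw [coe_unip]
      ext i j
      fin_cases i <;> fin_cases j <;> simp
    rw [← e]
    have e' : conjMat (unip s 0 0) !![0, 0, (p 0 - s * p 1) * lam 2; 0, 0, p 1 * lam 2; 0, 0, 1] =
        Matrix.vecMulVec p lam := by
      refine conjMat_eq_of_mul_eq ?_
      rw [coe_unip]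
      ext i j
      fin_cases i <;> fin_cases j <;>
        simp [Matrix.mul_apply, Fin.sum_univ_three, Matrix.vecMulVec_apply, l0, l1, s2]
      ring
    refine mem_limitSpace_diagHom
      (D := !![0, 0, (p 0 - s * p 1) * lam 2; 0, 0, p 1 * lam 2; 0, 0, 1]) 0 ?_ ?_
    · rw [e']; exact hpi
    · intro i j
      fin_cases i <;> fin_cases j <;> simp [w]
  · have e : conjMat (unip s 0 0) !![0, 1, 0; 0, 0, 0; 0, 0, 0] =
        !![0, 1, 0; 0, 0, 0; 0, 0, 0] := by
      refine conjMat_eq_of_mul_eq ?_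
      rw [coe_unip]
      ext i j
      fin_cases i <;> fin_cases j <;> simp
    rw [← e]
    set c : ℝ := ((q 0 - s * q 1) * (μ 1 + s * μ 0))⁻¹ with hc
    have hc1 : c * ((q 0 - s * q 1) * (μ 1 + s * μ 0)) = 1 :=
      inv_mul_cancel₀ (mul_ne_zero (by rwa [sub_eq_add_neg]) hs1)
    have e' : conjMat (unip s 0 0) (c • Matrix.vecMulVec ![q 0 - s * q 1, q 1, 0]
        ![μ 0, μ 1 + s * μ 0, μ 2]) = c • Matrix.vecMulVec q μ := by
      rw [map_smul]
      congr 1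
      refine conjMat_eq_of_mul_eq ?_
      rw [coe_unip]
      ext i j
      fin_cases i <;> fin_cases j <;>
        simp [Matrix.mul_apply, Fin.sum_univ_three, Matrix.vecMulVec_apply, hj] <;> ring
    refine mem_limitSpace_diagHom (D := c • Matrix.vecMulVec ![q 0 - s * q 1, q 1, 0]
        ![μ 0, μ 1 + s * μ 0, μ 2]) 1 ?_ ?_
    · rw [e']; exact Submodule.smul_mem _ _ hpj
    · intro i j
      fin_cases i <;> fin_cases j <;> simp [w, hc1] <;> norm_num

/-! ### Duality -/

/-- The inverse transpose automorphism of `SL₃(ℝ)`. -/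
def dualEquiv : SL3 ≃* SL3 where
  toFun g := (g⁻¹).transpose
  invFun g := (g⁻¹).transpose
  left_inv g := by
    apply Subtype.ext
    simp only [Matrix.SpecialLinearGroup.coe_transpose, Matrix.SpecialLinearGroup.coe_inv,
      Matrix.adjugate_transpose, Matrix.transpose_transpose]
    rw [Matrix.adjugate_adjugate _ (by simp), Matrix.SpecialLinearGroup.det_coe, one_pow, one_smul]
  right_inv g := by
    apply Subtype.ext
    simp only [Matrix.SpecialLinearGroup.coe_transpose, Matrix.SpecialLinearGroup.coe_inv,
      Matrix.adjugate_transpose, Matrix.transpose_transpose]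
    rw [Matrix.adjugate_adjugate _ (by simp), Matrix.SpecialLinearGroup.det_coe, one_pow, one_smul]
  map_mul' g h := by
    apply Subtype.ext
    simp

theorem continuous_dualEquiv : Continuous dualEquiv := by
  refine Continuous.subtype_mk (f := fun g : SL3 => ((g⁻¹ : SL3) : M3).transpose) ?_ _
  exact (continuous_coe_SL3.comp continuous_inv).matrix_transpose

theorem coe_dualEquiv (g : SL3) : (dualEquiv g : M3) = ((g⁻¹ : SL3) : M3).transpose := rfl

/-- The transposition of the first two coordinates, with determinant one. -/
def swapMat : SL3 := ⟨!![0, 1, 0; 1, 0, 0; 0, 0, -1], by simp [Matrix.det_fin_three]⟩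

theorem coe_swapMat : (swapMat : M3) = !![0, 1, 0; 1, 0, 0; 0, 0, -1] := rfl

theorem swapMat_mul_self : swapMat * swapMat = 1 := by
  apply Subtype.ext
  rw [Matrix.SpecialLinearGroup.coe_mul, coe_swapMat]
  ext i j
  fin_cases i <;> fin_cases j <;> simp

theorem swapMat_inv : swapMat⁻¹ = swapMat := inv_eq_of_mul_eq_one_left swapMat_mul_self

theorem dualEquiv_swapMat : dualEquiv swapMat = swapMat := by
  apply Subtype.ext
  rw [coe_dualEquiv, swapMat_inv, coe_swapMat]
  ext i j
  fin_cases i <;> fin_cases j <;> simp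

theorem dualEquiv_dualEquiv (g : SL3) : dualEquiv (dualEquiv g) = g := dualEquiv.left_inv g

theorem map_dualEquiv_C : groupC.map dualEquiv.toMonoidHom = groupC := by
  have hle : groupC.map dualEquiv.toMonoidHom ≤ groupC := by
    rintro _ ⟨g, hg, rfl⟩
    obtain ⟨a, b, ha, hb, hg⟩ := groupC.inv_mem hg
    refine ⟨a, b, ha, hb, ?_⟩
    change (dualEquiv g : M3) = _
    rw [coe_dualEquiv, hg]
    ext i j
    fin_cases i <;> fin_cases j <;> simp
  refine le_antisymm hle fun g hg => ⟨dualEquiv g, hle ⟨g, hg, rfl⟩, dualEquiv_dualEquiv g⟩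

/-- Inverse transpose makes the Jordan block lower triangular; exchanging the first two coordinates
restores it. -/
theorem map_dualEquiv_F : conjSubgroup swapMat (groupF.map dualEquiv.toMonoidHom) = groupF := by
  have hle : conjSubgroup swapMat (groupF.map dualEquiv.toMonoidHom) ≤ groupF := by
    rintro _ ⟨_, ⟨g, hg, rfl⟩, rfl⟩
    obtain ⟨a, t, ha, hg⟩ := groupF.inv_mem hg
    refine ⟨a, t, ha, ?_⟩
    change ((swapMat * dualEquiv g * swapMat⁻¹ : SL3) : M3) = _
    rw [swapMat_inv, Matrix.SpecialLinearGroup.coe_mul, Matrix.SpecialLinearGroup.coe_mul,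
      coe_dualEquiv, hg, coe_swapMat]
    ext i j
    fin_cases i <;> fin_cases j <;>
      simp [Matrix.mul_apply, Matrix.vecMul, dotProduct, Fin.sum_univ_three]
  refine le_antisymm hle fun g hg => ?_
  have h1 : swapMat * dualEquiv g * swapMat⁻¹ ∈ groupF := hle ⟨_, ⟨g, hg, rfl⟩, rfl⟩
  rw [mem_conjSubgroup]
  refine ⟨_, h1, ?_⟩
  change dualEquiv _ = _
  rw [map_mul, map_mul, map_inv, dualEquiv_swapMat, dualEquiv_dualEquiv, swapMat_inv]

/-- The twisted duality preserves both `C` and `F`, so every construction phrased with columns of R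
has a counterpart with rows of R⁻¹. -/
theorem IsOneParameterLimit.of_dual {R : SL3}
    (h : IsOneParameterLimit groupF (conjSubgroup (swapMat * dualEquiv R) groupC)) :
    IsOneParameterLimit groupF (conjSubgroup R groupC) := by
  have h2 := (h.map dualEquiv continuous_dualEquiv continuous_dualEquiv).conj swapMat
  rwa [map_dualEquiv_F, map_conjSubgroup, map_dualEquiv_C, map_mul, dualEquiv_dualEquiv,
    dualEquiv_swapMat, ← conjSubgroup_mul, ← mul_assoc, swapMat_mul_self, one_mul] at h2

theorem coe_dual (R : SL3) : ((swapMat * dualEquiv R : SL3) : M3) =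
    !![0, 1, 0; 1, 0, 0; 0, 0, -1] * ((R⁻¹ : SL3) : M3).transpose := rfl

theorem coe_dual_inv (R : SL3) : (((swapMat * dualEquiv R)⁻¹ : SL3) : M3) =
    (R : M3).transpose * !![0, 1, 0; 1, 0, 0; 0, 0, -1] := by
  rw [mul_inv_rev, swapMat_inv, Matrix.SpecialLinearGroup.coe_mul, ← map_inv, coe_dualEquiv,
    inv_inv, coe_swapMat]

theorem colOf_dual_one (R : SL3) (i : Fin 3) :
    colOf (swapMat * dualEquiv R) i 1 = dualRowOf R i 0 := by
  rw [colOf, coe_dual]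
  simp [Matrix.mul_apply, Fin.sum_univ_three, dualRowOf, -Matrix.SpecialLinearGroup.coe_inv]

theorem colOf_dual_two (R : SL3) (i : Fin 3) :
    colOf (swapMat * dualEquiv R) i 2 = -dualRowOf R i 2 := by
  rw [colOf, coe_dual]
  simp [Matrix.mul_apply, Fin.sum_univ_three, dualRowOf, -Matrix.SpecialLinearGroup.coe_inv]

theorem dualRowOf_dual_two (R : SL3) (i : Fin 3) :
    dualRowOf (swapMat * dualEquiv R) i 2 = -colOf R i 2 := by
  rw [dualRowOf, coe_dual_inv]
  simp [Matrix.mul_apply, Fin.sum_univ_three, colOf]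

/-! ### Every configuration admits a flow to `F` -/

/-- The configurations of three points and their dual lines relative to the flag of `F` for which a
degenerating flow has been constructed. -/
def HasFlow (x y u v : Fin 3 → ℝ) : Prop :=
  ∃ i j k : Fin 3, i ≠ j ∧ i ≠ k ∧ j ≠ k ∧
    ((u i ≠ 0 ∧ x i * y i < 1 ∧ y j ≠ 0 ∧ y k ≠ 0) ∨ (v i ≠ 0 ∧ x i * y i < 1 ∧ x j ≠ 0 ∧ x k ≠ 0) ∨
      (x j = 0 ∧ x k = 0) ∨ (y j = 0 ∧ y k = 0))

theorem HasFlow.dual {x y u v : Fin 3 → ℝ} (h : HasFlow x y u v) : HasFlow y x v u := by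
  obtain ⟨i, j, k, h1, h2, h3, h⟩ := h
  refine ⟨i, j, k, h1, h2, h3, ?_⟩
  rw [mul_comm (y i)]
  tauto

theorem sum_fin_three_of_ne {i j k : Fin 3} (hij : i ≠ j) (hik : i ≠ k) (hjk : j ≠ k)
    (f : Fin 3 → ℝ) : f 0 + f 1 + f 2 = f i + f j + f k := by
  fin_cases i <;> fin_cases j <;> fin_cases k <;> simp at hij hik hjk ⊢ <;> ring

/-- A vanishing x i makes the elliptic inequality at i automatic. If no second x vanishes and v i =
0, then u and x are proportional on {j, k}, both being orthogonal to v there. Zeros of y then lead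
to a hyperbolic case or to an elliptic one at j or k; without zeros at j and k, u i = 0 would force
u = 0. -/
theorem hasFlow_of_eq_zero {x y u v : Fin 3 → ℝ} {i j k : Fin 3} (hij : i ≠ j) (hik : i ≠ k)
    (hjk : j ≠ k) (hxy : x i * y i + x j * y j + x k * y k = 1)
    (huy : u i * y i + u j * y j + u k * y k = 0) (hxv : x i * v i + x j * v j + x k * v k = 0)
    (huv : u i * v i + u j * v j + u k * v k = 0) (hu : ¬(u i = 0 ∧ u j = 0 ∧ u k = 0))
    (hv : ¬(v i = 0 ∧ v j = 0 ∧ v k = 0)) (hx : x i = 0) : HasFlow x y u v := by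
  by_cases hxj : x j = 0
  · exact ⟨k, i, j, hik.symm, hjk.symm, hij, Or.inr (Or.inr (Or.inl ⟨hx, hxj⟩))⟩
  by_cases hxk : x k = 0
  · exact ⟨j, i, k, hij.symm, hjk, hik, Or.inr (Or.inr (Or.inl ⟨hx, hxk⟩))⟩
  have hlt : x i * y i < 1 := by rw [hx, zero_mul]; exact one_pos
  by_cases hvi : v i = 0
  swap
  · exact ⟨i, j, k, hij, hik, hjk, Or.inr (Or.inl ⟨hvi, hlt, hxj, hxk⟩)⟩
  rw [hx, zero_mul, zero_add] at hxy hxv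
  rw [hvi, mul_zero, zero_add] at huv
  have hvj : v j ≠ 0 := by
    intro h
    rw [h, mul_zero, zero_add] at hxv
    exact hv ⟨hvi, h, (mul_eq_zero.1 hxv).resolve_left hxk⟩
  have hukj : u k * x j = u j * x k := by
    have : v j * (u k * x j - u j * x k) = 0 := by linear_combination u k * hxv - x k * huv
    linarith [(mul_eq_zero.1 this).resolve_left hvj]
  by_cases hyj : y j = 0
  · by_cases hyi : y i = 0
    · exact ⟨k, i, j, hik.symm, hjk.symm, hij, Or.inr (Or.inr (Or.inr ⟨hyi, hyj⟩))⟩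
    have hyk : y k ≠ 0 := by
      intro h
      rw [hyj, h] at hxy
      simp at hxy
    have huj : u j ≠ 0 := by
      intro h
      have huk : u k = 0 := by
        rw [h, zero_mul] at hukj
        exact (mul_eq_zero.1 hukj).resolve_right hxj
      rw [h, huk, zero_mul, zero_mul, add_zero, add_zero] at huy
      exact hu ⟨(mul_eq_zero.1 huy).resolve_right hyi, h, huk⟩
    refine ⟨j, i, k, hij.symm, hjk, hik, Or.inl ⟨huj, ?_, hyi, hyk⟩⟩
    rw [hyj, mul_zero]; exact one_pos
  by_cases hyk : y k = 0
  · by_cases hyi : y i = 0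
    · exact ⟨j, i, k, hij.symm, hjk, hik, Or.inr (Or.inr (Or.inr ⟨hyi, hyk⟩))⟩
    have huk : u k ≠ 0 := by
      intro h
      have huj : u j = 0 := by
        rw [h, zero_mul] at hukj
        exact (mul_eq_zero.1 hukj.symm).resolve_right hxk
      rw [h, huj, zero_mul, zero_mul, add_zero, add_zero] at huy
      exact hu ⟨(mul_eq_zero.1 huy).resolve_right hyi, huj, h⟩
    refine ⟨k, i, j, hik.symm, hjk.symm, hij, Or.inl ⟨huk, ?_, hyi, hyj⟩⟩
    rw [hyk, mul_zero]; exact one_pos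
  by_cases hui : u i = 0
  · exfalso
    rw [hui, zero_mul, zero_add] at huy
    have : u j = 0 := by linear_combination -u j * hxy + x j * huy - y k * hukj
    have h' : u k = 0 := by
      rw [this, zero_mul] at hukj
      exact (mul_eq_zero.1 hukj).resolve_right hxj
    exact hu ⟨hui, this, h'⟩
  · exact ⟨i, j, k, hij, hik, hjk, Or.inl ⟨hui, hlt, hyj, hyk⟩⟩

/-- An elliptic flow at i fails only if u i = v i = 0. Then u and x are proportional on {j, k}, and
pairing with y multiplies u by 1 - x i y i ≠ 0 to give zero, so u = 0. -/
theorem hasFlow_of_lt {x y u v : Fin 3 → ℝ} {i j k : Fin 3} (hij : i ≠ j) (hik : i ≠ k)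
    (hjk : j ≠ k) (hxy : x i * y i + x j * y j + x k * y k = 1)
    (huy : u i * y i + u j * y j + u k * y k = 0) (hxv : x i * v i + x j * v j + x k * v k = 0)
    (huv : u i * v i + u j * v j + u k * v k = 0) (hu : ¬(u i = 0 ∧ u j = 0 ∧ u k = 0))
    (hv : ¬(v i = 0 ∧ v j = 0 ∧ v k = 0)) (hxj : x j ≠ 0) (hxk : x k ≠ 0) (hyj : y j ≠ 0)
    (hyk : y k ≠ 0) (hlt : x i * y i < 1) : HasFlow x y u v := by
  by_cases hvi : v i = 0
  swap
  · exact ⟨i, j, k, hij, hik, hjk, Or.inr (Or.inl ⟨hvi, hlt, hxj, hxk⟩)⟩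
  by_cases hui : u i = 0
  swap
  · exact ⟨i, j, k, hij, hik, hjk, Or.inl ⟨hui, hlt, hyj, hyk⟩⟩
  exfalso
  rw [hui, zero_mul, zero_add] at huy huv
  rw [hvi, mul_zero, zero_add] at hxv
  have hvj : v j ≠ 0 := by
    intro h
    rw [h, mul_zero, zero_add] at hxv
    exact hv ⟨hvi, h, (mul_eq_zero.1 hxv).resolve_left hxk⟩
  have hukj : u k * x j = u j * x k := by
    have : v j * (u k * x j - u j * x k) = 0 := by linear_combination u k * hxv - x k * huv
    linarith [(mul_eq_zero.1 this).resolve_left hvj]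
  have huj : u j = 0 := by
    have : u j * (1 - x i * y i) = 0 := by
      linear_combination -u j * hxy + x j * huy - y k * hukj
    exact (mul_eq_zero.1 this).resolve_right (by linarith)
  have huk : u k = 0 := by
    rw [huj, zero_mul] at hukj
    exact (mul_eq_zero.1 hukj).resolve_right hxj
  exact hu ⟨hui, huj, huk⟩

theorem exists_other_indices (i : Fin 3) : ∃ j k : Fin 3, i ≠ j ∧ i ≠ k ∧ j ≠ k := by
  revert i; decide

/-- When no x or y vanishes, the three products x i y i sum to one, so one of them is below one.
Zeros of y are handled by duality. -/
theorem hasFlow_of_relations {x y u v : Fin 3 → ℝ} (hxy : x 0 * y 0 + x 1 * y 1 + x 2 * y 2 = 1)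
    (huy : u 0 * y 0 + u 1 * y 1 + u 2 * y 2 = 0) (hxv : x 0 * v 0 + x 1 * v 1 + x 2 * v 2 = 0)
    (huv : u 0 * v 0 + u 1 * v 1 + u 2 * v 2 = 0) (hu : u ≠ 0) (hv : v ≠ 0) :
    HasFlow x y u v := by
  have hu' : ∀ {i j k : Fin 3}, i ≠ j → i ≠ k → j ≠ k → ¬(u i = 0 ∧ u j = 0 ∧ u k = 0) := by
    rintro i j k hij hik hjk ⟨h1, h2, h3⟩
    refine hu (funext fun a => ?_)
    have : a = i ∨ a = j ∨ a = k := by omega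
    rcases this with rfl | rfl | rfl <;> simpa
  have hv' : ∀ {i j k : Fin 3}, i ≠ j → i ≠ k → j ≠ k → ¬(v i = 0 ∧ v j = 0 ∧ v k = 0) := by
    rintro i j k hij hik hjk ⟨h1, h2, h3⟩
    refine hv (funext fun a => ?_)
    have : a = i ∨ a = j ∨ a = k := by omega
    rcases this with rfl | rfl | rfl <;> simpa
  by_cases hx : ∃ i, x i = 0
  · obtain ⟨i, hi⟩ := hx
    obtain ⟨j, k, hij, hik, hjk⟩ := exists_other_indices i
    have sums := fun f => sum_fin_three_of_ne hij hik hjk f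
    refine hasFlow_of_eq_zero hij hik hjk ?_ ?_ ?_ ?_ (hu' hij hik hjk) (hv' hij hik hjk) hi
    · rw [← hxy]; exact (sums fun a => x a * y a).symm
    · rw [← huy]; exact (sums fun a => u a * y a).symm
    · rw [← hxv]; exact (sums fun a => x a * v a).symm
    · rw [← huv]; exact (sums fun a => u a * v a).symm
  by_cases hy : ∃ i, y i = 0
  · obtain ⟨i, hi⟩ := hy
    obtain ⟨j, k, hij, hik, hjk⟩ := exists_other_indices i
    have sums := fun f => sum_fin_three_of_ne hij hik hjk f
    refine (hasFlow_of_eq_zero hij hik hjk ?_ ?_ ?_ ?_ (hv' hij hik hjk) (hu' hij hik hjk) hi).dual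
    · rw [← hxy, sums fun a => x a * y a]; ring
    · rw [← hxv, sums fun a => x a * v a]; ring
    · rw [← huy, sums fun a => u a * y a]; ring
    · rw [← huv, sums fun a => u a * v a]; ring
  push Not at hx hy
  have hlt : ∃ i, x i * y i < 1 := by
    by_contra h
    push Not at h
    linarith [h 0, h 1, h 2]
  obtain ⟨i, hi⟩ := hlt
  obtain ⟨j, k, hij, hik, hjk⟩ := exists_other_indices i
  have sums := fun f => sum_fin_three_of_ne hij hik hjk f
  refine hasFlow_of_lt hij hik hjk ?_ ?_ ?_ ?_ (hu' hij hik hjk) (hv' hij hik hjk) (hx j) (hx k)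
    (hy j) (hy k) hi
  · rw [← hxy]; exact (sums fun a => x a * y a).symm
  · rw [← huy]; exact (sums fun a => u a * y a).symm
  · rw [← hxv]; exact (sums fun a => x a * v a).symm
  · rw [← huv]; exact (sums fun a => u a * v a).symm

/-- The vectors x and u are the last and middle rows of R, and y and v the last and first columns of
R⁻¹. Their pairings are entries of R R⁻¹ = 1, which supplies the four relations. -/
theorem limit_conj_C_F (R : SL3) : IsOneParameterLimit groupF (conjSubgroup R groupC) := by
  have hflow : HasFlow (fun i => colOf R i 2) (fun i => dualRowOf R i 2) (fun i => colOf R i 1)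
      (fun i => dualRowOf R i 0) := by
    refine hasFlow_of_relations (by simpa using colOf_dualRowOf R 2 2)
      (by simpa using colOf_dualRowOf R 1 2) (by simpa using colOf_dualRowOf R 2 0)
      (by simpa using colOf_dualRowOf R 1 0) ?_ ?_
    · intro h
      have := colOf_dualRowOf R 1 1
      have h' := fun i => congrFun h i
      simp only [Pi.zero_apply] at h'
      simp [h'] at this
    · intro h
      have := colOf_dualRowOf R 0 0
      have h' := fun i => congrFun h i
      simp only [Pi.zero_apply] at h'
      simp [h'] at this
  obtain ⟨i, j, k, hij, hik, hjk, ⟨h1, h2, h3, h4⟩ | ⟨h1, h2, h3, h4⟩ | ⟨h1, h2⟩ | ⟨h1, h2⟩⟩ := hflow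
  · exact limit_conj_C_F_of_elliptic R hij hik hjk h1 h2 h3 h4
  · refine IsOneParameterLimit.of_dual (limit_conj_C_F_of_elliptic _ hij hik hjk ?_ ?_ ?_ ?_)
    · rwa [colOf_dual_one]
    · rw [colOf_dual_two, dualRowOf_dual_two, neg_mul_neg, mul_comm]
      exact h2
    · rw [dualRowOf_dual_two]; exact neg_ne_zero.2 h3
    · rw [dualRowOf_dual_two]; exact neg_ne_zero.2 h4
  · exact limit_conj_C_F_of_hyperbolic R hij hik hjk h1 h2
  · refine IsOneParameterLimit.of_dual (limit_conj_C_F_of_hyperbolic _ hij hik hjk ?_ ?_)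
    · rw [colOf_dual_two]; exact neg_eq_zero.2 h1
    · rw [colOf_dual_two]; exact neg_eq_zero.2 h2

/-! ### Commuting families with real spectra -/

theorem det_sub_smul_one (X : M3) (l : ℝ) :
    (X - l • 1).det = -(l ^ 3 - X.trace * l ^ 2 + X.adjugate.trace * l - X.det) := by
  rw [Matrix.adjugate_fin_three, Matrix.det_fin_three, Matrix.det_fin_three]
  simp [Matrix.trace, Fin.sum_univ_three]
  ring

theorem exists_SL3_conj {T : M3} (hT : T.det ≠ 0) :
    ∃ R : SL3, ∀ X Y : M3, X * T = T * Y → conjMat R X = Y := by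
  obtain ⟨R, c, hc, hR⟩ := exists_SL3_eq_smul hT
  refine ⟨R⁻¹, fun X Y h => ?_⟩
  have : X = conjMat R Y := by
    refine (conjMat_eq_of_mul_eq ?_).symm
    rw [hR, mul_smul_comm, smul_mul_assoc, h]
  rw [this, conjMat_inv_conjMat]

theorem exists_first_col {v : Fin 3 → ℝ} (hv : v ≠ 0) :
    ∃ T : M3, T.det ≠ 0 ∧ ∀ i, T i 0 = v i := by
  by_cases h0 : v 0 = 0
  swap
  · refine ⟨!![v 0, 0, 0; v 1, 1, 0; v 2, 0, 1], by simpa [Matrix.det_fin_three], fun i => ?_⟩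
    fin_cases i <;> simp
  by_cases h1 : v 1 = 0
  swap
  · refine ⟨!![v 0, 1, 0; v 1, 0, 0; v 2, 0, 1], by simpa [Matrix.det_fin_three], fun i => ?_⟩
    fin_cases i <;> simp
  by_cases h2 : v 2 = 0
  · exact absurd (vec3_eq_zero h0 h1 h2) hv
  · refine ⟨!![v 0, 1, 0; v 1, 0, 1; v 2, 0, 0], by simpa [Matrix.det_fin_three], fun i => ?_⟩
    fin_cases i <;> simp

/-- The columns of the adjugate of b - A are eigenvectors; if both vanish, A is scalar. -/
theorem exists_eigenvector_two {p q r s b c : ℝ} (ht : p + s = b + c) (hd : p * s - q * r = b * c) :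
    ∃ w₀ w₁ : ℝ, (w₀ ≠ 0 ∨ w₁ ≠ 0) ∧ p * w₀ + q * w₁ = b * w₀ ∧ r * w₀ + s * w₁ = b * w₁ := by
  by_cases h1 : q = 0 ∧ p = b
  · by_cases h2 : r = 0 ∧ s = b
    · exact ⟨1, 0, Or.inl one_ne_zero, by rw [h1.2]; ring, by rw [h2.1]; ring⟩
    · refine ⟨b - s, r, ?_, by rw [h1.1, h1.2]; ring, by ring⟩
      by_contra h
      push Not at h
      exact h2 ⟨h.2, by linarith⟩
  · refine ⟨q, b - p, ?_, by ring, ?_⟩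
    · by_contra h
      push Not at h
      exact h1 ⟨h.1, by linarith⟩
    · linear_combination b * ht - hd

theorem exists_complement_two {w₀ w₁ : ℝ} (h : w₀ ≠ 0 ∨ w₁ ≠ 0) :
    ∃ u₀ u₁ : ℝ, w₀ * u₁ - u₀ * w₁ ≠ 0 := by
  rcases h with h | h
  · exact ⟨0, 1, by simpa⟩
  · exact ⟨1, 0, by simpa⟩

/-- Schur form. -/
theorem exists_triangularization {X : M3} {a b c : ℝ} (h1 : X.trace = a + b + c)
    (h2 : X.adjugate.trace = a * b + b * c + c * a) (h3 : X.det = a * b * c) :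
    ∃ (R : SL3) (x y z : ℝ), conjMat R X = !![a, x, y; 0, b, z; 0, 0, c] := by
  have hdet : (X - a • 1).det = 0 := by rw [det_sub_smul_one, h1, h2, h3]; ring
  obtain ⟨v, hv, hv'⟩ := Matrix.exists_mulVec_eq_zero_iff.2 hdet
  rw [Matrix.sub_mulVec, Matrix.smul_mulVec, Matrix.one_mulVec, sub_eq_zero] at hv'
  obtain ⟨T, hT, hTv⟩ := exists_first_col hv
  obtain ⟨R, hR⟩ := exists_SL3_conj hT
  have hTu : IsUnit T.det := isUnit_iff_ne_zero.2 hT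
  have hY := hR X (T⁻¹ * X * T) (by
    rw [mul_assoc, Matrix.mul_nonsing_inv_cancel_left _ _ hTu])
  set Y := T⁻¹ * X * T with hYdef
  have hcol : ∀ i, Y i 0 = if i = 0 then a else 0 := by
    intro i
    have e : T.mulVec (Pi.single 0 1) = v := by
      rw [Matrix.mulVec_single_one]; ext i; exact hTv i
    have : Y.mulVec (Pi.single 0 1) = a • Pi.single 0 1 := by
      rw [hYdef, ← Matrix.mulVec_mulVec, ← Matrix.mulVec_mulVec, e, hv', Matrix.mulVec_smul, ← e,
        Matrix.mulVec_mulVec, Matrix.nonsing_inv_mul _ hTu, Matrix.one_mulVec]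
    have := congrFun this i
    rw [Matrix.mulVec_single_one] at this
    rw [Matrix.col_apply] at this
    rw [this]
    fin_cases i <;> simp
  have y0 : Y 0 0 = a := hcol 0
  have y1 : Y 1 0 = 0 := hcol 1
  have y2 : Y 2 0 = 0 := hcol 2
  have t1 : Y.trace = a + b + c := by rw [← hY, trace_conjMat, h1]
  have t2 : Y.adjugate.trace = a * b + b * c + c * a := by rw [← hY, trace_adjugate_conjMat, h2]
  rw [Matrix.adjugate_fin_three] at t2
  simp [Matrix.trace, Fin.sum_univ_three, y0, y1, y2] at t1 t2
  have ht : Y 1 1 + Y 2 2 = b + c := by linarith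
  have hd : Y 1 1 * Y 2 2 - Y 1 2 * Y 2 1 = b * c := by linear_combination t2 - a * ht
  obtain ⟨w₀, w₁, hw, e0, e1⟩ := exists_eigenvector_two ht hd
  obtain ⟨u₀, u₁, hu⟩ := exists_complement_two hw
  set δ := w₀ * u₁ - u₀ * w₁ with hδ
  obtain ⟨R', hR'⟩ := exists_SL3_conj (T := !![1, 0, 0; 0, w₀, u₀; 0, w₁, u₁])
    (by simpa [Matrix.det_fin_three] using hu)
  refine ⟨R' * R, Y 0 1 * w₀ + Y 0 2 * w₁, Y 0 1 * u₀ + Y 0 2 * u₁,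
    (u₁ * (Y 1 1 * u₀ + Y 1 2 * u₁) - u₀ * (Y 2 1 * u₀ + Y 2 2 * u₁)) / δ, ?_⟩
  rw [conjMat_mul, hY]
  refine hR' _ _ ?_
  have hc : c = (w₀ * (Y 2 1 * u₀ + Y 2 2 * u₁) - w₁ * (Y 1 1 * u₀ + Y 1 2 * u₁)) / δ := by
    rw [eq_div_iff hu, hδ]
    linear_combination (-(w₀ * u₁ - u₀ * w₁)) * ht + u₁ * e0 - u₀ * e1
  rw [hc]
  ext i j
  fin_cases i <;> fin_cases j <;> simp [Matrix.mul_apply, Fin.sum_univ_three, y0, y1, y2]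
  · linarith
  · field_simp; rw [hδ]; ring
  · linarith
  · field_simp; rw [hδ]; ring

/-- A family of matrices lies in a conjugate of one of the five model algebras. -/
def FitsModel (S : Set M3) : Prop :=
  ∃ R : SL3, (∀ X ∈ S, conjMat R X ∈ LinearMap.range paramC) ∨
    (∀ X ∈ S, conjMat R X ∈ LinearMap.range paramF) ∨
    (∀ X ∈ S, conjMat R X ∈ LinearMap.range paramN1) ∨
    (∀ X ∈ S, conjMat R X ∈ LinearMap.range paramN2) ∨
    (∀ X ∈ S, conjMat R X ∈ LinearMap.range paramN3)

theorem FitsModel.of_image {S : Set M3} {R : SL3} (h : FitsModel (conjMat R '' S)) :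
    FitsModel S := by
  obtain ⟨Q, h⟩ := h
  refine ⟨Q * R, ?_⟩
  simp only [conjMat_mul]
  simpa only [Set.forall_mem_image] using h

/-- Commuting families of matrices with real eigenvalues. -/
structure CommSplit (S : Set M3) : Prop where
  comm : ∀ X ∈ S, ∀ Y ∈ S, X * Y = Y * X
  split : ∀ X ∈ S, RealSplit X

theorem CommSplit.image {S : Set M3} (h : CommSplit S) (R : SL3) :
    CommSplit (conjMat R '' S) where
  comm := by
    rintro _ ⟨X, hX, rfl⟩ _ ⟨Y, hY, rfl⟩
    rw [← map_mul, ← map_mul, h.comm X hX Y hY]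
  split := by
    rintro _ ⟨X, hX, rfl⟩
    exact (h.split X hX).conjMat R

theorem mem_range_paramC_of {Y : M3} (h01 : Y 0 1 = 0) (h02 : Y 0 2 = 0) (h10 : Y 1 0 = 0)
    (h12 : Y 1 2 = 0) (h20 : Y 2 0 = 0) (h21 : Y 2 1 = 0) : Y ∈ LinearMap.range paramC := by
  refine ⟨![Y 0 0, Y 1 1, Y 2 2], ?_⟩
  rw [paramC_apply]
  ext i j
  fin_cases i <;> fin_cases j <;> simp [*]

theorem mem_range_paramF_of {Y : M3} (h02 : Y 0 2 = 0) (h10 : Y 1 0 = 0) (h11 : Y 1 1 = Y 0 0)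
    (h12 : Y 1 2 = 0) (h20 : Y 2 0 = 0) (h21 : Y 2 1 = 0) : Y ∈ LinearMap.range paramF := by
  refine ⟨![Y 0 0, Y 0 1, Y 2 2], ?_⟩
  rw [paramF_apply]
  ext i j
  fin_cases i <;> fin_cases j <;> simp [*]

/-- The commutation relations, entry by entry. -/
theorem entries_of_commute {X Y : M3} (h : X * Y = Y * X) (i j : Fin 3) :
    X i 0 * Y 0 j + X i 1 * Y 1 j + X i 2 * Y 2 j =
      Y i 0 * X 0 j + Y i 1 * X 1 j + Y i 2 * X 2 j := by
  have := congrFun (congrFun h i) j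
  rwa [Matrix.mul_apply, Matrix.mul_apply, Fin.sum_univ_three, Fin.sum_univ_three] at this

theorem fitsModel_of_diagonal_mem {S : Set M3} (h : CommSplit S) {l : Fin 3 → ℝ}
    (hl : Function.Injective l) (hX : Matrix.diagonal l ∈ S) : FitsModel S := by
  refine ⟨1, Or.inl fun Y hY => ?_⟩
  rw [conjMat_one]
  have key : ∀ i j, i ≠ j → Y i j = 0 := by
    intro i j hij
    have := congrFun (congrFun (h.comm _ hX Y hY) i) j
    rw [Matrix.diagonal_mul, Matrix.mul_diagonal] at this
    have h0 : (l i - l j) * Y i j = 0 := by linear_combination this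
    exact (mul_eq_zero.1 h0).resolve_left (sub_ne_zero.2 (hl.ne hij))
  apply mem_range_paramC_of <;> exact key _ _ (by decide)

theorem fitsModel_of_distinct {S : Set M3} (h : CommSplit S) {X : M3} (hX : X ∈ S) {a b c : ℝ}
    (h1 : X.trace = a + b + c) (h2 : X.adjugate.trace = a * b + b * c + c * a)
    (h3 : X.det = a * b * c) (hab : a ≠ b) (hac : a ≠ c) (hbc : b ≠ c) : FitsModel S := by
  have hinj : Function.Injective ![a, b, c] := by
    intro i j hij
    fin_cases i <;> fin_cases j <;> simp [hab, hac, hbc, hab.symm, hac.symm, hbc.symm] at hij ⊢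
  obtain ⟨T, hT, hXT⟩ := exists_diagonalization X ![a, b, c] hinj (fun i => by
    rw [det_sub_smul_one, h1, h2, h3]
    fin_cases i <;> simp <;> ring)
  obtain ⟨R, hR⟩ := exists_SL3_conj hT
  exact FitsModel.of_image (R := R)
    (fitsModel_of_diagonal_mem (h.image R) hinj ⟨X, hX, hR _ _ hXT⟩)

theorem exists_block_conj {w₀ w₁ u₀ u₁ : ℝ} (hu : w₀ * u₁ - u₀ * w₁ ≠ 0) :
    ∃ R : SL3, (∀ X Y : M3, X * !![w₀, u₀, 0; w₁, u₁, 0; 0, 0, 1] =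
      !![w₀, u₀, 0; w₁, u₁, 0; 0, 0, 1] * Y → conjMat R X = Y) ∧
      ∀ X : M3, X 0 2 = 0 ∧ X 1 2 = 0 ∧ X 2 0 = 0 ∧ X 2 1 = 0 → conjMat R X 0 2 = 0 ∧
        conjMat R X 1 2 = 0 ∧ conjMat R X 2 0 = 0 ∧ conjMat R X 2 1 = 0 := by
  obtain ⟨R, hR⟩ := exists_SL3_conj (T := !![w₀, u₀, 0; w₁, u₁, 0; 0, 0, 1])
    (by simpa [Matrix.det_fin_three] using hu)
  refine ⟨R, hR, fun X ⟨h1, h2, h3, h4⟩ => ?_⟩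
  set δ := w₀ * u₁ - u₀ * w₁ with hδ
  have := hR X !![(u₁ * (X 0 0 * w₀ + X 0 1 * w₁) - u₀ * (X 1 0 * w₀ + X 1 1 * w₁)) / δ,
    (u₁ * (X 0 0 * u₀ + X 0 1 * u₁) - u₀ * (X 1 0 * u₀ + X 1 1 * u₁)) / δ, 0;
    (w₀ * (X 1 0 * w₀ + X 1 1 * w₁) - w₁ * (X 0 0 * w₀ + X 0 1 * w₁)) / δ,
    (w₀ * (X 1 0 * u₀ + X 1 1 * u₁) - w₁ * (X 0 0 * u₀ + X 0 1 * u₁)) / δ, 0; 0, 0, X 2 2] (by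
      ext i j
      fin_cases i <;> fin_cases j <;>
        simp [Matrix.mul_apply, Fin.sum_univ_three, h1, h2, h3, h4] <;> field_simp <;> rw [hδ] <;>
        ring)
  rw [this]
  simp

theorem det_two_ne_zero_of_eigenvectors {p q r s b c w₀ w₁ u₀ u₁ : ℝ} (hbc : b ≠ c)
    (hw : w₀ ≠ 0 ∨ w₁ ≠ 0) (hu : u₀ ≠ 0 ∨ u₁ ≠ 0) (e0 : p * w₀ + q * w₁ = b * w₀)
    (e1 : r * w₀ + s * w₁ = b * w₁) (f0 : p * u₀ + q * u₁ = c * u₀)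
    (f1 : r * u₀ + s * u₁ = c * u₁) : w₀ * u₁ - u₀ * w₁ ≠ 0 := by
  intro h
  have hne : b - c ≠ 0 := sub_ne_zero.2 hbc
  have k00 : w₀ * u₀ = 0 := (mul_eq_zero.1 (show (b - c) * (w₀ * u₀) = 0 by
    linear_combination -u₀ * e0 + w₀ * f0 - q * h)).resolve_left hne
  have k01 : w₀ * u₁ = 0 := (mul_eq_zero.1 (show (b - c) * (w₀ * u₁) = 0 by
    linear_combination -u₁ * e0 + w₁ * f0 + (p - c) * h)).resolve_left hne
  have k10 : w₁ * u₀ = 0 := by linarith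
  have k11 : w₁ * u₁ = 0 := (mul_eq_zero.1 (show (b - c) * (w₁ * u₁) = 0 by
    linear_combination -u₁ * e1 + w₁ * f1 + r * h)).resolve_left hne
  rcases hw with hw | hw <;> rcases hu with hu | hu
  · exact mul_ne_zero hw hu k00
  · exact mul_ne_zero hw hu k01
  · exact mul_ne_zero hw hu k10
  · exact mul_ne_zero hw hu k11

/-- The upper 2 × 2 blocks commute. A non-scalar one either has distinct eigenvalues, which
diagonalizes the family, or is a Jordan block, whose centralizer is that of `F`. -/
theorem fitsModel_of_block {S : Set M3} (h : CommSplit S)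
    (hblock : ∀ Y ∈ S, Y 0 2 = 0 ∧ Y 1 2 = 0 ∧ Y 2 0 = 0 ∧ Y 2 1 = 0) : FitsModel S := by
  by_cases hall : ∀ Y ∈ S, Y 0 1 = 0 ∧ Y 1 0 = 0
  · refine ⟨1, Or.inl fun Y hY => ?_⟩
    rw [conjMat_one]
    obtain ⟨h1, h2, h3, h4⟩ := hblock Y hY
    obtain ⟨h5, h6⟩ := hall Y hY
    exact mem_range_paramC_of h5 h1 h6 h2 h3 h4
  push Not at hall
  obtain ⟨X, hX, hXne⟩ := hall
  obtain ⟨x1, x2, x3, x4⟩ := hblock X hX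
  obtain ⟨a, b, c, s1, s2, s3⟩ := h.split X hX
  -- The corner entry is one of the three roots; the other two belong to the block.
  have hroots : ∃ b c : ℝ, X 0 0 + X 1 1 = b + c ∧ X 0 0 * X 1 1 - X 0 1 * X 1 0 = b * c := by
    rw [Matrix.adjugate_fin_three] at s2
    rw [Matrix.det_fin_three] at s3
    simp [Matrix.trace, Fin.sum_univ_three, x1, x2, x3, x4] at s1 s2 s3
    have hk : (X 2 2 - a) * (X 2 2 - b) * (X 2 2 - c) = 0 := by
      linear_combination X 2 2 ^ 2 * s1 - X 2 2 * s2 + s3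
    rcases mul_eq_zero.1 hk with hk | hk
    · rcases mul_eq_zero.1 hk with hk | hk
      · have : a = X 2 2 := by linarith
        refine ⟨b, c, by linarith, ?_⟩
        subst this
        linear_combination s2 - X 2 2 * s1
      · have : b = X 2 2 := by linarith
        refine ⟨a, c, by linarith, ?_⟩
        subst this
        linear_combination s2 - X 2 2 * s1
    · have : c = X 2 2 := by linarith
      refine ⟨a, b, by linarith, ?_⟩
      subst this
      linear_combination s2 - X 2 2 * s1
  clear a b c s1 s2 s3
  obtain ⟨b, c, ht, hd⟩ := hroots
  obtain ⟨w₀, w₁, hw, e0, e1⟩ := exists_eigenvector_two ht hd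
  by_cases hbc : b = c
  · subst hbc
    clear hw e0 e1 w₀ w₁
    -- A Jordan chain: u is a basis vector that is not an eigenvector and w = (X - b)u, which
    -- Cayley-Hamilton makes an eigenvector.
    obtain ⟨w₀, w₁, u₀, u₁, hδ, e0, e1, f0, f1⟩ : ∃ w₀ w₁ u₀ u₁ : ℝ, w₀ * u₁ - u₀ * w₁ ≠ 0 ∧
        X 0 0 * w₀ + X 0 1 * w₁ = b * w₀ ∧ X 1 0 * w₀ + X 1 1 * w₁ = b * w₁ ∧
        X 0 0 * u₀ + X 0 1 * u₁ = w₀ + b * u₀ ∧ X 1 0 * u₀ + X 1 1 * u₁ = w₁ + b * u₁ := by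
      by_cases hq : X 0 1 = 0
      · refine ⟨X 0 0 - b, X 1 0, 1, 0, by simpa using hXne hq, ?_, ?_, by ring, by ring⟩
        · linear_combination X 0 0 * ht - hd
        · linear_combination X 1 0 * ht
      · refine ⟨X 0 1, X 1 1 - b, 0, 1, by simpa using hq, ?_, ?_, by ring, by ring⟩
        · linear_combination X 0 1 * ht
        · linear_combination X 1 1 * ht - hd
    obtain ⟨R, hR, hRb⟩ := exists_block_conj hδ
    refine FitsModel.of_image (R := R) ⟨1, Or.inr (Or.inl ?_)⟩
    rintro _ ⟨Y, hY, rfl⟩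
    have hXR : conjMat R X = !![b, 1, 0; 0, b, 0; 0, 0, X 2 2] := by
      refine hR _ _ ?_
      ext i j
      fin_cases i <;> fin_cases j <;>
        simp [Matrix.mul_apply, Fin.sum_univ_three, x1, x2, x3, x4] <;> linarith
    have hcomm := (h.image R).comm _ ⟨X, hX, rfl⟩ _ ⟨Y, hY, rfl⟩
    obtain ⟨g1, g2, g3, g4⟩ := hRb Y (hblock Y hY)
    rw [conjMat_one]
    rw [hXR] at hcomm
    have k00 := entries_of_commute hcomm 0 0
    have k01 := entries_of_commute hcomm 0 1
    simp at k00 k01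
    exact mem_range_paramF_of g1 (by linarith) (by linarith) g2 g3 g4
  · obtain ⟨u₀, u₁, hu, f0, f1⟩ := exists_eigenvector_two (p := X 0 0) (q := X 0 1) (r := X 1 0)
      (s := X 1 1) (b := c) (c := b) (by linarith) (by linarith)
    obtain ⟨R, hR, hRb⟩ := exists_block_conj
      (det_two_ne_zero_of_eigenvectors hbc hw hu e0 e1 f0 f1)
    refine FitsModel.of_image (R := R) ⟨1, Or.inl ?_⟩
    rintro _ ⟨Y, hY, rfl⟩
    have hXR : conjMat R X = !![b, 0, 0; 0, c, 0; 0, 0, X 2 2] := by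
      refine hR _ _ ?_
      ext i j
      fin_cases i <;> fin_cases j <;>
        simp [Matrix.mul_apply, Fin.sum_univ_three, x1, x2, x3, x4] <;> linarith
    have hcomm := (h.image R).comm _ ⟨X, hX, rfl⟩ _ ⟨Y, hY, rfl⟩
    obtain ⟨g1, g2, g3, g4⟩ := hRb Y (hblock Y hY)
    rw [conjMat_one]
    rw [hXR] at hcomm
    have k01 := entries_of_commute hcomm 0 1
    have k10 := entries_of_commute hcomm 1 0
    simp at k01 k10
    have hne : b - c ≠ 0 := sub_ne_zero.2 hbc
    refine mem_range_paramC_of ?_ g1 ?_ g2 g3 g4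
    · exact (mul_eq_zero.1 (show (b - c) * conjMat R Y 0 1 = 0 by linarith)).resolve_left hne
    · exact (mul_eq_zero.1 (show (b - c) * conjMat R Y 1 0 = 0 by linarith)).resolve_left hne

/-- Since c - a is invertible, the eigenline for c splits off from the generalized eigenspace for a.
Everything commuting with X respects this splitting. -/
theorem fitsModel_of_double {S : Set M3} (h : CommSplit S) {X : M3} (hX : X ∈ S) {a c : ℝ}
    (h1 : X.trace = a + a + c) (h2 : X.adjugate.trace = a * a + a * c + c * a)
    (h3 : X.det = a * a * c) (hac : a ≠ c) : FitsModel S := by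
  obtain ⟨R, x, y, z, hR⟩ := exists_triangularization h1 h2 h3
  refine FitsModel.of_image (R := R) ?_
  have hne : c - a ≠ 0 := sub_ne_zero.2 hac.symm
  obtain ⟨Q, hQ⟩ := exists_SL3_conj (T := !![1, 0, (x * (z / (c - a)) + y) / (c - a);
    0, 1, z / (c - a); 0, 0, 1]) (by simp [Matrix.det_fin_three])
  have hX' : conjMat Q (conjMat R X) = !![a, x, 0; 0, a, 0; 0, 0, c] := by
    refine hQ _ _ ?_
    rw [hR]
    ext i j
    fin_cases i <;> fin_cases j <;> simp [Matrix.mul_apply, Fin.sum_univ_three] <;> field_simp <;>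
      ring
  refine FitsModel.of_image (R := Q) (fitsModel_of_block ((h.image R).image Q) ?_)
  intro Y hY
  have hcomm := ((h.image R).image Q).comm _ ⟨_, ⟨X, hX, rfl⟩, rfl⟩ _ hY
  rw [hX'] at hcomm
  have k02 := entries_of_commute hcomm 0 2
  have k12 := entries_of_commute hcomm 1 2
  have k20 := entries_of_commute hcomm 2 0
  have k21 := entries_of_commute hcomm 2 1
  simp at k02 k12 k20 k21
  have y12 : Y 1 2 = 0 :=
    (mul_eq_zero.1 (show (c - a) * Y 1 2 = 0 by linarith)).resolve_left hne
  have y20 : Y 2 0 = 0 :=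
    (mul_eq_zero.1 (show (c - a) * Y 2 0 = 0 by linarith)).resolve_left hne
  rw [y12, mul_zero] at k02
  rw [y20, zero_mul] at k21
  exact ⟨(mul_eq_zero.1 (show (c - a) * Y 0 2 = 0 by linarith)).resolve_left hne, y12, y20,
    (mul_eq_zero.1 (show (c - a) * Y 2 1 = 0 by linarith)).resolve_left hne⟩

/-- The nonzero superdiagonal makes e₃ cyclic, and (X - a)²e₃, (X - a)e₃, e₃ is a Jordan basis. The
centralizer of a full Jordan block is the algebra of `N₁`. -/
theorem fitsModel_of_regular {S : Set M3} (h : CommSplit S) {a x y z : ℝ}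
    (hX : (!![a, x, y; 0, a, z; 0, 0, a] : M3) ∈ S) (hx : x ≠ 0) (hz : z ≠ 0) : FitsModel S := by
  obtain ⟨Q, hQ⟩ := exists_SL3_conj (T := !![x * z, y, 0; 0, z, 0; 0, 0, 1])
    (by simp [Matrix.det_fin_three, hx, hz])
  have hX' : conjMat Q !![a, x, y; 0, a, z; 0, 0, a] = !![a, 1, 0; 0, a, 1; 0, 0, a] := by
    refine hQ _ _ ?_
    ext i j
    fin_cases i <;> fin_cases j <;> simp [Matrix.mul_apply, Fin.sum_univ_three] <;> ring
  refine FitsModel.of_image (R := Q) ⟨1, Or.inr (Or.inr (Or.inl fun Y hY => ?_))⟩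
  have hcomm := (h.image Q).comm _ ⟨_, hX, rfl⟩ _ hY
  rw [hX'] at hcomm
  have k00 := entries_of_commute hcomm 0 0
  have k01 := entries_of_commute hcomm 0 1
  have k02 := entries_of_commute hcomm 0 2
  have k10 := entries_of_commute hcomm 1 0
  have k11 := entries_of_commute hcomm 1 1
  have k12 := entries_of_commute hcomm 1 2
  simp at k00 k01 k02 k10 k11 k12
  rw [conjMat_one]
  refine ⟨![Y 0 0, Y 0 1, Y 0 2], ?_⟩
  rw [paramN1_apply]
  ext i j
  fin_cases i <;> fin_cases j <;> simp <;> linarith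

theorem conjMat_sub_smul_one (R : SL3) (X : M3) (a : ℝ) :
    conjMat R (X - a • 1) = conjMat R X - a • 1 := by
  rw [map_sub, map_smul, map_one]

/-- Commuting with E₁₃ and having square-zero nilpotent part makes each member a scalar plus a
strictly upper triangular matrix with zero product of its superdiagonal entries. Commutativity then
forces the same superdiagonal entry to vanish throughout the family, giving `N₂` or `N₃`. -/
theorem fitsModel_of_square_zero {S : Set M3} (h : CommSplit S)
    (hsq : ∀ X ∈ S, ∃ a : ℝ, (X - a • 1) * (X - a • 1) = 0) {a : ℝ}
    (hX : (!![a, 0, 1; 0, a, 0; 0, 0, a] : M3) ∈ S) : FitsModel S := by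
  have key : ∀ Y ∈ S, Y 1 0 = 0 ∧ Y 2 0 = 0 ∧ Y 2 1 = 0 ∧ Y 1 1 = Y 0 0 ∧ Y 2 2 = Y 0 0 ∧
      Y 0 1 * Y 1 2 = 0 := by
    intro Y hY
    have hcomm := h.comm _ hX _ hY
    have k00 := entries_of_commute hcomm 0 0
    have k01 := entries_of_commute hcomm 0 1
    have k02 := entries_of_commute hcomm 0 2
    have k12 := entries_of_commute hcomm 1 2
    simp at k00 k01 k02 k12
    have y20 : Y 2 0 = 0 := by linarith
    have y21 : Y 2 1 = 0 := by linarith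
    have y22 : Y 2 2 = Y 0 0 := by linarith
    have y10 : Y 1 0 = 0 := by linarith
    obtain ⟨b, hb⟩ := hsq Y hY
    have s00 := congrFun (congrFun hb 0) 0
    have s11 := congrFun (congrFun hb 1) 1
    have s02 := congrFun (congrFun hb 0) 2
    simp [Matrix.mul_apply, Fin.sum_univ_three, y20, y21, y22, y10] at s00 s11 s02
    rw [s00] at s02
    refine ⟨y10, y20, y21, by linarith, y22, by linarith⟩
  have hcomm : ∀ Y ∈ S, ∀ Z ∈ S, Y 0 1 * Z 1 2 = Z 0 1 * Y 1 2 := by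
    intro Y hY Z hZ
    obtain ⟨a1, a2, a3, a4, a5, -⟩ := key Y hY
    obtain ⟨b1, b2, b3, b4, b5, -⟩ := key Z hZ
    have := entries_of_commute (h.comm Y hY Z hZ) 0 2
    rw [a5, b5] at this
    linarith
  by_cases hz : ∀ Y ∈ S, Y 0 1 = 0
  · refine ⟨1, Or.inr (Or.inr (Or.inr (Or.inr fun Y hY => ?_)))⟩
    obtain ⟨a1, a2, a3, a4, a5, -⟩ := key Y hY
    have a6 := hz Y hY
    rw [conjMat_one]
    refine ⟨![Y 0 0, Y 1 2, Y 0 2], ?_⟩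
    rw [paramN3_apply]
    ext i j
    fin_cases i <;> fin_cases j <;> simp <;> linarith
  · push Not at hz
    obtain ⟨Z, hZ, hZ0⟩ := hz
    refine ⟨1, Or.inr (Or.inr (Or.inr (Or.inl fun Y hY => ?_)))⟩
    obtain ⟨a1, a2, a3, a4, a5, -⟩ := key Y hY
    obtain ⟨-, -, -, -, -, b6⟩ := key Z hZ
    have hZ12 : Z 1 2 = 0 := (mul_eq_zero.1 b6).resolve_left hZ0
    have a6 : Y 1 2 = 0 := by
      have := hcomm Z hZ Y hY
      rw [hZ12, mul_zero] at this
      exact (mul_eq_zero.1 this).resolve_left hZ0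
    rw [conjMat_one]
    refine ⟨![Y 0 0, Y 0 1, Y 0 2], ?_⟩
    rw [paramN2_apply]
    ext i j
    fin_cases i <;> fin_cases j <;> simp <;> linarith

/-- The nilpotent part N has rank one. The basis consists of a vector N v, a vector completing it to
a basis of ker N, and v. -/
theorem exists_conj_square_zero {a x y z : ℝ} (hxz : x = 0 ∨ z = 0)
    (hne : ¬(x = 0 ∧ y = 0 ∧ z = 0)) :
    ∃ R : SL3, conjMat R !![a, x, y; 0, a, z; 0, 0, a] = !![a, 0, 1; 0, a, 0; 0, 0, a] := by
  rcases hxz with rfl | rfl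
  · have hs : y ^ 2 + z ^ 2 ≠ 0 := by
      intro h
      exact hne ⟨rfl, by nlinarith [sq_nonneg y, sq_nonneg z], by nlinarith [sq_nonneg y, sq_nonneg z]⟩
    obtain ⟨Q, hQ⟩ := exists_SL3_conj (T := !![y, -z, 0; z, y, 0; 0, 0, 1]) (by
      simp only [Matrix.det_fin_three]; simp; intro h; exact hs (by linarith))
    refine ⟨Q, hQ _ _ ?_⟩
    ext i j
    fin_cases i <;> fin_cases j <;> simp [Matrix.mul_apply, Fin.sum_univ_three] <;> ring
  · have hs : x ^ 2 + y ^ 2 ≠ 0 := by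
      intro h
      exact hne ⟨by nlinarith [sq_nonneg y, sq_nonneg x], by nlinarith [sq_nonneg y, sq_nonneg x], rfl⟩
    obtain ⟨Q, hQ⟩ := exists_SL3_conj
      (T := !![x ^ 2 + y ^ 2, 0, 0; 0, -y, x; 0, x, y]) (by
      simp only [Matrix.det_fin_three]; simp
      exact fun h => mul_ne_zero hs hs (by linarith))
    refine ⟨Q, hQ _ _ ?_⟩
    ext i j
    fin_cases i <;> fin_cases j <;> simp [Matrix.mul_apply, Fin.sum_univ_three] <;> ring

/-- Commuting families of matrices with real eigenvalues fit into one of the five models. -/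
theorem CommSplit.fitsModel {S : Set M3} (h : CommSplit S) : FitsModel S := by
  -- A member with at least two distinct eigenvalues settles the matter. Otherwise all nilpotent
  -- parts are studied by rank: a regular one gives `N₁`, and without one all of them have square
  -- zero.
  by_cases htriple : ∀ X ∈ S, ∃ a : ℝ, X.trace = a + a + a ∧
      X.adjugate.trace = a * a + a * a + a * a ∧ X.det = a * a * a
  swap
  · push Not at htriple
    obtain ⟨X, hX, hne⟩ := htriple
    obtain ⟨a, b, c, h1, h2, h3⟩ := h.split X hX
    by_cases hab : a = b
    · subst hab
      refine fitsModel_of_double h hX (a := a) (c := c) h1 (by linarith) h3 ?_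
      rintro rfl
      exact hne a h1 h2 h3
    by_cases hac : a = c
    · subst hac
      exact fitsModel_of_double h hX (a := a) (c := b) (by linarith) (by linarith) (by linarith) hab
    by_cases hbc : b = c
    · subst hbc
      exact fitsModel_of_double h hX (a := b) (c := a) (by linarith) (by linarith) (by linarith)
        (Ne.symm hab)
    exact fitsModel_of_distinct h hX h1 h2 h3 hab hac hbc
  by_cases hreg : ∃ X ∈ S, ∃ (R : SL3) (a x y z : ℝ),
      conjMat R X = !![a, x, y; 0, a, z; 0, 0, a] ∧ x ≠ 0 ∧ z ≠ 0
  · obtain ⟨X, hX, R, a, x, y, z, hR, hx, hz⟩ := hreg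
    exact FitsModel.of_image (R := R) (fitsModel_of_regular (h.image R) ⟨X, hX, hR⟩ hx hz)
  push Not at hreg
  have htri : ∀ X ∈ S, ∃ (R : SL3) (a x y z : ℝ), conjMat R X = !![a, x, y; 0, a, z; 0, 0, a] ∧
      (x = 0 ∨ z = 0) := by
    intro X hX
    obtain ⟨a, h1, h2, h3⟩ := htriple X hX
    obtain ⟨R, x, y, z, hR⟩ := exists_triangularization h1 h2 h3
    exact ⟨R, a, x, y, z, hR, or_iff_not_imp_left.2 fun hx => hreg X hX R a x y z hR hx⟩
  have hsq : ∀ X ∈ S, ∃ a : ℝ, (X - a • 1) * (X - a • 1) = 0 := by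
    intro X hX
    obtain ⟨R, a, x, y, z, hR, hxz⟩ := htri X hX
    refine ⟨a, (conjMat R).injective ?_⟩
    rw [map_zero, map_mul, conjMat_sub_smul_one, hR]
    ext i j
    fin_cases i <;> fin_cases j <;> simp [Matrix.mul_apply, Fin.sum_univ_three, hxz]
  by_cases hsc : ∀ X ∈ S, ∃ a : ℝ, X = a • 1
  · refine ⟨1, Or.inl fun X hX => ?_⟩
    obtain ⟨a, rfl⟩ := hsc X hX
    rw [conjMat_one]
    exact Submodule.smul_mem _ _ one_mem_range_paramC
  push Not at hsc
  obtain ⟨X, hX, hne⟩ := hsc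
  obtain ⟨R, a, x, y, z, hR, hxz⟩ := htri X hX
  obtain ⟨Q, hQ⟩ := exists_conj_square_zero (a := a) (y := y) hxz (by
    rintro ⟨rfl, rfl, rfl⟩
    refine hne a ((conjMat R).injective ?_)
    rw [hR, map_smul, map_one]
    ext i j
    fin_cases i <;> fin_cases j <;> simp)
  refine FitsModel.of_image (R := Q * R) (fitsModel_of_square_zero (h.image _) ?_
    ⟨X, hX, by rw [conjMat_mul, hR, hQ]⟩)
  rintro _ ⟨Y, hY, rfl⟩
  obtain ⟨b, hb⟩ := hsq Y hY
  exact ⟨b, by rw [← conjMat_sub_smul_one, ← map_mul, hb, map_zero]⟩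

/-! ### Real spectrum is a closed condition -/

theorem exists_cubic_root (p q r : ℝ) : ∃ a : ℝ, a ^ 3 - p * a ^ 2 + q * a - r = 0 := by
  set M : ℝ := 1 + |p| + |q| + |r| with hM
  have hp := abs_nonneg p
  have hq := abs_nonneg q
  have hr := abs_nonneg r
  have hM1 : 1 ≤ M := by linarith
  have hM2 : M ≤ M ^ 2 := by nlinarith
  have hc : Continuous fun a : ℝ => a ^ 3 - p * a ^ 2 + q * a - r := by fun_prop
  have b1 : |p| * M ^ 2 + |q| * M + |r| ≤ (M - 1) * M ^ 2 := by
    have : |q| * M ≤ |q| * M ^ 2 := mul_le_mul_of_nonneg_left hM2 hq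
    have : |r| ≤ |r| * M ^ 2 := le_mul_of_one_le_right hr (by linarith)
    nlinarith
  have b2 : p * M ^ 2 ≤ |p| * M ^ 2 := mul_le_mul_of_nonneg_right (le_abs_self p) (by positivity)
  have b2' : -p * M ^ 2 ≤ |p| * M ^ 2 :=
    mul_le_mul_of_nonneg_right (neg_le_abs p) (by positivity)
  have b3 : -q * M ≤ |q| * M := mul_le_mul_of_nonneg_right (neg_le_abs q) (by linarith)
  have b4 := le_abs_self r
  have b4' := neg_le_abs r
  have hpos : 0 ≤ M ^ 3 - p * M ^ 2 + q * M - r := by nlinarith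
  have hneg : (-M) ^ 3 - p * (-M) ^ 2 + q * (-M) - r ≤ 0 := by nlinarith
  obtain ⟨a, -, ha⟩ := intermediate_value_Icc (by linarith : -M ≤ M) hc.continuousOn ⟨hneg, hpos⟩
  exact ⟨a, ha⟩

/-- A matrix without real splitting has a real eigenvalue and a pair of non-real ones. -/
theorem realSplit_or_complex (X : M3) : RealSplit X ∨ ∃ a u v : ℝ, v ≠ 0 ∧
    X.trace = a + 2 * u ∧ X.adjugate.trace = 2 * a * u + (u ^ 2 + v ^ 2) ∧
    X.det = a * (u ^ 2 + v ^ 2) := by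
  obtain ⟨a, ha⟩ := exists_cubic_root X.trace X.adjugate.trace X.det
  set s := X.trace - a with hs
  set t := X.adjugate.trace - a * s with ht
  have hdet : X.det = a * t := by rw [ht, hs]; linarith
  rcases le_or_gt 0 (s ^ 2 - 4 * t) with h | h
  · left
    have hsq := Real.sq_sqrt h
    refine ⟨a, (s + Real.sqrt (s ^ 2 - 4 * t)) / 2, (s - Real.sqrt (s ^ 2 - 4 * t)) / 2, ?_, ?_, ?_⟩
    · rw [hs]; ring
    · linear_combination (1 / 4 : ℝ) * hsq - ht
    · rw [hdet]; linear_combination (a / 4) * hsq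
  · right
    have h' : 0 < 4 * t - s ^ 2 := by linarith
    have hsq := Real.sq_sqrt h'.le
    refine ⟨a, s / 2, Real.sqrt (4 * t - s ^ 2) / 2, ?_, ?_, ?_, ?_⟩
    · exact div_ne_zero (Real.sqrt_pos.2 h').ne' two_ne_zero
    · rw [hs]; ring
    · linear_combination (-(1 / 4) : ℝ) * hsq - ht
    · rw [hdet]; linear_combination (-(a / 4)) * hsq

/-- The discriminant of the characteristic polynomial. -/
noncomputable def charDiscr (X : M3) : ℝ :=
  X.trace ^ 2 * X.adjugate.trace ^ 2 - 4 * X.adjugate.trace ^ 3 - 4 * X.trace ^ 3 * X.det +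
    18 * X.trace * X.adjugate.trace * X.det - 27 * X.det ^ 2

theorem continuous_charDiscr : Continuous charDiscr := by
  have h1 : Continuous fun X : M3 => X.trace := continuous_id.matrix_trace
  have h2 := continuous_trace_adjugate
  have h3 : Continuous fun X : M3 => X.det := continuous_id.matrix_det
  unfold charDiscr
  fun_prop

/-- The discriminant is the square of a product of differences for real roots and strictly negative
for a non-real pair. Splitting therefore passes to limits. -/
theorem realSplit_iff (X : M3) : RealSplit X ↔ 0 ≤ charDiscr X := by
  constructor
  · rintro ⟨a, b, c, h1, h2, h3⟩
    have : charDiscr X = ((a - b) * (b - c) * (c - a)) ^ 2 := by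
      rw [charDiscr, h1, h2, h3]; ring
    rw [this]
    positivity
  · intro h
    rcases realSplit_or_complex X with h' | ⟨a, u, v, hv, h1, h2, h3⟩
    · exact h'
    · exfalso
      have e : charDiscr X = -(4 * v ^ 2 * ((a - u) ^ 2 + v ^ 2) ^ 2) := by
        rw [charDiscr, h1, h2, h3]; ring
      have : 0 < 4 * v ^ 2 * ((a - u) ^ 2 + v ^ 2) ^ 2 := by positivity
      linarith

theorem RealSplit.of_mem_limitSpace {A : Submodule ℝ M3} (hA : ∀ X ∈ A, RealSplit X) {P : ℕ → SL3}
    {Y : M3} (hY : Y ∈ limitSpace P A) : RealSplit Y := by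
  obtain ⟨X, hX, hlim⟩ := hY
  rw [realSplit_iff]
  exact ge_of_tendsto' ((continuous_charDiscr.tendsto Y).comp hlim) fun n =>
    (realSplit_iff _).1 ((hA _ (hX n)).conjMat (P n))

theorem mul_comm_of_mem_limitSpace {A : Submodule ℝ M3} (hA : ∀ X ∈ A, ∀ Y ∈ A, X * Y = Y * X)
    {P : ℕ → SL3} {Y Z : M3} (hY : Y ∈ limitSpace P A) (hZ : Z ∈ limitSpace P A) :
    Y * Z = Z * Y := by
  obtain ⟨X, hX, hX'⟩ := hY
  obtain ⟨W, hW, hW'⟩ := hZ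
  refine tendsto_nhds_unique (hX'.mul hW') ?_
  have := hW'.mul hX'
  refine this.congr fun n => ?_
  rw [← map_mul, ← map_mul, hA _ (hX n) _ (hW n)]

/-! ### Conjugacy limits of `C` -/

/-- Compactness of the Grassmannian: conjugates of a three-dimensional space subconverge. -/
theorem exists_subseq_limitSpace {A : Submodule ℝ M3} (hA : Module.finrank ℝ A = 3)
    (P : ℕ → SL3) : ∃ k : ℕ → ℕ, StrictMono k ∧ ∃ B : Submodule ℝ M3,
      Module.finrank ℝ B = 3 ∧ B ≤ limitSpace (P ∘ k) A := by
  -- An inner product on matrices is borrowed from ℝ⁹. Orthonormal bases stay in a compact ball, and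
  -- orthonormality of their limit prevents a drop of dimension.
  let E := EuclideanSpace ℝ (Fin 9)
  let e : M3 ≃ₗ[ℝ] E := LinearEquiv.ofFinrankEq M3 E (by simp [E, Module.finrank_matrix])
  have he : Continuous e.symm := LinearMap.continuous_of_finiteDimensional e.symm.toLinearMap
  let V : ℕ → Submodule ℝ E := fun n => (conjSpace (P n) A).map e.toLinearMap
  have hV : ∀ n, Module.finrank ℝ (V n) = 3 := fun n =>
    (LinearEquiv.finrank_map_eq e _).trans ((finrank_conjSpace _ _).trans hA)
  let b : ∀ n, OrthonormalBasis (Fin 3) ℝ (V n) := fun n =>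
    (stdOrthonormalBasis ℝ (V n)).reindex (finCongr (hV n))
  let x : ℕ → Fin 3 → E := fun n i => (b n i : E)
  have hx : ∀ n, Orthonormal ℝ (x n) := fun n =>
    (b n).orthonormal.comp_linearIsometry (V n).subtypeₗᵢ
  have hmem : ∀ n, x n ∈ Metric.closedBall (0 : Fin 3 → E) 1 := by
    intro n
    rw [mem_closedBall_zero_iff, pi_norm_le_iff_of_nonneg zero_le_one]
    exact fun i => ((hx n).1 i).le
  obtain ⟨a, -, k, hk, hlim⟩ := (isCompact_closedBall (0 : Fin 3 → E) 1).tendsto_subseq hmem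
  have hlim' : ∀ i, Tendsto (fun n => x (k n) i) atTop (𝓝 (a i)) := fun i =>
    (tendsto_pi_nhds.1 hlim) i
  have ha : Orthonormal ℝ a := by
    classical
    rw [orthonormal_iff_ite]
    intro i j
    refine tendsto_nhds_unique ((hlim' i).inner (hlim' j)) ?_
    refine tendsto_const_nhds.congr fun n => ?_
    exact ((orthonormal_iff_ite.1 (hx (k n))) i j).symm
  have hind : LinearIndependent ℝ fun i => e.symm (a i) :=
    ha.linearIndependent.map' e.symm.toLinearMap e.symm.ker
  refine ⟨k, hk, Submodule.span ℝ (Set.range fun i => e.symm (a i)), ?_, ?_⟩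
  · rw [finrank_span_eq_card hind, Fintype.card_fin]
  · rw [Submodule.span_le]
    rintro _ ⟨i, rfl⟩
    have hin : ∀ n, e.symm (x (k n) i) ∈ conjSpace (P (k n)) A := by
      intro n
      obtain ⟨y, hy, hye⟩ := (b (k n) i).2
      have : e.symm (x (k n) i) = y := by
        rw [LinearEquiv.symm_apply_eq]; exact hye.symm
      rwa [this]
    refine ⟨fun n => conjMat (P (k n))⁻¹ (e.symm (x (k n) i)),
      fun n => mem_conjSpace.1 (hin n), ?_⟩
    simp only [Function.comp_apply, conjMat_conjMat_inv]
    exact (he.tendsto _).comp (hlim' i)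

theorem SubgroupsConvergeTo.unique_of_subseq {G : Type*} [Group G] [TopologicalSpace G]
    {H : ℕ → Subgroup G} {L L' : Subgroup G} (h : SubgroupsConvergeTo H L) {k : ℕ → ℕ}
    (hk : StrictMono k) (h' : SubgroupsConvergeTo (fun n => H (k n)) L') : L = L' := by
  classical
  ext g
  constructor
  · intro hg
    obtain ⟨u, hu, hlim⟩ := h.1 g hg
    exact h'.2 (fun n => u (k n)) (fun n => hu (k n)) g
      ⟨id, strictMono_id, hlim.comp hk.tendsto_atTop⟩
  · intro hg
    obtain ⟨u, hu, hlim⟩ := h'.1 g hg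
    -- A sequence along the subsequence is completed by the identity elsewhere, as membership is
    -- demanded for every index.
    let w : ℕ → G := fun m => if hm : ∃ n, k n = m then u hm.choose else 1
    have hw : ∀ n, w (k n) = u n := by
      intro n
      have hm : ∃ n', k n' = k n := ⟨n, rfl⟩
      have : w (k n) = u hm.choose := dif_pos hm
      rw [this, hk.injective hm.choose_spec]
    refine h.2 w (fun m => ?_) g ⟨k, hk, by simpa only [hw] using hlim⟩
    by_cases hm : ∃ n, k n = m
    · obtain ⟨n, rfl⟩ := hm
      rw [hw]; exact hu n
    · have : w m = 1 := dif_neg hm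
      rw [this]; exact one_mem _

theorem IsSplitPair.of_le {L : Subgroup SL3} {A B : Submodule ℝ M3} (h : IsSplitPair L A) {R : SL3}
    (hB : Module.finrank ℝ B = 3) (hBA : ∀ X ∈ B, conjMat R X ∈ A) :
    IsSplitPair (conjSubgroup R⁻¹ L) B := by
  have hle : B ≤ conjSpace R⁻¹ A := fun X hX => by
    rw [mem_conjSpace, inv_inv]; exact hBA X hX
  have : B = conjSpace R⁻¹ A :=
    Submodule.eq_of_le_of_finrank_eq hle (hB.trans (h.conj R⁻¹).finrank_eq.symm)
  rw [this]
  exact h.conj R⁻¹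

theorem mul_comm_range_paramC : ∀ X ∈ LinearMap.range paramC, ∀ Y ∈ LinearMap.range paramC,
    X * Y = Y * X := by
  rintro _ ⟨v, rfl⟩ _ ⟨w, rfl⟩
  simp only [paramC_eq_diagonal, Matrix.diagonal_mul_diagonal, mul_comm]

/-- Every conjugacy limit of `C` is conjugate to an element of `𝒬`. -/
theorem IsConjugacyLimit.exists_conj {G : Subgroup SL3} (h : IsConjugacyLimit G groupC) :
    ∃ R : SL3, G = conjSubgroup R groupC ∨ G = conjSubgroup R groupF ∨
      G = conjSubgroup R groupN1 ∨ G = conjSubgroup R groupN2 ∨ G = conjSubgroup R groupN3 := by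
  obtain ⟨P, hP⟩ := h
  obtain ⟨k, hk, B, hB, hBA⟩ := exists_subseq_limitSpace isSplitPair_C.finrank_eq P
  have hcs : CommSplit (B : Set M3) :=
    ⟨fun X hX Y hY => mul_comm_of_mem_limitSpace mul_comm_range_paramC (hBA hX) (hBA hY),
      fun X hX => RealSplit.of_mem_limitSpace isSplitPair_C.realSplit (hBA hX)⟩
  -- The conjugates converge to L along the subsequence, and a convergent sequence has the same
  -- limit along every subsequence.
  have key : ∀ L : Subgroup SL3, IsSplitPair L B → G = L := fun L hL =>
    hP.unique_of_subseq hk (isSplitPair_C.convergeTo hL hBA)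
  obtain ⟨R, h | h | h | h | h⟩ := hcs.fitsModel
  · exact ⟨R⁻¹, Or.inl (key _ (isSplitPair_C.of_le hB h))⟩
  · exact ⟨R⁻¹, Or.inr (Or.inl (key _ (isSplitPair_F.of_le hB h)))⟩
  · exact ⟨R⁻¹, Or.inr (Or.inr (Or.inl (key _ (isSplitPair_N1.of_le hB h))))⟩
  · exact ⟨R⁻¹, Or.inr (Or.inr (Or.inr (Or.inl (key _ (isSplitPair_N2.of_le hB h)))))⟩
  · exact ⟨R⁻¹, Or.inr (Or.inr (Or.inr (Or.inr (key _ (isSplitPair_N3.of_le hB h)))))⟩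

/-- The conjugator in the classification of limits is transferred to `C`, where the flows exist for
every conjugate. -/
theorem IsConjugacyLimit.isOneParameterLimit {G : Subgroup SL3} (h : IsConjugacyLimit G groupC) :
    IsOneParameterLimit G groupC := by
  obtain ⟨R, rfl | rfl | rfl | rfl | rfl⟩ := h.exists_conj
  · exact limit_conj_C_C R
  · exact (limit_conj_C_F R⁻¹).of_conj
  · exact (limit_conj_C_N1 R⁻¹).of_conj
  · exact (limit_conj_C_N2 R⁻¹).of_conj
  · exact (limit_conj_C_N3 R⁻¹).of_conj

/-! ### Coordinates on the model groups -/

/-- `H` has a continuous injective homomorphism to the plane. -/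
def HasCoordinates (H : Subgroup SL3) : Prop :=
  ∃ κ : SL3 → ℝ × ℝ, (∀ g ∈ H, ∀ h ∈ H, κ (g * h) = κ g + κ h) ∧
    ContinuousOn κ (H : Set SL3) ∧ Set.InjOn κ (H : Set SL3)

theorem continuous_entry (i j : Fin 3) : Continuous fun g : SL3 => (g : M3) i j :=
  continuous_coe_SL3.matrix_elem i j

theorem SL3_ext {g h : SL3} (H : (g : M3) = (h : M3)) : g = h := Subtype.ext H

theorem hasCoordinates_C : HasCoordinates groupC := by
  refine ⟨fun g => (Real.log ((g : M3) 0 0), Real.log ((g : M3) 1 1)), ?_, ?_, ?_⟩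
  · rintro g ⟨a, b, ha, hb, hg⟩ h ⟨c, d, hc, hd, hh⟩
    have hm : ((g * h : SL3) : M3) = (g : M3) * (h : M3) := rfl
    rw [hg, hh] at hm
    beta_reduce
    rw [hm, hg, hh]
    simp [Matrix.mul_apply, Fin.sum_univ_three, Real.log_mul, ha.ne', hb.ne', hc.ne', hd.ne']
  · refine ContinuousOn.prodMk ?_ ?_
    · refine ContinuousOn.log (continuous_entry 0 0).continuousOn ?_
      rintro g ⟨a, b, ha, hb, hg⟩
      simp [hg, ha.ne']
    · refine ContinuousOn.log (continuous_entry 1 1).continuousOn ?_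
      rintro g ⟨a, b, ha, hb, hg⟩
      simp [hg, hb.ne']
  · rintro g ⟨a, b, ha, hb, hg⟩ h ⟨c, d, hc, hd, hh⟩ e
    simp [hg, hh] at e
    have e1 := Real.log_injOn_pos ha hc e.1
    have e2 := Real.log_injOn_pos hb hd e.2
    exact SL3_ext (by rw [hg, hh, e1, e2])

theorem hasCoordinates_F : HasCoordinates groupF := by
  refine ⟨fun g => (Real.log ((g : M3) 0 0), (g : M3) 0 1 / (g : M3) 0 0), ?_, ?_, ?_⟩
  · rintro g ⟨a, b, ha, hg⟩ h ⟨c, d, hc, hh⟩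
    have hm : ((g * h : SL3) : M3) = (g : M3) * (h : M3) := rfl
    rw [hg, hh] at hm
    beta_reduce
    rw [hm, hg, hh]
    have := ha.ne'
    have := hc.ne'
    simp [Matrix.mul_apply, Fin.sum_univ_three, Real.log_mul, ha.ne', hc.ne']
    field_simp
    ring
  · refine ContinuousOn.prodMk ?_ ?_
    · refine ContinuousOn.log (continuous_entry 0 0).continuousOn ?_
      rintro g ⟨a, b, ha, hg⟩
      simp [hg, ha.ne']
    · refine ContinuousOn.div (continuous_entry 0 1).continuousOn
        (continuous_entry 0 0).continuousOn ?_
      rintro g ⟨a, b, ha, hg⟩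
      simp [hg, ha.ne']
  · rintro g ⟨a, b, ha, hg⟩ h ⟨c, d, hc, hh⟩ e
    simp [hg, hh] at e
    have e1 := Real.log_injOn_pos ha hc e.1
    subst e1
    have e2 := e.2
    rw [div_left_inj' ha.ne'] at e2
    exact SL3_ext (by rw [hg, hh, e2])

theorem hasCoordinates_N1 : HasCoordinates groupN1 := by
  -- These are the entries of the matrix logarithm; the correction -s²/2 makes the second coordinate
  -- additive.
  refine ⟨fun g => ((g : M3) 0 1, (g : M3) 0 2 - (g : M3) 0 1 ^ 2 / 2), ?_, ?_, ?_⟩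
  · rintro g ⟨a, b, hg⟩ h ⟨c, d, hh⟩
    have hm : ((g * h : SL3) : M3) = (g : M3) * (h : M3) := rfl
    rw [hg, hh] at hm
    beta_reduce
    rw [hm, hg, hh]
    simp [Matrix.mul_apply, Fin.sum_univ_three]
    constructor <;> ring
  · have h1 := continuous_entry 0 1
    have h2 := continuous_entry 0 2
    fun_prop
  · rintro g ⟨a, b, hg⟩ h ⟨c, d, hh⟩ e
    simp [hg, hh] at e
    obtain ⟨e1, e2⟩ := e
    subst e1
    have e2 : b = d := by linarith
    exact SL3_ext (by rw [hg, hh, e2])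

theorem hasCoordinates_N2 : HasCoordinates groupN2 := by
  refine ⟨fun g => ((g : M3) 0 1, (g : M3) 0 2), ?_, ?_, ?_⟩
  · rintro g ⟨a, b, hg⟩ h ⟨c, d, hh⟩
    have hm : ((g * h : SL3) : M3) = (g : M3) * (h : M3) := rfl
    rw [hg, hh] at hm
    beta_reduce
    rw [hm, hg, hh]
    simp [Matrix.mul_apply, Fin.sum_univ_three]
    constructor <;> ring
  · have h1 := continuous_entry 0 1
    have h2 := continuous_entry 0 2
    fun_prop
  · rintro g ⟨a, b, hg⟩ h ⟨c, d, hh⟩ e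
    simp [hg, hh] at e
    exact SL3_ext (by rw [hg, hh, e.1, e.2])

theorem hasCoordinates_N3 : HasCoordinates groupN3 := by
  refine ⟨fun g => ((g : M3) 0 2, (g : M3) 1 2), ?_, ?_, ?_⟩
  · rintro g ⟨a, b, hg⟩ h ⟨c, d, hh⟩
    have hm : ((g * h : SL3) : M3) = (g : M3) * (h : M3) := rfl
    rw [hg, hh] at hm
    beta_reduce
    rw [hm, hg, hh]
    simp [Matrix.mul_apply, Fin.sum_univ_three]
    constructor <;> ring
  · have h1 := continuous_entry 0 2
    have h2 := continuous_entry 1 2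
    fun_prop
  · rintro g ⟨a, b, hg⟩ h ⟨c, d, hh⟩ e
    simp [hg, hh] at e
    exact SL3_ext (by rw [hg, hh, e.1, e.2])

/-- A plane inside a group with coordinates is the whole group. -/
theorem HasCoordinates.eq_of_le {L : Subgroup SL3} (hL : HasCoordinates L)
    {φ : Multiplicative (ℝ × ℝ) →* SL3} (hφ : Continuous φ) (hinj : Function.Injective φ)
    (hle : φ.range ≤ L) : φ.range = L := by
  obtain ⟨κ, hmul, hcont, hκ⟩ := hL
  have hmem : ∀ v, φ v ∈ L := fun v => hle ⟨v, rfl⟩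
  -- In coordinates the plane becomes a continuous additive, hence linear, injection of ℝ² into
  -- itself, which is onto.
  let F : ℝ × ℝ →+ ℝ × ℝ := AddMonoidHom.mk' (fun v => κ (φ (Multiplicative.ofAdd v))) fun v w => by
    rw [ofAdd_add, map_mul, hmul _ (hmem _) _ (hmem _)]
  have hF : Continuous F := by
    have : Continuous fun v => κ (φ v) := hcont.comp_continuous hφ hmem
    exact this.comp continuous_ofAdd
  have hFinj : Function.Injective (F.toRealLinearMap hF) := fun v w h =>
    Multiplicative.ofAdd.injective (hinj (hκ (hmem _) (hmem _) h))
  have hsurj : Function.Surjective (F.toRealLinearMap hF) :=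
    (LinearMap.injective_iff_surjective (f := (F.toRealLinearMap hF).toLinearMap)).1 hFinj
  refine le_antisymm hle fun g hg => ?_
  obtain ⟨v, hv⟩ := hsurj (κ g)
  exact ⟨Multiplicative.ofAdd v, hκ (hmem _) hg hv⟩

/-! ### No complex characters -/

/-- A continuous one-parameter group in the unit circle is not injective. -/
theorem exists_ne_zero_of_circle {ψ : ℝ → ℂ} (hc : Continuous ψ) (h0 : ψ 0 = 1)
    (hadd : ∀ s t, ψ (s + t) = ψ s * ψ t) (hn : ∀ t, ‖ψ t‖ = 1) : ∃ t, t ≠ 0 ∧ ψ t = 1 := by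
  by_contra hcon
  push Not at hcon
  have hre : Continuous fun t => (ψ t).re := Complex.continuous_re.comp hc
  have hsq : ∀ t, (ψ t).re ^ 2 + (ψ t).im ^ 2 = 1 := by
    intro t
    have := Complex.sq_norm (ψ t)
    rw [hn, Complex.normSq_apply] at this
    linarith
  -- A zero real part means ψ t = ± i, and then ψ (4t) = 1.
  have hne : ∀ t, (ψ t).re ≠ 0 := by
    intro t ht
    have ht0 : t ≠ 0 := by
      rintro rfl
      rw [h0] at ht
      simp at ht
    have h2 : ψ (t + t) = -1 := by
      rw [hadd]
      have := hsq t
      rw [ht] at this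
      apply Complex.ext
      · simp [ht]; nlinarith
      · simp [ht]
    have h4 : ψ (t + t + (t + t)) = 1 := by rw [hadd, h2]; norm_num
    refine hcon _ ?_ h4
    intro h
    exact ht0 (by linarith)
  have hpos : ∀ t, 0 < (ψ t).re := by
    intro t
    by_contra ht
    push Not at ht
    have h1 : (0 : ℝ) ≤ (ψ 0).re := by rw [h0]; simp
    obtain ⟨s, hs⟩ := mem_range_of_exists_le_of_exists_ge hre ⟨t, ht⟩ ⟨0, h1⟩
    exact hne s hs
  -- With positive real part, the defect 1 - Re ψ at least doubles whenever t does, although it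
  -- stays below one.
  have hdouble : ∀ t, 2 * (1 - (ψ t).re) ≤ 1 - (ψ (t + t)).re := by
    intro t
    have h1 : (ψ (t + t)).re = 2 * (ψ t).re ^ 2 - 1 := by
      rw [hadd, Complex.mul_re]
      linarith [hsq t]
    have h2 : (ψ t).re ≤ 1 := by nlinarith [hsq t, sq_nonneg (ψ t).im]
    rw [h1]
    nlinarith [hpos t]
  have hpow : ∀ n : ℕ, 2 ^ n * (1 - (ψ 1).re) ≤ 1 - (ψ (2 ^ n)).re := by
    intro n
    induction n with
    | zero => simp
    | succ n ih =>
      have h1 := hdouble (2 ^ n)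
      rw [← two_mul, ← pow_succ'] at h1
      have h2 : (2 : ℝ) ^ (n + 1) = 2 * 2 ^ n := pow_succ' 2 n
      calc 2 ^ (n + 1) * (1 - (ψ 1).re) = 2 * (2 ^ n * (1 - (ψ 1).re)) := by rw [h2]; ring
        _ ≤ 2 * (1 - (ψ (2 ^ n)).re) := by linarith
        _ ≤ _ := h1
  have hδ : 0 < 1 - (ψ 1).re := by
    have h2 : (ψ 1).re ≤ 1 := by nlinarith [hsq 1, sq_nonneg (ψ 1).im]
    rcases lt_or_eq_of_le h2 with h | h
    · linarith
    · exfalso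
      refine hcon 1 one_ne_zero (Complex.ext (by simpa using h) ?_)
      have := hsq 1
      rw [h] at this
      simp
      nlinarith
  obtain ⟨n, hn⟩ := pow_unbounded_of_one_lt (1 / (1 - (ψ 1).re)) one_lt_two
  rw [div_lt_iff₀ hδ] at hn
  linarith [hpow n, hpos (2 ^ n)]

/-- A continuous character of the plane with values in `ℂ` is not injective. -/
theorem exists_ne_zero_of_character {χ : ℝ × ℝ → ℂ} (hc : Continuous χ) (h0 : χ 0 = 1)
    (hadd : ∀ v w, χ (v + w) = χ v * χ w) : ∃ v, v ≠ 0 ∧ χ v = 1 := by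
  have hne : ∀ v, χ v ≠ 0 := by
    intro v hv
    have := hadd v (-v)
    rw [add_neg_cancel, h0, hv, zero_mul] at this
    exact one_ne_zero this
  let F : ℝ × ℝ →+ ℝ := AddMonoidHom.mk' (fun v => Real.log ‖χ v‖) fun v w => by
    rw [hadd, norm_mul, Real.log_mul (norm_ne_zero_iff.2 (hne v)) (norm_ne_zero_iff.2 (hne w))]
  have hF : Continuous F := Continuous.log hc.norm fun v => norm_ne_zero_iff.2 (hne v)
  -- The functional log |χ| on the plane vanishes on a line, along which χ takes values in the unit
  -- circle.
  have hker : ¬Function.Injective (F.toRealLinearMap hF) := by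
    intro h
    have := LinearMap.finrank_le_finrank_of_injective
      (f := (F.toRealLinearMap hF).toLinearMap) h
    simp at this
  rw [injective_iff_map_eq_zero] at hker
  push Not at hker
  obtain ⟨v, hv, hv0⟩ := hker
  obtain ⟨t, ht, ht'⟩ := exists_ne_zero_of_circle (ψ := fun t => χ (t • v))
    (by fun_prop) (by simpa using h0) (fun s t => by rw [add_smul, hadd]) (fun t => by
      have h1 : Real.log ‖χ (t • v)‖ = 0 := by
        change F.toRealLinearMap hF (t • v) = 0
        rw [map_smul, hv, smul_zero]
      have hp : 0 < ‖χ (t • v)‖ := norm_pos_iff.2 (hne _)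
      rcases Real.log_eq_zero.1 h1 with h | h | h <;> linarith)
  exact ⟨t • v, smul_ne_zero ht hv0, ht'⟩

/-! ### Planes consist of matrices with real eigenvalues -/

open scoped Matrix

/-- Matrices commuting with one that has distinct eigenvalues are diagonal in its eigenbasis. -/
theorem exists_diagonal_of_commute {K : Type*} [Field K] {M X T : Matrix (Fin 3) (Fin 3) K}
    {l : Fin 3 → K} (hl : Function.Injective l) (hT : IsUnit T) (hM : M * T = T * Matrix.diagonal l)
    (hX : M * X = X * M) : ∃ d : Fin 3 → K, X * T = T * Matrix.diagonal d := by
  have hu : IsUnit T.det := (Matrix.isUnit_iff_isUnit_det _).1 hT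
  set N := T⁻¹ * X * T with hN
  have hXT : X * T = T * N := by rw [hN, mul_assoc, Matrix.mul_nonsing_inv_cancel_left _ _ hu]
  have hc : Matrix.diagonal l * N = N * Matrix.diagonal l := by
    have h1 : T * (Matrix.diagonal l * N) = T * (N * Matrix.diagonal l) := by
      rw [← mul_assoc, ← hM, mul_assoc, ← hXT, ← mul_assoc, hX, mul_assoc, hM, ← mul_assoc, hXT,
        mul_assoc]
    have h2 := congrArg (T⁻¹ * ·) h1
    simpa only [Matrix.nonsing_inv_mul_cancel_left _ _ hu] using h2
  refine ⟨fun i => N i i, ?_⟩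
  rw [hXT]
  congr 1
  ext i j
  by_cases hij : i = j
  · subst hij; simp
  · rw [Matrix.diagonal_apply_ne _ hij]
    have h1 := congrFun (congrFun hc i) j
    rw [Matrix.diagonal_mul, Matrix.mul_diagonal] at h1
    have h2 : (l i - l j) * N i j = 0 := by linear_combination h1
    exact (mul_eq_zero.1 h2).resolve_left (sub_ne_zero.2 fun h => hij (hl h))

theorem mulVec_eq_smul_of_mul_eq {K : Type*} [Field K] {X T : Matrix (Fin 3) (Fin 3) K}
    {d : Fin 3 → K} (h : X * T = T * Matrix.diagonal d) (j : Fin 3) :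
    X *ᵥ (fun i => T i j) = d j • fun i => T i j := by
  ext i
  have := congrFun (congrFun h i) j
  rw [Matrix.mul_diagonal, Matrix.mul_apply] at this
  simp only [Matrix.mulVec, dotProduct, Pi.smul_apply, smul_eq_mul]
  rw [this, mul_comm]

theorem mulVec_conj (X : M3) (v : Fin 3 → ℂ) :
    (X.map Complex.ofReal) *ᵥ (fun i => (starRingEnd ℂ) (v i)) =
      fun i => (starRingEnd ℂ) (((X.map Complex.ofReal) *ᵥ v) i) := by
  ext i
  simp [Matrix.mulVec, dotProduct, map_sum]

theorem det_map_ofReal_sub (X : M3) (l : ℂ) : (X.map Complex.ofReal - l • 1).det =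
    -(l ^ 3 - X.trace * l ^ 2 + X.adjugate.trace * l - X.det) := by
  rw [Matrix.adjugate_fin_three, Matrix.det_fin_three, Matrix.det_fin_three]
  simp [Matrix.trace, Fin.sum_univ_three]
  ring

theorem map_ofReal_mul (X Y : M3) :
    (X * Y).map Complex.ofReal = X.map Complex.ofReal * Y.map Complex.ofReal :=
  Matrix.map_mul (f := Complex.ofRealHom)

/-- The matrices commuting with one that has a non-real eigenvalue are governed by a complex
character. -/
theorem exists_eigencharacter {X : M3} {a u v : ℝ} (hv : v ≠ 0) (h1 : X.trace = a + 2 * u)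
    (h2 : X.adjugate.trace = 2 * a * u + (u ^ 2 + v ^ 2)) (h3 : X.det = a * (u ^ 2 + v ^ 2)) :
    ∃ z : Fin 3 → ℂ, z ≠ 0 ∧ (∀ Y : M3, X * Y = Y * X →
      ∃ c : ℂ, (Y.map Complex.ofReal) *ᵥ z = c • z) ∧
      ∀ g : SL3, X * (g : M3) = (g : M3) * X →
        ((g : M3).map Complex.ofReal) *ᵥ z = z → g = 1 := by
  set M := X.map Complex.ofReal with hM
  have hroot : ∀ l : ℂ, (M - l • 1).det = -((l - a) * ((l - u) ^ 2 + v ^ 2)) := by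
    intro l
    rw [hM, det_map_ofReal_sub, h1, h2, h3]
    push_cast
    ring
  obtain ⟨z, hz, hz'⟩ := exists_eigenvector (M := M) (a := u + v * Complex.I) (by
    rw [hroot]; ring_nf; simp)
  obtain ⟨w, hw, hw'⟩ := exists_eigenvector (M := M) (a := (a : ℂ)) (by
    rw [hroot]; ring)
  let zc : Fin 3 → ℂ := fun i => (starRingEnd ℂ) (z i)
  have hzc : zc ≠ 0 := by
    intro h
    refine hz (funext fun i => ?_)
    have := congrFun h i
    simpa [zc] using this
  let l : Fin 3 → ℂ := ![u + v * Complex.I, u - v * Complex.I, a]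
  let e : Fin 3 → Fin 3 → ℂ := ![z, zc, w]
  have hl : Function.Injective l := by
    have d1 : (u + v * Complex.I : ℂ) ≠ u - v * Complex.I := by
      intro h
      have := congrArg Complex.im h
      simp at this
      exact hv (by linarith)
    have d2 : (u + v * Complex.I : ℂ) ≠ a := by
      intro h
      have := congrArg Complex.im h
      simp at this
      exact hv this
    have d3 : (u - v * Complex.I : ℂ) ≠ a := by
      intro h
      have := congrArg Complex.im h
      simp at this
      exact hv this
    intro i j hij
    fin_cases i <;> fin_cases j <;>
      first
        | rfl
        | exact absurd hij d1
        | exact absurd hij d1.symm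
        | exact absurd hij d2
        | exact absurd hij d2.symm
        | exact absurd hij d3
        | exact absurd hij d3.symm
  have he0 : ∀ i, e i ≠ 0 := by
    intro i
    fin_cases i
    exacts [hz, hzc, hw]
  have he : ∀ i, M *ᵥ e i = l i • e i := by
    intro i
    fin_cases i
    · exact hz'
    · change M *ᵥ zc = (u - v * Complex.I : ℂ) • zc
      rw [hM, mulVec_conj, ← hM, hz']
      ext i
      simp [zc, sub_eq_add_neg]
    · exact hw'
  have hT := isUnit_of_eigenvectors hl he0 he
  have hMT := mul_of_eigenvectors he
  set T := Matrix.of fun i j => e j i with hTdef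
  have hdiag : ∀ Y : M3, X * Y = Y * X →
      ∃ d : Fin 3 → ℂ, Y.map Complex.ofReal * T = T * Matrix.diagonal d := fun Y hY =>
    exists_diagonal_of_commute hl hT hMT (by rw [hM, ← map_ofReal_mul, hY, map_ofReal_mul])
  refine ⟨z, hz, fun Y hY => ?_, fun g hg hgz => ?_⟩
  · obtain ⟨d, hd⟩ := hdiag Y hY
    exact ⟨d 0, mulVec_eq_smul_of_mul_eq hd 0⟩
  · obtain ⟨d, hd⟩ := hdiag g hg
    have one_of : ∀ {x : Fin 3 → ℂ} {c : ℂ}, x ≠ 0 → x = c • x → c = 1 := by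
      intro x c hx h
      have : (c - 1) • x = 0 := by rw [sub_smul, one_smul, ← h, sub_self]
      exact sub_eq_zero.1 ((smul_eq_zero.1 this).resolve_right hx)
    have hd0 : d 0 = 1 := one_of hz (by
      have := mulVec_eq_smul_of_mul_eq hd 0
      exact hgz.symm.trans this)
    have hd1 : d 1 = 1 := one_of hzc (by
      have h := mulVec_eq_smul_of_mul_eq hd 1
      change (g : M3).map Complex.ofReal *ᵥ zc = d 1 • zc at h
      rw [mulVec_conj, hgz] at h
      exact h)
    have hdet : T.det ≠ 0 := ((Matrix.isUnit_iff_isUnit_det _).1 hT).ne_zero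
    have hgd : ((g : M3).map Complex.ofReal).det = 1 := by
      have : ((g : M3).map Complex.ofReal).det = ((g : M3).det : ℂ) :=
        (RingHom.map_det Complex.ofRealHom (g : M3)).symm
      rw [this, Matrix.SpecialLinearGroup.det_coe, Complex.ofReal_one]
    -- Complex conjugation has given the second eigenvalue; determinant one now gives the third.
    have hd2 : d 2 = 1 := by
      have h := congrArg Matrix.det hd
      rw [Matrix.det_mul, Matrix.det_mul, hgd, Matrix.det_diagonal, Fin.prod_univ_three, hd0, hd1,
        one_mul, one_mul, one_mul] at h
      exact (mul_left_cancel₀ hdet ((mul_one _).trans h)).symm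
    have hd' : Matrix.diagonal d = 1 := by
      rw [← Matrix.diagonal_one]
      congr 1
      ext i
      fin_cases i
      exacts [hd0, hd1, hd2]
    rw [hd', mul_one] at hd
    have hg1 : (g : M3).map Complex.ofReal = 1 := hT.mul_right_cancel (by rw [hd, one_mul])
    refine SL3_ext ?_
    ext i j
    have := congrFun (congrFun hg1 i) j
    rw [Matrix.map_apply, Matrix.one_apply] at this
    rw [Matrix.SpecialLinearGroup.coe_one, Matrix.one_apply]
    split_ifs at this ⊢
    · exact_mod_cast this
    · exact_mod_cast this

/-- A non-real eigenvalue of one element gives a complex eigenline common to the whole plane, hence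
a continuous character. Its kernel is nontrivial, but an element acting trivially on that line is
the identity, contrary to injectivity. -/
theorem realSplit_of_plane {φ : Multiplicative (ℝ × ℝ) →* SL3} (hφ : Continuous φ)
    (hinj : Function.Injective φ) (x : Multiplicative (ℝ × ℝ)) : RealSplit (φ x : M3) := by
  rcases realSplit_or_complex (φ x : M3) with h | ⟨a, u, v, hv, h1, h2, h3⟩
  · exact h
  exfalso
  obtain ⟨z, hz, hex, huniq⟩ := exists_eigencharacter hv h1 h2 h3
  obtain ⟨k, hk⟩ := Function.ne_iff.1 hz
  have hcomm : ∀ y, (φ x : M3) * (φ y : M3) = (φ y : M3) * (φ x : M3) := fun y => by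
    rw [← Matrix.SpecialLinearGroup.coe_mul, ← Matrix.SpecialLinearGroup.coe_mul, ← map_mul,
      ← map_mul, mul_comm]
  let χ : ℝ × ℝ → ℂ := fun y =>
    (((φ (Multiplicative.ofAdd y) : M3).map Complex.ofReal) *ᵥ z) k / z k
  have hχ : ∀ y, ((φ (Multiplicative.ofAdd y) : M3).map Complex.ofReal) *ᵥ z = χ y • z := by
    intro y
    obtain ⟨c, hc⟩ := hex _ (hcomm (Multiplicative.ofAdd y))
    have : χ y = c := by
      simp only [χ, hc, Pi.smul_apply, smul_eq_mul]
      exact mul_div_cancel_right₀ c hk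
    rw [this, hc]
  have hcont : Continuous χ := by
    refine Continuous.div_const ?_ _
    have h : Continuous fun y : ℝ × ℝ => ((φ (Multiplicative.ofAdd y) : M3).map Complex.ofReal) :=
      (continuous_coe_SL3.comp (hφ.comp continuous_ofAdd)).matrix_map Complex.continuous_ofReal
    exact (continuous_apply k).comp (h.matrix_mulVec continuous_const)
  obtain ⟨y, hy, hy'⟩ := exists_ne_zero_of_character hcont (by
      have h0 : ((φ (Multiplicative.ofAdd 0) : SL3) : M3) = 1 := by rw [ofAdd_zero, map_one]; rfl
      simp only [χ]
      rw [h0, Matrix.map_one _ Complex.ofReal_zero Complex.ofReal_one, Matrix.one_mulVec]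
      exact div_self hk) (by
      intro y w
      have h0 : ((φ (Multiplicative.ofAdd (y + w)) : SL3) : M3) =
          (φ (Multiplicative.ofAdd y) : M3) * (φ (Multiplicative.ofAdd w) : M3) := by
        rw [ofAdd_add, map_mul, Matrix.SpecialLinearGroup.coe_mul]
      have h1 : χ (y + w) • z = (χ y * χ w) • z := by
        rw [← hχ, h0, map_ofReal_mul, ← Matrix.mulVec_mulVec, hχ, Matrix.mulVec_smul, hχ, smul_smul,
          mul_comm]
      exact smul_left_injective ℂ hz h1)
  have := hχ y
  rw [hy', one_smul] at this
  have h1 := huniq _ (hcomm _) this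
  rw [← map_one φ] at h1
  exact hy (Multiplicative.ofAdd.injective (hinj h1))

/-! ### Planes are conjugate to model groups -/

/-- Halving in ℝ² gives each element a square root in the plane, so its eigenvalues are squares of
nonzero reals. -/
theorem trace_pos_of_plane {φ : Multiplicative (ℝ × ℝ) →* SL3} (hφ : Continuous φ)
    (hinj : Function.Injective φ) (x : Multiplicative (ℝ × ℝ)) :
    0 < (φ x : M3).trace ∧ 0 < (φ x : M3).adjugate.trace := by
  set y : Multiplicative (ℝ × ℝ) :=
    Multiplicative.ofAdd ((1 / 2 : ℝ) • Multiplicative.toAdd x) with hy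
  have hxy : x = y * y := by
    rw [hy, ← ofAdd_add, ← add_smul]
    norm_num
  set K : M3 := (φ y : M3) with hK
  have hsq : (φ x : M3) = K * K := by rw [hxy, map_mul, Matrix.SpecialLinearGroup.coe_mul]
  obtain ⟨a, b, c, h1, h2, h3⟩ := realSplit_of_plane hφ hinj y
  rw [← hK] at h1 h2 h3
  have hd : a * b * c = 1 := by rw [← h3, hK, Matrix.SpecialLinearGroup.det_coe]
  have ha : a ≠ 0 := by rintro rfl; simp at hd
  have hb : b ≠ 0 := by rintro rfl; simp at hd
  have e1 : (K * K).trace = a ^ 2 + b ^ 2 + c ^ 2 := by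
    have := trace_adjugate_eq K
    rw [h1, h2] at this
    linarith
  have e2 : (K * K).adjugate.trace = (a * b) ^ 2 + (b * c) ^ 2 + (c * a) ^ 2 := by
    have h : (K * K).adjugate.trace = K.adjugate.trace ^ 2 - 2 * K.det * K.trace := by
      rw [Matrix.adjugate_fin_three, Matrix.adjugate_fin_three, Matrix.det_fin_three]
      simp [Matrix.trace, Fin.sum_univ_three, Matrix.mul_apply]
      ring
    rw [h, h1, h2, h3]
    ring
  rw [hsq, e1, e2]
  constructor <;> positivity

theorem eq_conjSubgroup_of_plane {φ : Multiplicative (ℝ × ℝ) →* SL3} (hφ : Continuous φ)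
    (hinj : Function.Injective φ) {L : Subgroup SL3} {A : Submodule ℝ M3} (hL : IsSplitPair L A)
    (hco : HasCoordinates L) {R : SL3} (h : ∀ x, conjMat R (φ x) ∈ A) :
    φ.range = conjSubgroup R⁻¹ L := by
  let ψ : Multiplicative (ℝ × ℝ) →* SL3 := (MulAut.conj R).toMonoidHom.comp φ
  have hψ : Continuous ψ := by
    change Continuous fun x => R * φ x * R⁻¹
    fun_prop
  have hcoe : ∀ x, (ψ x : M3) = conjMat R (φ x) := fun x => coe_conj R (φ x)
  have hle : ψ.range ≤ L := by
    rintro _ ⟨x, rfl⟩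
    rw [hL.mem_iff, hcoe, trace_conjMat, trace_adjugate_conjMat]
    exact ⟨h x, trace_pos_of_plane hφ hinj x⟩
  have heq := hco.eq_of_le hψ ((MulAut.conj R).injective.comp hinj) hle
  rw [← heq]
  have : ψ.range = conjSubgroup R φ.range := MonoidHom.range_comp _ _
  rw [this, ← conjSubgroup_mul, inv_mul_cancel, conjSubgroup_one]

/-- Every plane in `SL₃(ℝ)` is conjugate to an element of `𝒬`. -/
theorem IsIsomorphicToPlane.exists_conj {H : Subgroup SL3} (h : IsIsomorphicToPlane H) :
    ∃ G ∈ groupsQ, IsConjugateTo H G := by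
  obtain ⟨φ, hφ, hinj, rfl⟩ := h
  have hcs : CommSplit (Set.range fun x => (φ x : M3)) := by
    refine ⟨?_, ?_⟩
    · rintro _ ⟨x, rfl⟩ _ ⟨y, rfl⟩
      simp only
      rw [← Matrix.SpecialLinearGroup.coe_mul, ← Matrix.SpecialLinearGroup.coe_mul, ← map_mul,
        ← map_mul, mul_comm]
    · rintro _ ⟨x, rfl⟩
      exact realSplit_of_plane hφ hinj x
  obtain ⟨R, h⟩ := hcs.fitsModel
  simp only [Set.forall_mem_range] at h
  rcases h with h | h | h | h | h
  · exact ⟨groupC, by simp [groupsQ], R⁻¹,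
      eq_conjSubgroup_of_plane hφ hinj isSplitPair_C hasCoordinates_C h⟩
  · exact ⟨groupF, by simp [groupsQ], R⁻¹,
      eq_conjSubgroup_of_plane hφ hinj isSplitPair_F hasCoordinates_F h⟩
  · exact ⟨groupN1, by simp [groupsQ], R⁻¹,
      eq_conjSubgroup_of_plane hφ hinj isSplitPair_N1 hasCoordinates_N1 h⟩
  · exact ⟨groupN2, by simp [groupsQ], R⁻¹,
      eq_conjSubgroup_of_plane hφ hinj isSplitPair_N2 hasCoordinates_N2 h⟩
  · exact ⟨groupN3, by simp [groupsQ], R⁻¹,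
      eq_conjSubgroup_of_plane hφ hinj isSplitPair_N3 hasCoordinates_N3 h⟩

/-! ### Obstructions to being a conjugacy limit -/

/-- Closed conditions on pairs which hold in all conjugates of `H` hold in its conjugacy limits. -/
theorem IsConjugacyLimit.mem_of_isClosed {L H : Subgroup SL3} (h : IsConjugacyLimit L H)
    {E : Set (M3 × M3)} (hE : IsClosed E)
    (hH : ∀ P : SL3, ∀ g ∈ H, ∀ k ∈ H, (conjMat P g, conjMat P k) ∈ E) {g k : SL3} (hg : g ∈ L)
    (hk : k ∈ L) : ((g : M3), (k : M3)) ∈ E := by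
  obtain ⟨P, hP⟩ := h
  obtain ⟨a, ha, ha'⟩ := hP.1 g hg
  obtain ⟨b, hb, hb'⟩ := hP.1 k hk
  refine hE.mem_of_tendsto ((tendsto_SL3_iff.1 ha').prodMk_nhds (tendsto_SL3_iff.1 hb'))
    (Eventually.of_forall fun n => ?_)
  have key := hH (P n) _ (mem_conjSubgroup.1 (ha n)) _ (mem_conjSubgroup.1 (hb n))
  simpa only [coe_inv_conj, conjMat_conjMat_inv] using key

theorem isConjugacyLimit_conj {H : Subgroup SL3} {A : Submodule ℝ M3} (h : IsSplitPair H A)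
    (Q : SL3) : IsConjugacyLimit (conjSubgroup Q H) H := by
  refine ⟨fun _ => Q, h.convergeTo (h.conj Q) ?_⟩
  rintro _ ⟨X, hX, rfl⟩
  exact ⟨fun _ => X, fun _ => hX, tendsto_const_nhds⟩

/-- All elements of `H` are unipotent. -/
def IsUnipotentGroup (H : Subgroup SL3) : Prop := ∀ g ∈ H, ((g : M3) - 1) ^ 3 = 0

/-- All elements of `H` have a multiple eigenvalue. -/
def HasZeroDiscr (H : Subgroup SL3) : Prop := ∀ g ∈ H, charDiscr (g : M3) = 0

/-- The nilpotent parts of elements of `H` have trivial products. -/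
def HasZeroProducts (H : Subgroup SL3) : Prop :=
  ∀ g ∈ H, ∀ k ∈ H, ((g : M3) - 1) * ((k : M3) - 1) = 0

theorem IsUnipotentGroup.of_limit {L H : Subgroup SL3} (hH : IsUnipotentGroup H)
    (h : IsConjugacyLimit L H) : IsUnipotentGroup L := by
  intro g hg
  refine h.mem_of_isClosed (E := {p | (p.1 - 1) ^ 3 = 0})
    (isClosed_eq (by fun_prop) continuous_const) (fun P g hg k hk => ?_) hg hg
  change (conjMat P g - 1) ^ 3 = 0
  rw [← map_one (conjMat P), ← map_sub, ← map_pow, hH g hg, map_zero]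

theorem charDiscr_conjMat (P : SL3) (X : M3) : charDiscr (conjMat P X) = charDiscr X := by
  rw [charDiscr, trace_conjMat, trace_adjugate_conjMat, det_conjMat, charDiscr]

theorem HasZeroDiscr.of_limit {L H : Subgroup SL3} (hH : HasZeroDiscr H)
    (h : IsConjugacyLimit L H) : HasZeroDiscr L := by
  intro g hg
  refine h.mem_of_isClosed (E := {p | charDiscr p.1 = 0})
    (isClosed_eq (continuous_charDiscr.comp continuous_fst) continuous_const)
    (fun P g hg k hk => ?_) hg hg
  exact (charDiscr_conjMat P g).trans (hH g hg)

theorem HasZeroProducts.of_limit {L H : Subgroup SL3} (hH : HasZeroProducts H)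
    (h : IsConjugacyLimit L H) : HasZeroProducts L := by
  intro g hg k hk
  refine h.mem_of_isClosed (E := {p | (p.1 - 1) * (p.2 - 1) = 0})
    (isClosed_eq (by fun_prop) continuous_const) (fun P g hg k hk => ?_) hg hk
  change (conjMat P g - 1) * (conjMat P k - 1) = 0
  rw [← map_one (conjMat P), ← map_sub, ← map_sub, ← map_mul, hH g hg k hk, map_zero]

theorem isUnipotentGroup_N1 : IsUnipotentGroup groupN1 := by
  rintro g ⟨s, t, hg⟩
  rw [hg]
  ext i j
  fin_cases i <;> fin_cases j <;>
    simp [pow_succ, Matrix.mul_apply, Fin.sum_univ_three, Matrix.sub_apply]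

theorem isUnipotentGroup_N2 : IsUnipotentGroup groupN2 := by
  rintro g ⟨s, t, hg⟩
  rw [hg]
  ext i j
  fin_cases i <;> fin_cases j <;>
    simp [pow_succ, Matrix.mul_apply, Fin.sum_univ_three, Matrix.sub_apply]

theorem isUnipotentGroup_N3 : IsUnipotentGroup groupN3 := by
  rintro g ⟨s, t, hg⟩
  rw [hg]
  ext i j
  fin_cases i <;> fin_cases j <;>
    simp [pow_succ, Matrix.mul_apply, Fin.sum_univ_three, Matrix.sub_apply]

theorem hasZeroDiscr_F : HasZeroDiscr groupF := by
  rintro g ⟨a, t, ha, hg⟩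
  rw [hg, charDiscr, trace_upper, trace_adjugate_upper, det_upper]
  ring

theorem hasZeroProducts_N2 : HasZeroProducts groupN2 := by
  rintro g ⟨s, t, hg⟩ k ⟨u, v, hk⟩
  rw [hg, hk]
  ext i j
  fin_cases i <;> fin_cases j <;>
    simp [Matrix.mul_apply, Fin.sum_univ_three, Matrix.sub_apply]

theorem hasZeroProducts_N3 : HasZeroProducts groupN3 := by
  rintro g ⟨s, t, hg⟩ k ⟨u, v, hk⟩
  rw [hg, hk]
  ext i j
  fin_cases i <;> fin_cases j <;>
    simp [Matrix.mul_apply, Fin.sum_univ_three, Matrix.sub_apply]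

theorem exists_mem_C : ∃ g ∈ groupC, (g : M3) = !![2, 0, 0; 0, 3, 0; 0, 0, 1 / (2 * 3)] :=
  ⟨⟨!![2, 0, 0; 0, 3, 0; 0, 0, 1 / (2 * 3)], by rw [det_upper]; norm_num⟩,
    ⟨2, 3, by norm_num, by norm_num, rfl⟩, rfl⟩

theorem exists_mem_F : ∃ g ∈ groupF, (g : M3) = !![2, 0, 0; 0, 2, 0; 0, 0, 1 / 2 ^ 2] :=
  ⟨⟨!![2, 0, 0; 0, 2, 0; 0, 0, 1 / 2 ^ 2], by rw [det_upper]; norm_num⟩,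
    ⟨2, 0, by norm_num, rfl⟩, rfl⟩

theorem exists_mem_N1 : ∃ g ∈ groupN1, (g : M3) = !![1, 1, 0; 0, 1, 1; 0, 0, 1] :=
  ⟨⟨!![1, 1, 0; 0, 1, 1; 0, 0, 1], by rw [det_upper]; norm_num⟩, ⟨1, 0, rfl⟩, rfl⟩

theorem exists_mem_N2 (s t : ℝ) : ∃ g ∈ groupN2, (g : M3) = !![1, s, t; 0, 1, 0; 0, 0, 1] :=
  ⟨⟨!![1, s, t; 0, 1, 0; 0, 0, 1], by rw [det_upper]; norm_num⟩, ⟨s, t, rfl⟩, rfl⟩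

theorem exists_mem_N3 (s t : ℝ) : ∃ g ∈ groupN3, (g : M3) = !![1, 0, t; 0, 1, s; 0, 0, 1] :=
  ⟨⟨!![1, 0, t; 0, 1, s; 0, 0, 1], by rw [det_upper]; norm_num⟩, ⟨s, t, rfl⟩, rfl⟩

theorem not_isUnipotentGroup_C : ¬IsUnipotentGroup groupC := by
  intro h
  obtain ⟨g, hg, e⟩ := exists_mem_C
  have := congrFun (congrFun (h g hg) 0) 0
  rw [e] at this
  simp [pow_succ, Matrix.mul_apply, Fin.sum_univ_three, Matrix.sub_apply] at this
  norm_num at this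

theorem not_isUnipotentGroup_F : ¬IsUnipotentGroup groupF := by
  intro h
  obtain ⟨g, hg, e⟩ := exists_mem_F
  have := congrFun (congrFun (h g hg) 0) 0
  rw [e] at this
  simp [pow_succ, Matrix.mul_apply, Fin.sum_univ_three, Matrix.sub_apply] at this
  norm_num at this

theorem not_hasZeroDiscr_C : ¬HasZeroDiscr groupC := by
  intro h
  obtain ⟨g, hg, e⟩ := exists_mem_C
  have := h g hg
  rw [e, charDiscr, trace_upper, trace_adjugate_upper, det_upper] at this
  norm_num at this

theorem not_hasZeroProducts_N1 : ¬HasZeroProducts groupN1 := by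
  intro h
  obtain ⟨g, hg, e⟩ := exists_mem_N1
  have := congrFun (congrFun (h g hg g hg) 0) 2
  rw [e] at this
  simp [Matrix.mul_apply, Fin.sum_univ_three, Matrix.sub_apply] at this

theorem conjMat_vecMulVec (P : SL3) (v w : Fin 3 → ℝ) : conjMat P (Matrix.vecMulVec v w) =
    Matrix.vecMulVec ((P : M3).mulVec v) (Matrix.vecMul w ((P⁻¹ : SL3) : M3)) := by
  rw [conjMat_apply, Matrix.mul_vecMulVec, Matrix.vecMulVec_mul]

theorem sub_one_mem_N2 {g : SL3} (hg : g ∈ groupN2) :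
    ∃ w, (g : M3) - 1 = Matrix.vecMulVec ![1, 0, 0] w := by
  obtain ⟨s, t, hg⟩ := hg
  refine ⟨![0, s, t], ?_⟩
  rw [hg]
  ext i j
  fin_cases i <;> fin_cases j <;> simp [Matrix.vecMulVec_apply, Matrix.sub_apply]

theorem sub_one_mem_N3 {g : SL3} (hg : g ∈ groupN3) :
    ∃ v, (g : M3) - 1 = Matrix.vecMulVec v ![0, 0, 1] := by
  obtain ⟨s, t, hg⟩ := hg
  refine ⟨![t, s, 0], ?_⟩
  rw [hg]
  ext i j
  fin_cases i <;> fin_cases j <;> simp [Matrix.vecMulVec_apply, Matrix.sub_apply]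

/-- In any conjugate of `N₂` the matrices g - 1 have rank at most one with columns on a common line.
The vanishing minor expressing this fails in `N₃`. -/
theorem not_limit_N3_N2 : ¬IsConjugacyLimit groupN3 groupN2 := by
  intro h
  obtain ⟨g, hg, eg⟩ := exists_mem_N3 0 1
  obtain ⟨k, hk, ek⟩ := exists_mem_N3 1 0
  have := h.mem_of_isClosed
    (E := {p | (p.1 - 1) 0 2 * (p.2 - 1) 1 2 = (p.1 - 1) 1 2 * (p.2 - 1) 0 2})
    (isClosed_eq (by fun_prop) (by fun_prop)) (fun P g hg k hk => by
      obtain ⟨w, hw⟩ := sub_one_mem_N2 hg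
      obtain ⟨x, hx⟩ := sub_one_mem_N2 hk
      change (conjMat P g - 1) 0 2 * (conjMat P k - 1) 1 2 =
        (conjMat P g - 1) 1 2 * (conjMat P k - 1) 0 2
      rw [← map_one (conjMat P), ← map_sub, ← map_sub, hw, hx, conjMat_vecMulVec,
        conjMat_vecMulVec]
      simp only [Matrix.vecMulVec_apply]
      ring) hg hk
  simp [eg, ek, Matrix.sub_apply] at this

/-- Dually, in conjugates of `N₃` the rows of all g - 1 lie on a common line. -/
theorem not_limit_N2_N3 : ¬IsConjugacyLimit groupN2 groupN3 := by
  intro h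
  obtain ⟨g, hg, eg⟩ := exists_mem_N2 1 0
  obtain ⟨k, hk, ek⟩ := exists_mem_N2 0 1
  have := h.mem_of_isClosed
    (E := {p | (p.1 - 1) 0 1 * (p.2 - 1) 0 2 = (p.1 - 1) 0 2 * (p.2 - 1) 0 1})
    (isClosed_eq (by fun_prop) (by fun_prop)) (fun P g hg k hk => by
      obtain ⟨w, hw⟩ := sub_one_mem_N3 hg
      obtain ⟨x, hx⟩ := sub_one_mem_N3 hk
      change (conjMat P g - 1) 0 1 * (conjMat P k - 1) 0 2 =
        (conjMat P g - 1) 0 2 * (conjMat P k - 1) 0 1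
      rw [← map_one (conjMat P), ← map_sub, ← map_sub, hw, hx, conjMat_vecMulVec,
        conjMat_vecMulVec]
      simp only [Matrix.vecMulVec_apply]
      ring) hg hk
  simp [eg, ek, Matrix.sub_apply] at this

theorem not_limit_C_F : ¬IsConjugacyLimit groupC groupF := fun h =>
  not_hasZeroDiscr_C (hasZeroDiscr_F.of_limit h)
theorem not_limit_C_N1 : ¬IsConjugacyLimit groupC groupN1 := fun h =>
  not_isUnipotentGroup_C (isUnipotentGroup_N1.of_limit h)
theorem not_limit_C_N2 : ¬IsConjugacyLimit groupC groupN2 := fun h =>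
  not_isUnipotentGroup_C (isUnipotentGroup_N2.of_limit h)
theorem not_limit_C_N3 : ¬IsConjugacyLimit groupC groupN3 := fun h =>
  not_isUnipotentGroup_C (isUnipotentGroup_N3.of_limit h)
theorem not_limit_F_N1 : ¬IsConjugacyLimit groupF groupN1 := fun h =>
  not_isUnipotentGroup_F (isUnipotentGroup_N1.of_limit h)
theorem not_limit_F_N2 : ¬IsConjugacyLimit groupF groupN2 := fun h =>
  not_isUnipotentGroup_F (isUnipotentGroup_N2.of_limit h)
theorem not_limit_F_N3 : ¬IsConjugacyLimit groupF groupN3 := fun h =>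
  not_isUnipotentGroup_F (isUnipotentGroup_N3.of_limit h)
theorem not_limit_N1_N2 : ¬IsConjugacyLimit groupN1 groupN2 := fun h =>
  not_hasZeroProducts_N1 (hasZeroProducts_N2.of_limit h)
theorem not_limit_N1_N3 : ¬IsConjugacyLimit groupN1 groupN3 := fun h =>
  not_hasZeroProducts_N1 (hasZeroProducts_N3.of_limit h)

theorem ne_of_not_limit {L H : Subgroup SL3} {A : Submodule ℝ M3} (hH : IsSplitPair H A)
    (h : ¬IsConjugacyLimit L H) : L ≠ H := by
  rintro rfl
  exact h (by simpa only [conjSubgroup_one] using isConjugacyLimit_conj hH 1)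

/-! ### Paths in the graph -/

/-- Elements of `𝒬` which are conjugacy limits of each other agree. -/
theorem eq_of_limit_of_limit {G₁ G₂ : Subgroup SL3} (h₁ : G₁ ∈ groupsQ) (h₂ : G₂ ∈ groupsQ)
    (h : IsConjugacyLimit G₁ G₂) (h' : IsConjugacyLimit G₂ G₁) : G₁ = G₂ := by
  rcases h₁ with rfl | rfl | rfl | rfl | rfl <;> rcases h₂ with rfl | rfl | rfl | rfl | rfl <;>
    first
      | rfl
      | exact absurd h not_limit_C_F
      | exact absurd h not_limit_C_N1
      | exact absurd h not_limit_C_N2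
      | exact absurd h not_limit_C_N3
      | exact absurd h not_limit_F_N1
      | exact absurd h not_limit_F_N2
      | exact absurd h not_limit_F_N3
      | exact absurd h not_limit_N1_N2
      | exact absurd h not_limit_N1_N3
      | exact absurd h not_limit_N2_N3
      | exact absurd h' not_limit_C_F
      | exact absurd h' not_limit_C_N1
      | exact absurd h' not_limit_C_N2
      | exact absurd h' not_limit_C_N3
      | exact absurd h' not_limit_F_N1
      | exact absurd h' not_limit_F_N2
      | exact absurd h' not_limit_F_N3
      | exact absurd h' not_limit_N1_N2
      | exact absurd h' not_limit_N1_N3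
      | exact absurd h' not_limit_N2_N3

theorem isSplitPair_of_mem {G : Subgroup SL3} (h : G ∈ groupsQ) :
    ∃ A : Submodule ℝ M3, IsSplitPair G A := by
  rcases h with rfl | rfl | rfl | rfl | rfl
  exacts [⟨_, isSplitPair_C⟩, ⟨_, isSplitPair_F⟩, ⟨_, isSplitPair_N1⟩, ⟨_, isSplitPair_N2⟩,
    ⟨_, isSplitPair_N3⟩]

/-- Groups with a common conjugate are limits of one another, through constant sequences. Uniqueness
in the classification therefore follows from the obstructions. -/
theorem IsConjugateTo.isConjugacyLimit {H G₁ G₂ : Subgroup SL3} (hG : G₂ ∈ groupsQ)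
    (h₁ : IsConjugateTo H G₁) (h₂ : IsConjugateTo H G₂) : IsConjugacyLimit G₁ G₂ := by
  obtain ⟨A, hA⟩ := isSplitPair_of_mem hG
  obtain ⟨P, rfl⟩ := h₁
  obtain ⟨Q, hQ⟩ := h₂
  have : G₁ = conjSubgroup (P⁻¹ * Q) G₂ := by
    rw [conjSubgroup_mul, ← hQ, ← conjSubgroup_mul, inv_mul_cancel, conjSubgroup_one]
  rw [this]
  exact isConjugacyLimit_conj hA _

theorem HasDirectedPath.cases {G₁ G₂ : groupsQ} (h : HasDirectedPath G₁ G₂) :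
    (G₁.1 = groupC ∧ (G₂.1 = groupF ∨ G₂.1 = groupN1 ∨ G₂.1 = groupN2 ∨ G₂.1 = groupN3)) ∨
    (G₁.1 = groupF ∧ (G₂.1 = groupN1 ∨ G₂.1 = groupN2 ∨ G₂.1 = groupN3)) ∨
    (G₁.1 = groupN1 ∧ (G₂.1 = groupN2 ∨ G₂.1 = groupN3)) := by
  -- The arrows are given by equations between subgroups, so appending an arrow to a path uses that
  -- the groups are distinct.
  have d1 := ne_of_not_limit isSplitPair_F not_limit_C_F
  have d2 := ne_of_not_limit isSplitPair_N1 not_limit_C_N1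
  have d3 := ne_of_not_limit isSplitPair_N2 not_limit_C_N2
  have d4 := ne_of_not_limit isSplitPair_N3 not_limit_C_N3
  have d5 := ne_of_not_limit isSplitPair_N1 not_limit_F_N1
  have d6 := ne_of_not_limit isSplitPair_N2 not_limit_F_N2
  have d7 := ne_of_not_limit isSplitPair_N3 not_limit_F_N3
  have d8 := ne_of_not_limit isSplitPair_N2 not_limit_N1_N2
  have d9 := ne_of_not_limit isSplitPair_N3 not_limit_N1_N3
  induction h with
  | single h =>
    simp only [digraphGamma] at h
    tauto
  | tail _ h ih =>
    simp only [digraphGamma] at h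
    grind

/-- Limits along different one-parameter groups need not compose to one, so each pair joined by a
path has its own flow. -/
theorem HasDirectedPath.isOneParameterLimit {G₁ G₂ : groupsQ} (h : HasDirectedPath G₁ G₂) :
    IsOneParameterLimit G₂.1 G₁.1 := by
  have key : ∀ {L : Subgroup SL3}, IsOneParameterLimit (conjSubgroup 1 L) groupC →
      IsOneParameterLimit L groupC := fun {L} h => by rwa [conjSubgroup_one] at h
  obtain ⟨e, h | h | h | h⟩ | ⟨e, h | h | h⟩ | ⟨e, h | h⟩ := h.cases <;> rw [e, h]
  · exact key (limit_conj_C_F 1⁻¹).of_conj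
  · exact key (limit_conj_C_N1 1⁻¹).of_conj
  · exact key (limit_conj_C_N2 1⁻¹).of_conj
  · exact key (limit_conj_C_N3 1⁻¹).of_conj
  · exact limit_F_N1
  · exact limit_F_N2
  · exact limit_F_N3
  · exact limit_N1_N2
  · exact limit_N1_N3

theorem hasDirectedPath_of_isConjugacyLimit {G₁ G₂ : groupsQ} (hne : G₁ ≠ G₂)
    (h : IsConjugacyLimit G₂.1 G₁.1) : HasDirectedPath G₁ G₂ := by
  obtain ⟨G₁, h₁⟩ := G₁
  obtain ⟨G₂, h₂⟩ := G₂
  have hF : groupF ∈ groupsQ := by simp [groupsQ]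
  have hN1 : groupN1 ∈ groupsQ := by simp [groupsQ]
  have a1 : ∀ h₁ h₂, digraphGamma.Adj ⟨groupC, h₁⟩ ⟨groupF, h₂⟩ := fun _ _ => Or.inl ⟨rfl, rfl⟩
  have a2 : ∀ h₁ h₂, digraphGamma.Adj ⟨groupF, h₁⟩ ⟨groupN1, h₂⟩ := fun _ _ =>
    Or.inr (Or.inl ⟨rfl, rfl⟩)
  have a3 : ∀ h₁ h₂, digraphGamma.Adj ⟨groupN1, h₁⟩ ⟨groupN2, h₂⟩ := fun _ _ =>
    Or.inr (Or.inr (Or.inl ⟨rfl, rfl⟩))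
  have a4 : ∀ h₁ h₂, digraphGamma.Adj ⟨groupN1, h₁⟩ ⟨groupN3, h₂⟩ := fun _ _ =>
    Or.inr (Or.inr (Or.inr ⟨rfl, rfl⟩))
  have hC1 : ∀ h₁, HasDirectedPath ⟨groupC, h₁⟩ ⟨groupN1, hN1⟩ := fun h₁ =>
    (Relation.TransGen.single (a1 h₁ hF)).tail (a2 hF hN1)
  have hF1 : ∀ h₁, HasDirectedPath ⟨groupF, h₁⟩ ⟨groupN1, hN1⟩ := fun h₁ =>
    Relation.TransGen.single (a2 h₁ hN1)
  dsimp only at h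
  rcases id h₁ with rfl | rfl | rfl | rfl | rfl <;> rcases id h₂ with rfl | rfl | rfl | rfl | rfl <;>
    first
      | exact absurd rfl hne
      | exact absurd h not_limit_C_F
      | exact absurd h not_limit_C_N1
      | exact absurd h not_limit_C_N2
      | exact absurd h not_limit_C_N3
      | exact absurd h not_limit_F_N1
      | exact absurd h not_limit_F_N2
      | exact absurd h not_limit_F_N3
      | exact absurd h not_limit_N1_N2
      | exact absurd h not_limit_N1_N3
      | exact absurd h not_limit_N2_N3
      | exact absurd h not_limit_N3_N2
      | exact Relation.TransGen.single (a1 _ _)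
      | exact hC1 _
      | exact (hC1 _).tail (a3 _ _)
      | exact (hC1 _).tail (a4 _ _)
      | exact hF1 _
      | exact (hF1 _).tail (a3 _ _)
      | exact (hF1 _).tail (a4 _ _)
      | exact Relation.TransGen.single (a3 _ _)
      | exact Relation.TransGen.single (a4 _ _)

theorem theorem1p1 :
    (∀ H : Subgroup SL3, IsIsomorphicToPlane H → ∃! G : groupsQ, IsConjugateTo H G.1) ∧
    (∀ G₁ G₂ : groupsQ, G₁ ≠ G₂ →
      (IsConjugacyLimit G₂.1 G₁.1 ↔ HasDirectedPath G₁ G₂)) ∧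
    (∀ G : Subgroup SL3, IsConjugacyLimit G groupC → IsOneParameterLimit G groupC) ∧
    (∀ G₁ G₂ : groupsQ, HasDirectedPath G₁ G₂ → IsOneParameterLimit G₂.1 G₁.1) := by
  refine ⟨fun H hH => ?_, fun G₁ G₂ hne => ⟨hasDirectedPath_of_isConjugacyLimit hne, fun h =>
    h.isOneParameterLimit.isConjugacyLimit⟩, fun G hG => hG.isOneParameterLimit, fun G₁ G₂ h =>
    h.isOneParameterLimit⟩
  obtain ⟨G, hG, h⟩ := hH.exists_conj
  refine ⟨⟨G, hG⟩, h, fun G' h' => Subtype.ext ?_⟩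
  exact eq_of_limit_of_limit G'.2 hG (h'.isConjugacyLimit hG h) (h.isConjugacyLimit G'.2 h')
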